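/- Let $T>0$, $L>0$, $\kappa\in(0,1)$, $\delta\in(0,\tfrac12)$, and let $n\ge 3$ be an integer with $n>\tfrac34\left(\tfrac1\kappa-1\right)$. Put $\mathfrak B=\mathbb R\times[-1,1]$ and $\Omega=(0,L)\times(-1,1)$, with coordinates $(x,y)$, $e_x=(1,0)$ and $\nabla^\perp\psi=(-\partial_y\psi,\partial_x\psi)$. Let $u_b\in L^2_{\mathrm{div}}(\mathfrak B)$, the space of square integrable divergence free vector fields on $\mathfrak B$ tangent to $\partial\mathfrak B$. Fix the following functions. * $h\in C^\infty([0,\infty))$ with $\operatorname{supp}h\subset(0,T/3]\cup[2T/3,T)$, $\int_0^{T/3}h(t)\,dt=2L$ and $\int_0^T t^kh(t)\,dt=0$ for $0\le k<n$. For a field $a$ on $\mathfrak B$, let $(\tau_ha)(t,x,y)=a\left(x-\int_0^th(s)\,ds,\,y\right)$. * $\varphi\in C^\infty([-1,1];[0,1])$ with $\varphi(\pm1)=0$ and $|\varphi'(y)|=1$ for $|y|\ge\tfrac14$; $\chi\in C^\infty([-1,1];[0,1])$ with $\chi=1$ for $|y|\ge\tfrac23$ and $\chi=0$ for $|y|\le\tfrac13$;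 $\chi_\delta\in C^\infty([-1,1];[0,1])$ with $\chi_\delta=1$ for $|y|\le1-2\delta$ and $\chi_\delta=0$ for $|y|\ge1-\delta$; $\beta\in C^\infty([0,\infty);[0,1])$ non-increasing with $\beta=1$ on $[0,T/3]$ and $\beta=0$ on $[2T/3,\infty)$. * $V(t,z)$ is the classical solution, bounded on bounded time intervals, of $\partial_tV-\partial_{zz}V=0$ for $t,z>0$ with $V(t,0)=h(t)$ and $V(0,z)=0$. * For $\varepsilon>0$, $W^\varepsilon(t,y)$ is the classical solution of $\partial_tW^\varepsilon-\varepsilon\partial_{yy}W^\varepsilon=f_W^\varepsilon$ on $[0,\infty)\times[-1,1]$ with $W^\varepsilon(t,\pm1)=0$ and $W^\varepsilon(0,\cdot)=0$, where $$f_W^\varepsilon(t,y)=-\frac{\chi''(y)}{\varphi(y)^2}\,z^2V(t,z)-\frac{2\chi'(y)\varphi'(y)}{\varphi(y)^3}\,z^3\partial_zV(t,z)\quad\text{at } z=\frac{\varphi(y)}{\sqrt\varepsilon}.$$ * $\psi_b(x,y)=-\int_{-1}^yu_b(x,y')\cdot e_x\,dy'$, and $u^1(t)=\beta(t)\,\tau_h\nabla^\perp[\chi_\delta\psi_b]+\tau_h\nabla^\perp[(1-\chi_\delta)\psi_b]$,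 with $\nabla^\perp$ in the sense of distributions. Define the approximate trajectory $$u^\varepsilon_{\mathrm{app}}(t,x,y)=h(t)e_x-\chi(y)\,V\!\left(t,\frac{\varphi(y)}{\sqrt\varepsilon}\right)e_x+\varepsilon u^1(t,x,y)+\varepsilon^2W^\varepsilon(t,y)e_x .$$ **Proposition.** There is a constant $C_\delta>0$ which depends only on the norm of $\chi_\delta$ in $H^1(-1,1)$, and a constant $C_{\mathrm{app}}>0$ which does not depend on $\varepsilon$ (but may depend on all the other data), such that for all sufficiently small $\varepsilon>0$ the field $u^\varepsilon_{\mathrm{app}}(T/\varepsilon^\kappa)$ is square integrable on $\Omega$ and $$\frac1\varepsilon\left\|u^\varepsilon_{\mathrm{app}}(T/\varepsilon^\kappa)\right\|_{L^2(\Omega)}\le C_{\mathrm{app}}\left(\varepsilon^{\frac14}+\varepsilon^{\kappa\left(n-\frac34\left(\frac1\kappa-1\right)\right)}|\ln\varepsilon|^{n+\frac34}\right)+C_\delta\left\|u_b\right\|_{L^2(\mathfrak B\cap\{|y|\ge1-2\delta\})}.$$ -/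

import Mathlib

open MeasureTheory Set
open scoped ContDiff

noncomputable section

namespace ApproxTrajectory

/-- Values of planar vector fields, with the Euclidean norm. -/
abbrev E2 : Type := EuclideanSpace ℝ (Fin 2)

/-- The unit vector `e_x`. -/
def ex : E2 := EuclideanSpace.single 0 1

/-- The closed interval `[-1,1]` of vertical positions. -/
def I : Set ℝ := Icc (-1) 1

/-- The band `ℝ × [-1,1]`. -/
def band : Set (ℝ × ℝ) := univ ×ˢ Icc (-1) 1

/-- The interior `ℝ × (-1,1)` of the band. -/
def openBand : Set (ℝ × ℝ) := univ ×ˢ Ioo (-1) 1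

/-- The physical domain `Ω = (0,L) × (-1,1)`. -/
def Omega (L : ℝ) : Set (ℝ × ℝ) := Ioo 0 L ×ˢ Ioo (-1) 1

/-- The part `|y| ≥ 1 - 2δ` of the band. -/
def edgeStrips (δ : ℝ) : Set (ℝ × ℝ) := {p | p ∈ band ∧ 1 - 2 * δ ≤ |p.2|}

/-- The `L²` norm of a vector field over a set of the plane. -/
def normL2 (u : ℝ × ℝ → E2) (S : Set (ℝ × ℝ)) : ℝ :=
  (eLpNorm u 2 (volume.restrict S)).toReal

/-- The derivative of a function on `[-1,1]` (one-sided at the end points). -/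
def dI (f : ℝ → ℝ) : ℝ → ℝ := derivWithin f I

/-- The norm of `H¹(-1,1)`. -/
def normH1 (f : ℝ → ℝ) : ℝ :=
  Real.sqrt (∫ y in (-1)..1, (f y ^ 2 + dI f y ^ 2))

/-- `L²_div` of the band: square integrable fields whose integral against the gradient of every
test function on the plane vanishes. Test functions need not vanish on the boundary of the band,
so this says that the field is divergence free and tangent to the boundary. -/
structure IsL2div (u : ℝ × ℝ → E2) : Prop where
  memLp : MemLp u 2 (volume.restrict band)
  div_free : ∀ q : ℝ × ℝ → ℝ, ContDiff ℝ ∞ q → HasCompactSupport q →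
    ∫ p in band, (u p 0 * fderiv ℝ q p (1, 0) + u p 1 * fderiv ℝ q p (0, 1)) = 0

/-- `g = ∇^⊥ ψ = (-∂_y ψ, ∂_x ψ)` in the sense of distributions in the open band. -/
structure IsPerpGrad (ψ : ℝ × ℝ → ℝ) (g : ℝ × ℝ → E2) : Prop where
  loc_int : LocallyIntegrableOn ψ openBand
  loc_int_grad : LocallyIntegrableOn g openBand
  fst : ∀ θ : ℝ × ℝ → ℝ, ContDiff ℝ ∞ θ → HasCompactSupport θ → tsupport θ ⊆ openBand →
    ∫ p in openBand, g p 0 * θ p = ∫ p in openBand, ψ p * fderiv ℝ θ p (0, 1)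
  snd : ∀ θ : ℝ × ℝ → ℝ, ContDiff ℝ ∞ θ → HasCompactSupport θ → tsupport θ ⊆ openBand →
    ∫ p in openBand, g p 1 * θ p = -∫ p in openBand, ψ p * fderiv ℝ θ p (1, 0)

/-- The base flow `h`: smooth on `[0,∞)`, with closed support in `(0,T/3] ∪ [2T/3,T)`,
flux `2L` over the first third, and `n` vanishing moments. -/
structure IsBaseFlow (T L : ℝ) (n : ℕ) (h : ℝ → ℝ) : Prop where
  smooth : ContDiffOn ℝ ∞ h (Ici 0)
  supp : closure {t | 0 ≤ t ∧ h t ≠ 0} ⊆ Ioc 0 (T / 3) ∪ Ico (2 * T / 3) T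
  flux : ∫ t in (0)..(T / 3), h t = 2 * L
  moments : ∀ k : ℕ, k < n → ∫ t in (0)..T, t ^ k * h t = 0

/-- The function `φ`, which is the distance to `{-1,1}` for `|y| ≥ 1/4`. -/
structure IsBoundaryDistance (φ : ℝ → ℝ) : Prop where
  smooth : ContDiffOn ℝ ∞ φ I
  range : ∀ y ∈ I, φ y ∈ Icc (0 : ℝ) 1
  left : φ (-1) = 0
  right : φ 1 = 0
  slope : ∀ y ∈ I, 1 / 4 ≤ |y| → |dI φ y| = 1

/-- The cut-off `χ`, localising near the boundary. -/
structure IsBoundaryCutoff (χ : ℝ → ℝ) : Prop where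
  smooth : ContDiffOn ℝ ∞ χ I
  range : ∀ y ∈ I, χ y ∈ Icc (0 : ℝ) 1
  eq_one : ∀ y ∈ I, 2 / 3 ≤ |y| → χ y = 1
  eq_zero : ∀ y ∈ I, |y| ≤ 1 / 3 → χ y = 0

/-- The time cut-off `β`. -/
structure IsTimeCutoff (T : ℝ) (β : ℝ → ℝ) : Prop where
  smooth : ContDiffOn ℝ ∞ β (Ici 0)
  range : ∀ t, 0 ≤ t → β t ∈ Icc (0 : ℝ) 1
  antitone : AntitoneOn β (Ici 0)
  eq_one : ∀ t, 0 ≤ t → t ≤ T / 3 → β t = 1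
  eq_zero : ∀ t, 2 * T / 3 ≤ t → β t = 0

/-- The cut-off `χ_δ`, localising away from the boundary. -/
structure IsInteriorCutoff (δ : ℝ) (χδ : ℝ → ℝ) : Prop where
  smooth : ContDiffOn ℝ ∞ χδ I
  range : ∀ y ∈ I, χδ y ∈ Icc (0 : ℝ) 1
  eq_one : ∀ y ∈ I, |y| ≤ 1 - 2 * δ → χδ y = 1
  eq_zero : ∀ y ∈ I, 1 - δ ≤ |y| → χδ y = 0

/-- The boundary layer profile: `V` is the classical solution, bounded on bounded time intervals,
of `∂_t V - ∂_zz V = 0` on the quarter plane with `V(t,0) = h(t)` and `V(0,z) = 0`.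
Boundedness is what makes the solution unique. -/
structure IsLayerProfile (h : ℝ → ℝ) (V : ℝ → ℝ → ℝ) : Prop where
  cont : ContinuousOn (fun p : ℝ × ℝ => V p.1 p.2) (Ici 0 ×ˢ Ici 0)
  bdd : ∀ τ : ℝ, ∃ M : ℝ, ∀ t ∈ Icc 0 τ, ∀ z, 0 ≤ z → |V t z| ≤ M
  smooth_space : ∀ t, 0 < t → ContDiffOn ℝ 2 (V t) (Ioi 0)
  heat : ∀ t, 0 < t → ∀ z, 0 < z → HasDerivAt (fun s => V s z) (deriv (deriv (V t)) z) t
  boundary : ∀ t, 0 ≤ t → V t 0 = h t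
  initial : ∀ z, 0 ≤ z → V 0 z = 0

/-- The source
`f_W = -(χ''/φ²) {z² V} - 2 (χ'/φ³) φ' {z³ ∂_z V}`, where `{·}` is evaluation at
`z = φ(y)/√ε`. Both terms vanish for `|y| ≤ 1/3`, and for `|y| ≥ 2/3`. -/
def sourceW (φ χ : ℝ → ℝ) (V : ℝ → ℝ → ℝ) (ε t y : ℝ) : ℝ :=
  (fun z : ℝ =>
    -(dI (dI χ) y / φ y ^ 2 * (z ^ 2 * V t z))
      - 2 * (dI χ y / φ y ^ 3) * dI φ y * (z ^ 3 * deriv (V t) z)) (φ y / Real.sqrt ε)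

/-- The technical profile: `W` is the classical solution of `∂_t W - ε ∂_yy W = f_W` on
`[0,∞) × [-1,1]` with zero initial and boundary values. -/
structure IsTechnicalProfile (φ χ : ℝ → ℝ) (V : ℝ → ℝ → ℝ) (ε : ℝ) (W : ℝ → ℝ → ℝ) : Prop where
  cont : ContinuousOn (fun p : ℝ × ℝ => W p.1 p.2) (Ici 0 ×ˢ I)
  smooth_space : ∀ t, 0 < t → ContDiffOn ℝ 2 (W t) (Ioo (-1) 1)
  heat : ∀ t, 0 < t → ∀ y ∈ Ioo (-1 : ℝ) 1,
    HasDerivAt (fun s => W s y) (ε * deriv (deriv (W t)) y + sourceW φ χ V ε t y) t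
  left : ∀ t, 0 ≤ t → W t (-1) = 0
  right : ∀ t, 0 ≤ t → W t 1 = 0
  initial : ∀ y ∈ I, W 0 y = 0

/-- The stream function `ψ_b(x,y) = -∫_{-1}^y u_b(x,y') · e_x dy'`. -/
def streamFunction (ub : ℝ × ℝ → E2) (p : ℝ × ℝ) : ℝ :=
  -∫ y' in (-1)..p.2, ub (p.1, y') 0

/-- Translation `τ_h` along the base flow. -/
def translate (h : ℝ → ℝ) (a : ℝ × ℝ → E2) (t : ℝ) (p : ℝ × ℝ) : E2 :=
  a (p.1 - ∫ s in (0)..t, h s, p.2)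

/-- `u¹ = β(t) τ_h g + τ_h g'`, where `g = ∇^⊥[χ_δ ψ_b]` and `g' = ∇^⊥[(1-χ_δ) ψ_b]`. -/
def profileOne (h β : ℝ → ℝ) (g g' : ℝ × ℝ → E2) (t : ℝ) (p : ℝ × ℝ) : E2 :=
  β t • translate h g t p + translate h g' t p

/-- `u_app^ε = u⁰(t) + χ(y) v⁰(t, φ(y)/√ε) + ε u¹(t,x,y) + ε² w^ε(t,y)` with `u⁰ = h e_x`,
`v⁰ = -V e_x` and `w^ε = W e_x`. -/
def uAppFormula (h φ χ : ℝ → ℝ) (V W : ℝ → ℝ → ℝ) (u1 : ℝ → ℝ × ℝ → E2)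
    (ε t : ℝ) (p : ℝ × ℝ) : E2 :=
  h t • ex + χ p.2 • (-V t (φ p.2 / Real.sqrt ε)) • ex + ε • u1 t p + ε ^ 2 • W t p.2 • ex

/-- `u` is the approximate trajectory `u_app^ε` built from the data `h, φ, χ, β, χ_δ, u_b`. Each
of `V`, `W` is determined by its equation, and `g`, `g'` are determined almost everywhere. -/
def IsUApp (h φ χ β χδ : ℝ → ℝ) (ub : ℝ × ℝ → E2) (ε : ℝ) (u : ℝ → ℝ × ℝ → E2) : Prop :=
  ∃ (V W : ℝ → ℝ → ℝ) (g g' : ℝ × ℝ → E2),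
    IsLayerProfile h V ∧ IsTechnicalProfile φ χ V ε W ∧
    IsPerpGrad (fun p => χδ p.2 * streamFunction ub p) g ∧
    IsPerpGrad (fun p => (1 - χδ p.2) * streamFunction ub p) g' ∧
    u = uAppFormula h φ χ V W (profileOne h β g g') ε

end ApproxTrajectory

end

open ApproxTrajectory

noncomputable section

namespace ApproxTrajectory

open Filter Topology

/-! ### Maximum principles for the heat equation -/

/-! At the time `t = T / ε ^ κ`, which is at least `2 * T` for small `ε`, most of the trajectory has
disappeared: the base flow is off, its total displacement is the zeroth moment of `h` and hence
zero, and `β` has switched off the interior part of `u¹`. Three terms remain, and each is divided by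
`ε`.

The boundary layer. The maximum principle on the quarter plane makes `V` unique, so `V` is the
explicit potential `z / (2√π) ∫ h(s) (t-s)^(-3/2) exp(-z²/(4(t-s))) ds`. Each vanishing moment
allows one integration by parts in `s`, which gains a factor `1/t`; hence `|V| ≤ C t^(-1-n)
exp(-z²/(16t))` (`exists_abs_layerProfile_le`). In the variable `y` this is a Gaussian of width
`√(εt)` at each wall, with `L²` norm of order `t^(-1-n) (εt)^(1/4)`. Division by `ε` produces
exactly the power `ε^(κ(n - 3/4(1/κ - 1)))`; the logarithm of the claim is not needed and is bounded
below by `1`.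

The technical profile. Its source lives where `φ ≥ 1/3`, that is `z ≥ 1/(3√ε)`, and there the heat
kernel is smaller than any power `(εt)^m`. The maximum principle bounds `W` by the elapsed time
times the supremum of the source (`exists_abs_technicalProfile_le`), and a large `m` makes this
negligible.

The boundary part of `u¹`. For `A = 1 - χ_δ` one has `∇^⊥[A ψ_b] = (A' P + A u_b·e_x, A u_b·e_y)`,
where `P = -ψ_b` is the vertical primitive of `u_b·e_x`. The second component uses that `u_b` is
divergence free. The flux of `u_b` through almost every section is zero, because it is a square
integrable function of `x` with vanishing weak derivative. So `P` can be computed from the nearer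
wall, and where `A' ≠ 0` it involves only values of `u_b` with `|y| ≥ 1 - 2δ`. By Cauchy-Schwarz the
norm is at most `(1 + ‖χ_δ‖_{H¹})` times that of `u_b` on the strips. -/

theorem second_deriv_nonpos_of_isLocalMax {f f₁ : ℝ → ℝ} {x c : ℝ} (hf : IsLocalMax f x)
    (h₁ : ∀ᶠ y in 𝓝 x, HasDerivAt f (f₁ y) y) (h₂ : HasDerivAt f₁ c x) : c ≤ 0 := by
  by_contra! hc
  have e : deriv f =ᶠ[𝓝 x] f₁ := h₁.mono fun y hy => hy.deriv
  have hdd : deriv (deriv f) x = c := e.deriv_eq.trans h₂.deriv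
  -- If `c > 0`, the second derivative test makes `x` a local minimum as well, so `f` is locally
  -- constant and `c = 0`.
  have hmin : IsLocalMin f x := isLocalMin_of_deriv_deriv_pos (by rw [hdd]; exact hc)
    hf.deriv_eq_zero h₁.self_of_nhds.continuousAt
  have hcst : f =ᶠ[𝓝 x] fun _ => f x := by
    filter_upwards [hf, hmin] with y h1 h2 using le_antisymm h1 h2
  have : deriv (deriv f) x = 0 := by
    rw [hcst.deriv.deriv_eq]
    simp
  linarith

/-- `w` is a classical subsolution of `∂_t w = ε ∂_yy w` at times `0 < t ≤ τ`, for `y` in `s`. -/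
def IsHeatSubsolution (ε τ : ℝ) (s : Set ℝ) (w : ℝ → ℝ → ℝ) : Prop :=
  ∀ t ∈ Ioc 0 τ, ∃ w₁ : ℝ → ℝ, ∀ y ∈ s, HasDerivAt (w t) (w₁ y) y ∧
    ∃ wt w₂, HasDerivAt (fun r => w r y) wt t ∧ HasDerivAt w₁ w₂ y ∧ wt ≤ ε * w₂

/-- Subtracting `η t` makes the subsolution strict: at a maximum of `w - η t` off the parabolic
boundary, `∂_t w ≥ η` while `∂_yy w ≤ 0`. Then `η → 0`. -/
theorem nonpos_of_isHeatSubsolution {ε τ a b : ℝ} (hε : 0 ≤ ε) {w : ℝ → ℝ → ℝ}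
    (hc : ContinuousOn (fun p : ℝ × ℝ => w p.1 p.2) (Icc 0 τ ×ˢ Icc a b))
    (hw : IsHeatSubsolution ε τ (Ioo a b) w)
    (h0 : ∀ y ∈ Icc a b, w 0 y ≤ 0) (ha : ∀ t ∈ Icc 0 τ, w t a ≤ 0)
    (hb : ∀ t ∈ Icc 0 τ, w t b ≤ 0) : ∀ t ∈ Icc 0 τ, ∀ y ∈ Icc a b, w t y ≤ 0 := by
  intro t ht y hy
  have key : ∀ η : ℝ, 0 < η → w t y ≤ η * t := by
    intro η hη
    have hcont : ContinuousOn (fun p : ℝ × ℝ => w p.1 p.2 - η * p.1) (Icc 0 τ ×ˢ Icc a b) :=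
      hc.sub (by fun_prop)
    obtain ⟨⟨t₀, y₀⟩, ⟨ht₀, hy₀⟩, hmax⟩ :=
      (isCompact_Icc.prod isCompact_Icc).exists_isMaxOn ⟨(t, y), ht, hy⟩ hcont
    simp only at ht₀ hy₀
    have hle : ∀ r ∈ Icc 0 τ, ∀ z ∈ Icc a b, w r z - η * r ≤ w t₀ y₀ - η * t₀ :=
      fun r hr z hz => hmax (show (r, z) ∈ Icc 0 τ ×ˢ Icc a b from ⟨hr, hz⟩)
    have hty := hle t ht y hy
    have hηt₀ : 0 ≤ η * t₀ := mul_nonneg hη.le ht₀.1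
    rcases eq_or_lt_of_le ht₀.1 with h | htpos
    · have := h0 y₀ hy₀
      rw [← h] at hty
      linarith
    rcases eq_or_lt_of_le hy₀.1 with h | hya
    · have := ha t₀ ht₀
      rw [← h] at hty
      linarith
    rcases eq_or_lt_of_le hy₀.2 with h | hyb
    · have := hb t₀ ht₀
      rw [h] at hty
      linarith
    exfalso
    obtain ⟨w₁, H⟩ := hw t₀ ⟨htpos, ht₀.2⟩
    obtain ⟨-, wt, w₂, hwt, hw₂, hineq⟩ := H y₀ ⟨hya, hyb⟩
    have hlm : IsLocalMax (w t₀) y₀ := by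
      filter_upwards [Ioo_mem_nhds hya hyb] with z hz
      have := hle t₀ ht₀ z ⟨hz.1.le, hz.2.le⟩
      linarith
    have hw₂' : w₂ ≤ 0 := second_deriv_nonpos_of_isLocalMax hlm
      (by filter_upwards [Ioo_mem_nhds hya hyb] with z hz using (H z hz).1) hw₂
    -- The maximum may sit at the final time `τ`, so only earlier times are compared.
    have hslope : η ≤ wt := by
      have hd : HasDerivWithinAt (fun r => w r y₀) wt (Iio t₀) t₀ := hwt.hasDerivWithinAt
      rw [hasDerivWithinAt_iff_tendsto_slope' (by simp)] at hd
      refine ge_of_tendsto hd ?_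
      filter_upwards [Ioo_mem_nhdsLT htpos] with r hr
      have := hle r ⟨hr.1.le, hr.2.le.trans ht₀.2⟩ y₀ hy₀
      rw [slope_def_field, le_div_iff_of_neg (by linarith [hr.2])]
      linarith
    have := mul_nonneg hε (neg_nonneg.2 hw₂')
    linarith
  have hlim : Tendsto (fun η : ℝ => η * t) (𝓝[>] 0) (𝓝 0) := by
    have : Tendsto (fun η : ℝ => η * t) (𝓝 0) (𝓝 (0 * t)) := tendsto_id.mul_const t
    rw [zero_mul] at this
    exact this.mono_left nhdsWithin_le_nhds
  exact ge_of_tendsto hlim (by filter_upwards [self_mem_nhdsWithin] with η hη using key η hη)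

theorem hasDerivAt_of_contDiffOn_two {f : ℝ → ℝ} {s : Set ℝ} (hs : IsOpen s)
    (hf : ContDiffOn ℝ 2 f s) {y : ℝ} (hy : y ∈ s) :
    HasDerivAt f (deriv f y) y ∧ HasDerivAt (deriv f) (deriv (deriv f) y) y := by
  have h1 : ContDiffOn ℝ 1 (deriv f) s :=
    ((contDiffOn_succ_iff_deriv_of_isOpen (n := 1) hs).1
      (by simpa [one_add_one_eq_two] using hf)).2.2
  exact ⟨((hf.differentiableOn (by norm_num)).differentiableAt (hs.mem_nhds hy)).hasDerivAt,
    ((h1.differentiableOn (by norm_num)).differentiableAt (hs.mem_nhds hy)).hasDerivAt⟩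

/-- A bounded subsolution on the quarter plane which is nonpositive on the parabolic boundary is
nonpositive. -/
theorem nonpos_of_isHeatSubsolution_quarterPlane {τ M : ℝ} {w : ℝ → ℝ → ℝ}
    (hc : ContinuousOn (fun p : ℝ × ℝ => w p.1 p.2) (Ici 0 ×ˢ Ici 0))
    (hw : IsHeatSubsolution 1 τ (Ioi 0) w) (hM : ∀ t ∈ Icc 0 τ, ∀ z, 0 ≤ z → w t z ≤ M)
    (h0 : ∀ z, 0 ≤ z → w 0 z ≤ 0) (hbd : ∀ t ∈ Icc 0 τ, w t 0 ≤ 0) :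
    ∀ t ∈ Icc 0 τ, ∀ z, 0 ≤ z → w t z ≤ 0 := by
  intro t ht z hz
  set N := max M 0
  -- The barrier `k (z² + 2t)` solves the heat equation, is nonnegative on the parabolic boundary
  -- and reaches `N ≥ M` at `z = R`. Its coefficient `N / R²` tends to zero as `R → ∞`.
  have key : ∀ R : ℝ, 0 < R → z ≤ R → w t z ≤ N / R ^ 2 * (z ^ 2 + 2 * t) := by
    intro R hR hzR
    set k := N / R ^ 2
    have hk : 0 ≤ k := by positivity
    have := nonpos_of_isHeatSubsolution (ε := 1) (τ := τ) (a := 0) (b := R) zero_le_one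
      (w := fun t z => w t z - k * (z ^ 2 + 2 * t)) ?_ ?_ ?_ ?_ ?_ t ht z ⟨hz, hzR⟩
    · linarith
    · refine (hc.mono ?_).sub (by fun_prop)
      exact prod_mono (fun x hx => hx.1) (fun x hx => hx.1)
    · intro r hr
      obtain ⟨w₁, H⟩ := hw r hr
      refine ⟨fun z => w₁ z - k * (2 * z), fun y hy => ?_⟩
      obtain ⟨hd, wt, w₂, hwt, hw₂, hle⟩ := H y hy.1
      refine ⟨?_, wt - k * 2, w₂ - k * 2, ?_, ?_, by linarith⟩
      · refine hd.sub (HasDerivAt.const_mul k ?_)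
        simpa using (hasDerivAt_pow 2 y).add_const (2 * r)
      · refine hwt.sub (HasDerivAt.const_mul k ?_)
        simpa using ((hasDerivAt_id r).const_mul 2).const_add (y ^ 2)
      · refine hw₂.sub (HasDerivAt.const_mul k ?_)
        simpa using (hasDerivAt_id y).const_mul 2
    · intro y hy
      have := h0 y hy.1
      have : 0 ≤ k * (y ^ 2 + 2 * 0) := by positivity
      linarith
    · intro r hr
      have := hbd r hr
      have : 0 ≤ k * (0 ^ 2 + 2 * r) := by have := hr.1; positivity
      linarith
    · intro r hr
      have h1 : w r R ≤ N := (hM r hr R hR.le).trans (le_max_left _ _)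
      have h2 : k * R ^ 2 = N := div_mul_cancel₀ _ (by positivity)
      have h3 : 0 ≤ k * (2 * r) := by have := hr.1; positivity
      linarith
  have hlim : Tendsto (fun R : ℝ => N / R ^ 2 * (z ^ 2 + 2 * t)) atTop (𝓝 (0 * (z ^ 2 + 2 * t))) :=
    (tendsto_const_nhds.div_atTop (tendsto_pow_atTop two_ne_zero)).mul_const _
  rw [zero_mul] at hlim
  refine ge_of_tendsto hlim ?_
  filter_upwards [eventually_gt_atTop 0, eventually_ge_atTop z] with R h1 h2 using key R h1 h2

/-- Two layer profiles with the same data coincide. -/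
theorem IsLayerProfile.unique {h : ℝ → ℝ} {V U : ℝ → ℝ → ℝ} (hV : IsLayerProfile h V)
    (hU : IsLayerProfile h U) {t z : ℝ} (ht : 0 ≤ t) (hz : 0 ≤ z) : V t z = U t z := by
  have key : ∀ {V U : ℝ → ℝ → ℝ}, IsLayerProfile h V → IsLayerProfile h U → V t z ≤ U t z := by
    intro V U hV hU
    obtain ⟨M, hM⟩ := hV.bdd t
    obtain ⟨M', hM'⟩ := hU.bdd t
    have := nonpos_of_isHeatSubsolution_quarterPlane (τ := t) (M := M + M')
      (w := fun t z => V t z - U t z) (hV.cont.sub hU.cont) ?_ ?_ ?_ ?_ t ⟨ht, le_rfl⟩ z hz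
    · linarith
    · intro r hr
      refine ⟨fun y => deriv (V r) y - deriv (U r) y, fun y hy => ?_⟩
      have h1 := hasDerivAt_of_contDiffOn_two isOpen_Ioi (hV.smooth_space r hr.1) hy
      have h2 := hasDerivAt_of_contDiffOn_two isOpen_Ioi (hU.smooth_space r hr.1) hy
      exact ⟨h1.1.sub h2.1, _, _, (hV.heat r hr.1 y hy).sub (hU.heat r hr.1 y hy),
        h1.2.sub h2.2, by linarith⟩
    · intro r hr y hy
      have h1 := (abs_le.1 (hM r hr y hy)).2
      have h2 := (abs_le.1 (hM' r hr y hy)).1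
      linarith
    · intro y hy
      simp [hV.initial y hy, hU.initial y hy]
    · intro r hr
      simp [hV.boundary r hr.1, hU.boundary r hr.1]
  exact le_antisymm (key hV hU) (key hU hV)

/-- A solution of the heat equation on a strip with zero data is bounded by the time integral of a
bound on the source. -/
theorem abs_le_of_heat_source {ε τ M : ℝ} (hε : 0 ≤ ε) {W f : ℝ → ℝ → ℝ} {a b : ℝ}
    (hc : ContinuousOn (fun p : ℝ × ℝ => W p.1 p.2) (Icc 0 τ ×ˢ Icc a b))
    (hs : ∀ t ∈ Ioc 0 τ, ContDiffOn ℝ 2 (W t) (Ioo a b))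
    (hW : ∀ t ∈ Ioc 0 τ, ∀ y ∈ Ioo a b,
      HasDerivAt (fun s => W s y) (ε * deriv (deriv (W t)) y + f t y) t)
    (hf : ∀ t ∈ Ioc 0 τ, ∀ y ∈ Ioo a b, |f t y| ≤ M) (hM : 0 ≤ M)
    (h0 : ∀ y ∈ Icc a b, W 0 y = 0) (ha : ∀ t ∈ Icc 0 τ, W t a = 0)
    (hb : ∀ t ∈ Icc 0 τ, W t b = 0) :
    ∀ t ∈ Icc 0 τ, ∀ y ∈ Icc a b, |W t y| ≤ M * t := by
  intro t ht y hy
  have key : ∀ σ : ℝ, |σ| = 1 → σ * W t y ≤ M * t := by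
    intro σ hσ
    have := nonpos_of_isHeatSubsolution (τ := τ) (a := a) (b := b) hε
      (w := fun t z => σ * W t z - M * t) ?_ ?_ ?_ ?_ ?_ t ht y hy
    · linarith
    · exact (hc.const_mul σ).sub (by fun_prop)
    · intro r hr
      refine ⟨fun z => σ * deriv (W r) z, fun z hz => ?_⟩
      have h1 := hasDerivAt_of_contDiffOn_two isOpen_Ioo (hs r hr) hz
      refine ⟨(h1.1.const_mul σ).sub_const _, σ * (ε * deriv (deriv (W r)) z + f r z) - M,
        σ * deriv (deriv (W r)) z, ?_, h1.2.const_mul σ, ?_⟩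
      · exact ((hW r hr z hz).const_mul σ).sub (by simpa using (hasDerivAt_id r).const_mul M)
      · have : σ * f r z ≤ M := (le_abs_self _).trans (by
          rw [abs_mul, hσ, one_mul]; exact hf r hr z hz)
        linarith
    · intro z hz
      simp [h0 z hz]
    · intro r hr
      have := mul_nonneg hM hr.1
      simp only [ha r hr]; linarith
    · intro r hr
      have := mul_nonneg hM hr.1
      simp only [hb r hr]; linarith
  rw [abs_le]
  have h1 := key 1 (by simp)
  have h2 := key (-1) (by simp)
  constructor <;> linarith

/-! ### The heat kernel family -/

/-- The inequality `x / b ≤ exp (x / b)` raised to the power `b`; the sharp constant is not needed.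
-/
theorem rpow_mul_exp_neg_le {b x : ℝ} (hb : 0 < b) (hx : 0 ≤ x) :
    x ^ b * Real.exp (-x) ≤ b ^ b := by
  have h1 : x / b ≤ Real.exp (x / b) := by linarith [Real.add_one_le_exp (x / b)]
  have h2 : (x / b) ^ b ≤ Real.exp x := by
    refine (Real.rpow_le_rpow (by positivity) h1 hb.le).trans_eq ?_
    rw [← Real.exp_mul, div_mul_cancel₀ _ hb.ne']
  rw [Real.div_rpow hx hb.le, div_le_iff₀ (by positivity)] at h2
  calc x ^ b * Real.exp (-x) ≤ (Real.exp x * b ^ b) * Real.exp (-x) := by gcongr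
    _ = b ^ b * (Real.exp x * Real.exp (-x)) := by ring
    _ = b ^ b := by rw [← Real.exp_add]; simp

/-- The kernel `τ^{-a} e^{-w/τ}`, extended by zero to `τ ≤ 0`. -/
def heatQ (a τ w : ℝ) : ℝ := if 0 < τ then τ ^ (-a) * Real.exp (-(w / τ)) else 0

theorem heatQ_of_pos {a τ w : ℝ} (h : 0 < τ) :
    heatQ a τ w = τ ^ (-a) * Real.exp (-(w / τ)) := if_pos h

theorem heatQ_of_nonpos {a τ w : ℝ} (h : τ ≤ 0) : heatQ a τ w = 0 := if_neg h.not_gt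

theorem heatQ_nonneg (a τ w : ℝ) : 0 ≤ heatQ a τ w := by
  unfold heatQ
  split_ifs <;> positivity

/-- Part of the exponential is spent on an extra factor `(τ / w)^m`, which is monotone in `τ`. The
bound is therefore uniform over all `τ ≤ t`. Taking `m = 0` gives domination, `m = 2` flatness at `τ
= 0`, and large `m` smallness far from the wall. -/
theorem heatQ_le {a m τ t w : ℝ} (ha : 0 < a) (hm : 0 ≤ m) (hw : 0 < w) (hτ : τ ≤ t)
    (ht : 0 ≤ t) : heatQ a τ w ≤ (a + m) ^ (a + m) * w ^ (-a) * (t / w) ^ m := by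
  rcases le_or_gt τ 0 with h | h
  · rw [heatQ_of_nonpos h]
    positivity
  rw [heatQ_of_pos h]
  have h1 : τ ^ (-a) = (w / τ) ^ (a + m) * (w ^ (-a) * (τ / w) ^ m) := by
    rw [Real.div_rpow hw.le h.le, Real.div_rpow h.le hw.le, Real.rpow_add hw, Real.rpow_add h,
      Real.rpow_neg hw.le, Real.rpow_neg h.le]
    field_simp
  calc τ ^ (-a) * Real.exp (-(w / τ))
      = ((w / τ) ^ (a + m) * Real.exp (-(w / τ))) * (w ^ (-a) * (τ / w) ^ m) := by rw [h1]; ring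
    _ ≤ (a + m) ^ (a + m) * (w ^ (-a) * (t / w) ^ m) := by
        gcongr
        exact rpow_mul_exp_neg_le (by linarith) (by positivity)
    _ = _ := by ring

theorem heatQ_le_const {a τ w : ℝ} (ha : 0 < a) (hw : 0 < w) :
    heatQ a τ w ≤ a ^ a * w ^ (-a) := by
  simpa using heatQ_le (m := 0) ha le_rfl hw (le_max_left τ 0) (le_max_right τ 0)

/-- For `w > 0` the kernel is flat as `τ ↓ 0`, so its extension by zero is differentiable on the
whole line. Potentials can thus be written over the fixed interval `[0, T]` and differentiated in
`t` without a moving end point. -/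
theorem hasDerivAt_heatQ_time {a w : ℝ} (ha : 0 < a) (hw : 0 < w) (τ : ℝ) :
    HasDerivAt (fun r => heatQ a r w)
      (-a * heatQ (a + 1) τ w + w * heatQ (a + 2) τ w) τ := by
  rcases lt_trichotomy τ 0 with h | h | h
  · rw [heatQ_of_nonpos h.le, heatQ_of_nonpos h.le]
    simp only [mul_zero, add_zero]
    refine (hasDerivAt_const τ (0 : ℝ)).congr_of_eventuallyEq ?_
    filter_upwards [Iio_mem_nhds h] with r hr using heatQ_of_nonpos (le_of_lt hr)
  · subst h
    rw [heatQ_of_nonpos le_rfl, heatQ_of_nonpos le_rfl]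
    simp only [mul_zero, add_zero]
    have : HasFDerivAt (fun r => heatQ a r w) (0 : ℝ →L[ℝ] ℝ) 0 := by
      refine Asymptotics.IsBigO.hasFDerivAt (n := 2) ?_ one_lt_two
      refine Asymptotics.IsBigO.of_bound ((a + 2) ^ (a + 2) * w ^ (-a) * (1 / w) ^ (2 : ℝ)) ?_
      refine Eventually.of_forall fun r => ?_
      rw [Real.norm_of_nonneg (heatQ_nonneg _ _ _)]
      refine (heatQ_le (m := 2) ha zero_le_two hw (le_abs_self r) (abs_nonneg r)).trans_eq ?_
      rw [div_eq_mul_one_div |r| w, Real.mul_rpow (by positivity) (by positivity)]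
      simp
      ring
    simpa using this.hasDerivAt
  · have h1 : HasDerivAt (fun r : ℝ => r ^ (-a) * Real.exp (-(w / r)))
        (-a * heatQ (a + 1) τ w + w * heatQ (a + 2) τ w) τ := by
      have e1 : HasDerivAt (fun r : ℝ => r ^ (-a)) (-a * τ ^ (-a - 1)) τ :=
        Real.hasDerivAt_rpow_const (Or.inl h.ne')
      have e2 : HasDerivAt (fun r : ℝ => -(w / r)) (w / τ ^ 2) τ := by
        have := ((hasDerivAt_inv h.ne').const_mul w).neg
        simp only [div_eq_mul_inv]
        convert! this using 1
        ring
      convert! e1.mul e2.exp using 1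
      rw [heatQ_of_pos h, heatQ_of_pos h, show -(a + 1) = -a - 1 by ring,
        show -(a + 2) = -a - (2 : ℕ) by push_cast; ring, Real.rpow_sub_natCast h.ne']
      field_simp
    refine h1.congr_of_eventuallyEq ?_
    filter_upwards [Ioi_mem_nhds h] with r hr using heatQ_of_pos hr

theorem continuous_heatQ {a w : ℝ} (ha : 0 < a) (hw : 0 < w) :
    Continuous (fun r => heatQ a r w) :=
  continuous_iff_continuousAt.2 fun τ => (hasDerivAt_heatQ_time ha hw τ).continuousAt

theorem hasDerivAt_heatQ_space (a τ w : ℝ) :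
    HasDerivAt (fun v => heatQ a τ v) (-heatQ (a + 1) τ w) w := by
  rcases le_or_gt τ 0 with h | h
  · simp only [heatQ_of_nonpos h, neg_zero]
    exact hasDerivAt_const _ _
  · simp only [heatQ_of_pos h]
    have e2 : HasDerivAt (fun v : ℝ => -(v / τ)) (-(1 / τ)) w := ((hasDerivAt_id w).div_const τ).neg
    convert! e2.exp.const_mul (τ ^ (-a)) using 1
    rw [show -(a + 1) = -a - (1 : ℕ) by push_cast; ring, Real.rpow_sub_natCast h.ne']
    field_simp

theorem heatQ_scale {a c τ w : ℝ} (hc : 0 < c) :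
    heatQ a (c * τ) (c * w) = c ^ (-a) * heatQ a τ w := by
  rcases le_or_gt τ 0 with h | h
  · rw [heatQ_of_nonpos h, heatQ_of_nonpos (mul_nonpos_of_nonneg_of_nonpos hc.le h), mul_zero]
  · rw [heatQ_of_pos h, heatQ_of_pos (by positivity), Real.mul_rpow hc.le h.le,
      mul_div_mul_left _ _ hc.ne', mul_assoc]

/-- The substitution `θ ↦ 1/θ` gives `Γ(1/2)`. -/
theorem integral_heatQ_one : ∫ θ, heatQ (3 / 2) θ 1 = Real.sqrt Real.pi := by
  have h1 : ∫ θ, heatQ (3 / 2) θ 1 = ∫ θ in Ioi (0 : ℝ), heatQ (3 / 2) θ 1 := by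
    refine (setIntegral_eq_integral_of_forall_compl_eq_zero fun x hx => ?_).symm
    exact heatQ_of_nonpos (not_lt.1 hx)
  rw [h1, ← Real.Gamma_one_half_eq, Real.Gamma_eq_integral (by norm_num),
    ← integral_comp_rpow_Ioi (fun y => Real.exp (-y) * y ^ ((1 / 2 : ℝ) - 1))
      (show (-1 : ℝ) ≠ 0 by norm_num)]
  refine setIntegral_congr_fun measurableSet_Ioi fun x hx => ?_
  have hx : 0 < x := hx
  simp only [heatQ_of_pos hx, smul_eq_mul, Real.rpow_neg_one, abs_neg, abs_one, one_mul, one_div]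
  rw [Real.inv_rpow hx.le, ← Real.rpow_neg hx.le, mul_comm (Real.exp _), ← mul_assoc,
    ← Real.rpow_add hx]
  norm_num

theorem integrable_heatQ_one : Integrable fun θ => heatQ (3 / 2) θ 1 := by
  -- The integral of a non-integrable function is zero by convention, whereas this one equals `√π`.
  by_contra h
  have := integral_undef h
  rw [integral_heatQ_one] at this
  have : 0 < Real.sqrt Real.pi := Real.sqrt_pos.2 Real.pi_pos
  linarith

/-! ### Heat potentials of a boundary flux -/

/-- The potential `∫_0^T h(s) (t-s)^{-a} e^{-w/(t-s)} ds`. -/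
def heatPot (h : ℝ → ℝ) (T a t w : ℝ) : ℝ := ∫ s in (0)..T, h s * heatQ a (t - s) w

section Potential

variable {h : ℝ → ℝ} {T a t w : ℝ}

theorem intervalIntegrable_heatPot (hh : ContinuousOn h (uIcc 0 T)) (ha : 0 < a) (hw : 0 < w) :
    IntervalIntegrable (fun s => h s * heatQ a (t - s) w) volume 0 T := by
  apply ContinuousOn.intervalIntegrable
  exact hh.mul ((continuous_heatQ ha hw).comp (continuous_const.sub continuous_id)).continuousOn

theorem hasDerivAt_heatPot_time (hh : ContinuousOn h (uIcc 0 T)) (ha : 0 < a) (hw : 0 < w) :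
    HasDerivAt (fun r => heatPot h T a r w)
      (-a * heatPot h T (a + 1) t w + w * heatPot h T (a + 2) t w) t := by
  have hmeas : ∀ r, ∀ b, 0 < b → IntervalIntegrable (fun s => h s * heatQ b (r - s) w) volume 0 T :=
    fun r b hb => intervalIntegrable_heatPot hh hb hw
  have key := (intervalIntegral.hasDerivAt_integral_of_dominated_loc_of_deriv_le
    (μ := volume) (a := 0) (b := T) (s := univ) (x₀ := t)
    (F := fun r s => h s * heatQ a (r - s) w)
    (F' := fun r s => h s * (-a * heatQ (a + 1) (r - s) w + w * heatQ (a + 2) (r - s) w))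
    (bound := fun s => |h s| * (a * ((a + 1) ^ (a + 1) * w ^ (-(a + 1))) +
      w * ((a + 2) ^ (a + 2) * w ^ (-(a + 2)))))
    univ_mem ?_ ?_ ?_ ?_ ?_ ?_).2
  · convert! key using 1
    unfold heatPot
    rw [← intervalIntegral.integral_const_mul, ← intervalIntegral.integral_const_mul,
      ← intervalIntegral.integral_add ((hmeas t _ (by linarith)).const_mul _)
        ((hmeas t _ (by linarith)).const_mul _)]
    congr 1
    ext s
    ring
  · exact Eventually.of_forall fun r => (hmeas r a ha).aestronglyMeasurable_restrict_uIoc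
  · exact hmeas t a ha
  · have := ((hmeas t (a + 1) (by linarith)).const_mul (-a)).add
      ((hmeas t (a + 2) (by linarith)).const_mul w)
    refine this.aestronglyMeasurable_restrict_uIoc.congr (Eventually.of_forall fun s => ?_)
    ring
  · refine Eventually.of_forall fun s _ r _ => ?_
    rw [norm_mul, Real.norm_eq_abs]
    gcongr
    refine (norm_add_le _ _).trans ?_
    rw [norm_mul, norm_mul, norm_neg, Real.norm_of_nonneg ha.le, Real.norm_of_nonneg hw.le,
      Real.norm_of_nonneg (heatQ_nonneg _ _ _), Real.norm_of_nonneg (heatQ_nonneg _ _ _)]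
    gcongr
    · exact heatQ_le_const (by linarith) hw
    · exact heatQ_le_const (by linarith) hw
  · exact (hh.abs.mul continuousOn_const).intervalIntegrable
  · refine Eventually.of_forall fun s _ r _ => HasDerivAt.const_mul _ ?_
    simpa using (hasDerivAt_heatQ_time ha hw (r - s)).comp_sub_const r s

theorem hasDerivAt_heatPot_space (hh : ContinuousOn h (uIcc 0 T)) (ha : 0 < a) (hw : 0 < w) :
    HasDerivAt (fun v => heatPot h T a t v) (-heatPot h T (a + 1) t w) w := by
  have hmeas : ∀ b v, 0 < b → 0 < v →
      IntervalIntegrable (fun s => h s * heatQ b (t - s) v) volume 0 T :=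
    fun b v hb hv => intervalIntegrable_heatPot hh hb hv
  -- The kernel bound degenerates as `v → 0`, so domination is asked only on `v > w / 2`.
  have key := (intervalIntegral.hasDerivAt_integral_of_dominated_loc_of_deriv_le
    (μ := volume) (a := 0) (b := T) (s := Ioi (w / 2)) (x₀ := w)
    (F := fun v s => h s * heatQ a (t - s) v)
    (F' := fun v s => h s * (-heatQ (a + 1) (t - s) v))
    (bound := fun s => |h s| * ((a + 1) ^ (a + 1) * (w / 2) ^ (-(a + 1))))
    (Ioi_mem_nhds (by linarith)) ?_ ?_ ?_ ?_ ?_ ?_).2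
  · convert! key using 1
    unfold heatPot
    rw [← intervalIntegral.integral_neg]
    congr 1
    ext s
    ring
  · filter_upwards [Ioi_mem_nhds hw] with v hv
    exact (hmeas a v ha hv).aestronglyMeasurable_restrict_uIoc
  · exact hmeas a w ha hw
  · refine (hmeas (a + 1) w (by linarith) hw).neg.aestronglyMeasurable_restrict_uIoc.congr
      (Eventually.of_forall fun s => ?_)
    simp only [Pi.neg_apply]
    ring
  · refine Eventually.of_forall fun s _ v hv => ?_
    have hv : w / 2 < v := hv
    have hv0 : 0 < v := by linarith
    rw [norm_mul, Real.norm_eq_abs, norm_neg, Real.norm_of_nonneg (heatQ_nonneg _ _ _)]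
    gcongr
    refine (heatQ_le_const (by linarith) hv0).trans ?_
    exact mul_le_mul_of_nonneg_left
      (Real.rpow_le_rpow_of_nonpos (by linarith) hv.le (by linarith)) (by positivity)
  · exact (hh.abs.mul continuousOn_const).intervalIntegrable
  · exact Eventually.of_forall fun s _ v _ => (hasDerivAt_heatQ_space _ _ _).const_mul _

end Potential

/-! ### The layer profile as a heat potential -/

theorem IsBaseFlow.eq_zero_of_ge {T L : ℝ} {n : ℕ} {h : ℝ → ℝ} (hh : IsBaseFlow T L n h)
    (hT : 0 < T) {t : ℝ} (ht : T ≤ t) : h t = 0 := by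
  by_contra hne
  rcases hh.supp (subset_closure ⟨hT.le.trans ht, hne⟩) with h1 | h1
  · have := h1.2
    linarith
  · exact absurd h1.2 (not_lt.2 ht)

/-- The extension of the base flow by zero to negative times. -/
def zeroExt (h : ℝ → ℝ) : ℝ → ℝ := (Ici 0).indicator h

theorem zeroExt_of_nonneg {h : ℝ → ℝ} {t : ℝ} (ht : 0 ≤ t) : zeroExt h t = h t :=
  indicator_of_mem (mem_Ici.2 ht) h

theorem zeroExt_of_neg {h : ℝ → ℝ} {t : ℝ} (ht : t < 0) : zeroExt h t = 0 :=
  indicator_of_notMem (by simpa using ht) h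

section BaseFlow

variable {T L : ℝ} {n : ℕ} {h : ℝ → ℝ}

/-- The closed support of `h` misses `0`, so the extension by zero is continuous across the initial
time. -/
theorem IsBaseFlow.eventually_zeroExt (hh : IsBaseFlow T L n h) (hT : 0 < T) :
    ∀ᶠ t in 𝓝 0, zeroExt h t = 0 := by
  have h0 : (0 : ℝ) ∉ closure {t | 0 ≤ t ∧ h t ≠ 0} := by
    intro h0
    rcases hh.supp h0 with h1 | h1
    · exact lt_irrefl _ h1.1
    · have := h1.1
      linarith
  filter_upwards [isClosed_closure.isOpen_compl.mem_nhds h0] with t ht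
  rcases lt_or_ge t 0 with h1 | h1
  · exact zeroExt_of_neg h1
  · rw [zeroExt_of_nonneg h1]
    by_contra h2
    exact ht (subset_closure ⟨h1, h2⟩)

theorem IsBaseFlow.continuous_zeroExt (hh : IsBaseFlow T L n h) (hT : 0 < T) :
    Continuous (zeroExt h) := by
  refine continuous_iff_continuousAt.2 fun t => ?_
  rcases lt_trichotomy t 0 with ht | ht | ht
  · refine (continuousAt_const (y := (0 : ℝ))).congr ?_
    filter_upwards [Iio_mem_nhds ht] with r hr using (zeroExt_of_neg hr).symm
  · subst ht
    refine (continuousAt_const (y := (0 : ℝ))).congr ?_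
    filter_upwards [hh.eventually_zeroExt hT] with r hr using hr.symm
  · refine ((hh.smooth.continuousOn).continuousAt (Ici_mem_nhds ht)).congr ?_
    filter_upwards [Ioi_mem_nhds ht] with r hr using (zeroExt_of_nonneg (le_of_lt hr)).symm

theorem IsBaseFlow.zeroExt_eq_zero (hh : IsBaseFlow T L n h) (hT : 0 < T) {t : ℝ}
    (ht : t ∉ Ioc 0 T) : zeroExt h t = 0 := by
  rcases lt_trichotomy t 0 with h1 | h1 | h1
  · exact zeroExt_of_neg h1
  · rw [h1]
    exact (hh.eventually_zeroExt hT).self_of_nhds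
  · rw [zeroExt_of_nonneg h1.le]
    refine hh.eq_zero_of_ge hT ?_
    by_contra h2
    exact ht ⟨h1, (not_le.1 h2).le⟩

theorem IsBaseFlow.exists_bound (hh : IsBaseFlow T L n h) (hT : 0 < T) :
    ∃ M, 0 ≤ M ∧ ∀ t, |zeroExt h t| ≤ M := by
  obtain ⟨M, hM⟩ := isCompact_Icc.exists_bound_of_continuousOn (s := Icc 0 T)
    (hh.continuous_zeroExt hT).continuousOn
  have h0 : 0 ≤ M := (norm_nonneg _).trans (hM 0 ⟨le_rfl, hT.le⟩)
  refine ⟨M, h0, fun t => ?_⟩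
  by_cases ht : t ∈ Icc 0 T
  · exact hM t ht
  · rw [hh.zeroExt_eq_zero hT fun h' => ht (Ioc_subset_Icc_self h'), abs_zero]
    exact h0

theorem IsBaseFlow.continuousOn (hh : IsBaseFlow T L n h) (hT : 0 < T) :
    ContinuousOn h (uIcc 0 T) := by
  rw [uIcc_of_le hT.le]
  exact hh.smooth.continuousOn.mono fun x hx => hx.1

end BaseFlow

/-- The bounded solution of the heat equation on the quarter plane with zero initial data and
boundary data `h`. -/
def layerSol (h : ℝ → ℝ) (t z : ℝ) : ℝ :=
  ∫ θ, zeroExt h (t - z ^ 2 / 4 * θ) * (heatQ (3 / 2) θ 1 / Real.sqrt Real.pi)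

theorem integral_heatQ_div : ∫ θ, heatQ (3 / 2) θ 1 / Real.sqrt Real.pi = 1 := by
  rw [integral_div, integral_heatQ_one, div_self (Real.sqrt_pos.2 Real.pi_pos).ne']

section LayerSol

variable {T L : ℝ} {n : ℕ} {h : ℝ → ℝ}

theorem norm_layerSol_integrand_le {M : ℝ} (hM : ∀ t, |zeroExt h t| ≤ M) (r θ : ℝ) :
    ‖zeroExt h r * (heatQ (3 / 2) θ 1 / Real.sqrt Real.pi)‖ ≤
      M * (heatQ (3 / 2) θ 1 / Real.sqrt Real.pi) := by
  have h1 : 0 ≤ heatQ (3 / 2) θ 1 / Real.sqrt Real.pi :=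
    div_nonneg (heatQ_nonneg _ _ _) (Real.sqrt_nonneg _)
  rw [norm_mul, Real.norm_of_nonneg h1]
  exact mul_le_mul_of_nonneg_right (hM _) h1

theorem continuous_layerSol (hh : IsBaseFlow T L n h) (hT : 0 < T) :
    Continuous fun p : ℝ × ℝ => layerSol h p.1 p.2 := by
  obtain ⟨M, -, hM⟩ := hh.exists_bound hT
  have hc := hh.continuous_zeroExt hT
  have hq : Continuous fun θ => heatQ (3 / 2) θ 1 := continuous_heatQ (by norm_num) one_pos
  refine continuous_of_dominated (fun p => ?_)
    (fun p => Eventually.of_forall fun θ => norm_layerSol_integrand_le hM _ θ)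
    ((integrable_heatQ_one.div_const _).const_mul M) (Eventually.of_forall fun θ => ?_)
  · exact Continuous.aestronglyMeasurable (by fun_prop)
  · fun_prop

theorem abs_layerSol_le {M : ℝ} (hM : ∀ t, |zeroExt h t| ≤ M) (t z : ℝ) :
    |layerSol h t z| ≤ M := by
  calc |layerSol h t z| ≤ ∫ θ, M * (heatQ (3 / 2) θ 1 / Real.sqrt Real.pi) :=
        norm_integral_le_of_norm_le ((integrable_heatQ_one.div_const _).const_mul M)
          (Eventually.of_forall fun θ => norm_layerSol_integrand_le hM _ θ)
    _ = M := by rw [integral_const_mul, integral_heatQ_div, mul_one]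

/-- The change of variables `s = t - (z²/4) θ`. The form in `θ` averages `h` against a probability
density, so it is bounded and continuous up to `z = 0`; in the potential form `t` and `z` enter only
through the kernel and the prefactor, which can be differentiated. -/
theorem layerSol_eq (hh : IsBaseFlow T L n h) (hT : 0 < T) (t : ℝ) {z : ℝ} (hz : 0 < z) :
    layerSol h t z = z / (2 * Real.sqrt Real.pi) * heatPot h T (3 / 2) t (z ^ 2 / 4) := by
  have hc : 0 < z ^ 2 / 4 := by positivity
  set c := z ^ 2 / 4 with hcdef
  have hpi : 0 < Real.sqrt Real.pi := Real.sqrt_pos.2 Real.pi_pos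
  let g : ℝ → ℝ := fun τ => zeroExt h (t - τ) * heatQ (3 / 2) τ c
  have h1 : layerSol h t z = c ^ (3 / 2 : ℝ) / Real.sqrt Real.pi * ∫ θ, g (c * θ) := by
    rw [layerSol, ← integral_const_mul]
    congr 1
    ext θ
    have := heatQ_scale (a := 3 / 2) (τ := θ) (w := 1) hc
    rw [mul_one, Real.rpow_neg hc.le] at this
    have h2 : 0 < c ^ (3 / 2 : ℝ) := by positivity
    simp only [g, this, ← hcdef]
    field_simp
  have h3 : ∫ s, zeroExt h s * heatQ (3 / 2) (t - s) c = heatPot h T (3 / 2) t c := by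
    rw [heatPot, intervalIntegral.integral_of_le hT.le,
      ← setIntegral_eq_integral_of_forall_compl_eq_zero (s := Ioc 0 T)]
    · refine setIntegral_congr_fun measurableSet_Ioc fun s hs => ?_
      simp only [zeroExt_of_nonneg hs.1.le]
    · intro s hs
      rw [hh.zeroExt_eq_zero hT hs, zero_mul]
  have h4 : ∫ τ, g τ = heatPot h T (3 / 2) t c := by
    rw [← h3, ← integral_sub_left_eq_self _ volume t]
    simp [g]
  have h5 : c ^ (3 / 2 : ℝ) = c * (z / 2) := by
    rw [hcdef, show z ^ 2 / 4 = (z / 2) ^ (2 : ℝ) by simp; ring, ← Real.rpow_mul (by positivity)]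
    norm_num
    ring
  rw [h1, Measure.integral_comp_mul_left, h4, h5, abs_of_pos (inv_pos.2 hc), smul_eq_mul]
  field_simp

theorem hasDerivAt_heatPot_sq {a t z : ℝ} (hh : ContinuousOn h (uIcc 0 T)) (ha : 0 < a)
    (hz : 0 < z) : HasDerivAt (fun v => heatPot h T a t (v ^ 2 / 4))
      (-heatPot h T (a + 1) t (z ^ 2 / 4) * (z / 2)) z := by
  have h1 : HasDerivAt (fun v : ℝ => v ^ 2 / 4) (z / 2) z := by
    convert! (hasDerivAt_pow 2 z).div_const 4 using 1
    norm_num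
    ring
  exact (hasDerivAt_heatPot_space (t := t) (w := z ^ 2 / 4) hh ha (by positivity)).comp z h1

/-- The first space derivative of `layerSol`. -/
def layerSolDz (h : ℝ → ℝ) (T t z : ℝ) : ℝ :=
  1 / (2 * Real.sqrt Real.pi) *
    (heatPot h T (3 / 2) t (z ^ 2 / 4) - z ^ 2 / 2 * heatPot h T (5 / 2) t (z ^ 2 / 4))

/-- The second space derivative of `layerSol`. -/
def layerSolDzz (h : ℝ → ℝ) (T t z : ℝ) : ℝ :=
  1 / (2 * Real.sqrt Real.pi) *
    (-(3 / 2) * z * heatPot h T (5 / 2) t (z ^ 2 / 4) +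
      z ^ 3 / 4 * heatPot h T (7 / 2) t (z ^ 2 / 4))

theorem hasDerivAt_layerSol_space (hh : IsBaseFlow T L n h) (hT : 0 < T) (t : ℝ) {z : ℝ}
    (hz : 0 < z) : HasDerivAt (layerSol h t) (layerSolDz h T t z) z := by
  have h1 : HasDerivAt (fun v => v / (2 * Real.sqrt Real.pi) * heatPot h T (3 / 2) t (v ^ 2 / 4))
      (layerSolDz h T t z) z := by
    convert! ((hasDerivAt_id z).div_const (2 * Real.sqrt Real.pi)).mul
      (hasDerivAt_heatPot_sq (a := 3 / 2) (t := t) (hh.continuousOn hT) (by norm_num) hz) using 1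
    rw [layerSolDz, show (3 / 2 + 1 : ℝ) = 5 / 2 by norm_num]
    simp only [id]
    ring
  refine h1.congr_of_eventuallyEq ?_
  filter_upwards [Ioi_mem_nhds hz] with v hv using layerSol_eq hh hT t hv

theorem hasDerivAt_layerSolDz (hh : IsBaseFlow T L n h) (hT : 0 < T) (t : ℝ) {z : ℝ}
    (hz : 0 < z) : HasDerivAt (layerSolDz h T t) (layerSolDzz h T t z) z := by
  have e1 := hasDerivAt_heatPot_sq (a := 3 / 2) (t := t) (hh.continuousOn hT) (by norm_num) hz
  have e2 := hasDerivAt_heatPot_sq (a := 5 / 2) (t := t) (hh.continuousOn hT) (by norm_num) hz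
  have e3 : HasDerivAt (fun v : ℝ => v ^ 2 / 2) z z := by
    convert! (hasDerivAt_pow 2 z).div_const 2 using 1
    norm_num
  convert! (e1.sub (e3.mul e2)).const_mul (1 / (2 * Real.sqrt Real.pi)) using 1
  rw [layerSolDzz, show (3 / 2 + 1 : ℝ) = 5 / 2 by norm_num,
    show (5 / 2 + 1 : ℝ) = 7 / 2 by norm_num]
  ring

/-- The heat equation for the kernel `z τ^(-3/2) exp(-z²/(4τ))`: both derivatives are the same
combination of potentials. -/
theorem hasDerivAt_layerSol_time (hh : IsBaseFlow T L n h) (hT : 0 < T) (t : ℝ) {z : ℝ}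
    (hz : 0 < z) : HasDerivAt (fun s => layerSol h s z) (layerSolDzz h T t z) t := by
  simp only [layerSol_eq hh hT _ hz]
  convert! (hasDerivAt_heatPot_time (t := t) (w := z ^ 2 / 4) (hh.continuousOn hT)
    (show (0 : ℝ) < 3 / 2 by norm_num) (by positivity)).const_mul
    (z / (2 * Real.sqrt Real.pi)) using 1
  rw [layerSolDzz, show (3 / 2 + 1 : ℝ) = 5 / 2 by norm_num,
    show (3 / 2 + 2 : ℝ) = 7 / 2 by norm_num]
  ring

theorem contDiffOn_two_of_hasDerivAt {f f₁ f₂ : ℝ → ℝ} {s : Set ℝ} (hs : IsOpen s)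
    (h₁ : ∀ x ∈ s, HasDerivAt f (f₁ x) x) (h₂ : ∀ x ∈ s, HasDerivAt f₁ (f₂ x) x)
    (hc : ContinuousOn f₂ s) : ContDiffOn ℝ 2 f s := by
  have key : ContDiffOn ℝ 1 f₁ s := by
    refine (contDiffOn_succ_iff_deriv_of_isOpen (n := 0) hs).2 ⟨fun x hx =>
      (h₂ x hx).differentiableAt.differentiableWithinAt, by simp, ?_⟩
    exact contDiffOn_zero.2 (hc.congr fun x hx => (h₂ x hx).deriv)
  have : ContDiffOn ℝ (1 + 1) f s := by
    refine (contDiffOn_succ_iff_deriv_of_isOpen (n := 1) hs).2 ⟨fun x hx =>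
      (h₁ x hx).differentiableAt.differentiableWithinAt, by simp, ?_⟩
    exact key.congr fun x hx => (h₁ x hx).deriv
  simpa [one_add_one_eq_two] using this

theorem isLayerProfile_layerSol (hh : IsBaseFlow T L n h) (hT : 0 < T) :
    IsLayerProfile h (layerSol h) where
  cont := (continuous_layerSol hh hT).continuousOn
  bdd := by
    obtain ⟨M, -, hM⟩ := hh.exists_bound hT
    exact fun τ => ⟨M, fun t _ z _ => abs_layerSol_le hM t z⟩
  smooth_space := by
    intro t _
    refine contDiffOn_two_of_hasDerivAt isOpen_Ioi
      (fun z hz => hasDerivAt_layerSol_space hh hT t hz)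
      (fun z hz => hasDerivAt_layerSolDz hh hT t hz) ?_
    intro z hz
    have e2 := (hasDerivAt_heatPot_sq (a := 5 / 2) (t := t) (hh.continuousOn hT) (by norm_num)
      hz).continuousAt
    have e3 := (hasDerivAt_heatPot_sq (a := 7 / 2) (t := t) (hh.continuousOn hT) (by norm_num)
      hz).continuousAt
    have : ContinuousAt (layerSolDzz h T t) z := by
      unfold layerSolDzz
      fun_prop
    exact this.continuousWithinAt
  heat := by
    intro t _ z hz
    have e1 : deriv (layerSol h t) =ᶠ[𝓝 z] layerSolDz h T t := by
      filter_upwards [Ioi_mem_nhds hz] with v hv using (hasDerivAt_layerSol_space hh hT t hv).deriv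
    rw [e1.deriv_eq, (hasDerivAt_layerSolDz hh hT t hz).deriv]
    exact hasDerivAt_layerSol_time hh hT t hz
  boundary := by
    intro t ht
    simp only [layerSol, ne_eq, OfNat.ofNat_ne_zero, not_false_eq_true, zero_pow, zero_div,
      zero_mul, sub_zero]
    rw [integral_const_mul, integral_heatQ_div, mul_one, zeroExt_of_nonneg ht]
  initial := by
    intro z _
    refine integral_eq_zero_of_ae (Eventually.of_forall fun θ => ?_)
    simp only [zero_sub, Pi.zero_apply]
    rcases le_or_gt θ 0 with h1 | h1
    · rw [heatQ_of_nonpos h1]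
      simp
    · rw [hh.zeroExt_eq_zero hT (fun h' => ?_), zero_mul]
      have := h'.1
      have : 0 ≤ z ^ 2 / 4 * θ := by positivity
      linarith

end LayerSol

/-! ### Decay of potentials with vanishing moments -/

/-- Integration by parts: the moment of order `k` of the primitive is `-1/(k+1)` times the moment of
order `k+1` of `h`. The boundary term at `T` is the zeroth moment. One moment is lost. -/
theorem moments_primitive {h : ℝ → ℝ} {T : ℝ} {n : ℕ} (hc : Continuous h)
    (hm : ∀ k < n + 1, ∫ t in (0)..T, t ^ k * h t = 0) :
    ∀ k < n, ∫ t in (0)..T, t ^ k * ∫ s in (0)..t, h s = 0 := by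
  intro k hk
  have hd : ∀ t, HasDerivAt (fun t => ∫ s in (0)..t, h s) (h t) t :=
    fun t => (hc.integral_hasStrictDerivAt 0 t).hasDerivAt
  have hp : ∀ t : ℝ, HasDerivAt (fun t : ℝ => t ^ (k + 1)) ((k + 1 : ℝ) * t ^ k) t := by
    intro t
    simpa using hasDerivAt_pow (k + 1) t
  have h0 : ∫ s in (0)..T, h s = 0 := by simpa using hm 0 (by omega)
  have := intervalIntegral.integral_mul_deriv_eq_deriv_mul (a := 0) (b := T)
    (fun t _ => hp t) (fun t _ => hd t)
    (Continuous.intervalIntegrable (by fun_prop) _ _) (hc.intervalIntegrable _ _)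
  rw [hm (k + 1) (by omega), h0] at this
  simp only [mul_zero, intervalIntegral.integral_same, sub_zero, zero_sub, mul_assoc,
    intervalIntegral.integral_const_mul] at this
  have h1 : (k + 1 : ℝ) ≠ 0 := by positivity
  have h2 := neg_eq_zero.1 this.symm
  exact (mul_eq_zero.1 h2).resolve_left h1

/-- Integration by parts in `s`; the primitive of `h` vanishes at `0` and at `T`. Each resulting
kernel, `τ^(-a-1)` and `w τ^(-a-2)`, gains a factor `1/t` when `w` is of order `t`. -/
theorem heatPot_primitive {h : ℝ → ℝ} {T a t w : ℝ} (hc : Continuous h) (ha : 0 < a) (hw : 0 < w)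
    (h0 : ∫ s in (0)..T, h s = 0) :
    heatPot h T a t w = -a * heatPot (fun r => ∫ s in (0)..r, h s) T (a + 1) t w +
      w * heatPot (fun r => ∫ s in (0)..r, h s) T (a + 2) t w := by
  have hd : ∀ t, HasDerivAt (fun t => ∫ s in (0)..t, h s) (h t) t :=
    fun t => (hc.integral_hasStrictDerivAt 0 t).hasDerivAt
  have hH : Continuous fun t => ∫ s in (0)..t, h s :=
    continuous_iff_continuousAt.2 fun t => (hd t).continuousAt
  have hu : ∀ s, HasDerivAt (fun s => heatQ a (t - s) w)
      (-(-a * heatQ (a + 1) (t - s) w + w * heatQ (a + 2) (t - s) w)) s := by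
    exact fun s => (hasDerivAt_heatQ_time ha hw (t - s)).comp_const_sub t s
  have c1 := continuous_heatQ (a := a + 1) (by linarith) hw
  have c2 := continuous_heatQ (a := a + 2) (by linarith) hw
  have := intervalIntegral.integral_mul_deriv_eq_deriv_mul (a := 0) (b := T)
    (fun s _ => hu s) (fun s _ => hd s)
    (Continuous.intervalIntegrable (by fun_prop) _ _) (hc.intervalIntegrable _ _)
  rw [h0] at this
  have e : heatPot h T a t w = ∫ s in (0)..T, heatQ a (t - s) w * h s := by
    simp only [heatPot, mul_comm]
  rw [e, this]
  unfold heatPot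
  rw [← intervalIntegral.integral_const_mul (-a), ← intervalIntegral.integral_const_mul w,
    ← intervalIntegral.integral_add (Continuous.intervalIntegrable (by fun_prop) _ _)
      (Continuous.intervalIntegrable (by fun_prop) _ _)]
  simp only [mul_zero, intervalIntegral.integral_same, sub_zero, zero_sub]
  rw [← intervalIntegral.integral_neg]
  congr 1
  ext s
  ring

/-- Induction through `heatPot_primitive`: every vanishing moment is exchanged for a factor `1/t`,
at the cost of a factor `1 + w/t`. The exponent `a` is universally quantified because each step
raises it. -/
theorem exists_abs_heatPot_le_of_moments {T : ℝ} (hT : 0 < T) (n : ℕ) :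
    ∀ (a : ℝ) (h : ℝ → ℝ), 0 < a → Continuous h →
      (∀ k < n, ∫ t in (0)..T, t ^ k * h t = 0) →
      ∃ C, 0 ≤ C ∧ ∀ t w, 2 * T ≤ t → 0 < w →
        |heatPot h T a t w| ≤ C * t ^ (-a - n) * (1 + w / t) ^ n * Real.exp (-(w / t)) := by
  induction n with
  | zero =>
    intro a h ha hc _
    obtain ⟨M, hM⟩ := isCompact_Icc.exists_bound_of_continuousOn (s := Icc 0 T) hc.continuousOn
    have hM0 : 0 ≤ M := (norm_nonneg _).trans (hM 0 ⟨le_rfl, hT.le⟩)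
    refine ⟨M * 2 ^ a * T, by positivity, fun t w ht hw => ?_⟩
    have ht0 : 0 < t := by linarith
    have := intervalIntegral.norm_integral_le_of_norm_le_const (a := 0) (b := T)
      (f := fun s => h s * heatQ a (t - s) w) (C := M * ((t / 2) ^ (-a) * Real.exp (-(w / t)))) ?_
    · rw [Real.norm_eq_abs] at this
      refine this.trans_eq ?_
      rw [sub_zero, abs_of_pos hT, Real.div_rpow ht0.le zero_le_two, Real.rpow_neg zero_le_two]
      simp
      ring
    · intro s hs
      rw [uIoc_of_le hT.le] at hs
      -- Since `t ≥ 2T`, one has `t/2 ≤ t - s ≤ t`: the lower bound serves the power and the upper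
      -- bound the exponential.
      have h1 : 0 < t - s := by linarith [hs.2]
      rw [norm_mul, Real.norm_of_nonneg (heatQ_nonneg _ _ _), heatQ_of_pos h1]
      have h2 : w / t ≤ w / (t - s) := div_le_div_of_nonneg_left hw.le h1 (by linarith [hs.1])
      exact mul_le_mul (hM s ⟨hs.1.le, hs.2⟩) (mul_le_mul
        (Real.rpow_le_rpow_of_nonpos (by linarith) (by linarith [hs.2]) (by linarith))
        (Real.exp_le_exp.2 (neg_le_neg h2)) (Real.exp_pos _).le (by positivity)) (by positivity) hM0
  | succ n ih =>
    intro a h ha hc hm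
    have hH : Continuous fun t => ∫ s in (0)..t, h s :=
      continuous_iff_continuousAt.2 fun t => (hc.integral_hasStrictDerivAt 0 t).hasDerivAt.continuousAt
    obtain ⟨C₁, hC₁, H₁⟩ := ih (a + 1) _ (by linarith) hH (moments_primitive hc hm)
    obtain ⟨C₂, hC₂, H₂⟩ := ih (a + 2) _ (by linarith) hH (moments_primitive hc hm)
    refine ⟨a * C₁ + C₂, by positivity, fun t w ht hw => ?_⟩
    have ht0 : 0 < t := by linarith
    rw [heatPot_primitive hc ha hw (by simpa using hm 0 (by omega))]
    have e1 : t ^ (-(a + 1) - (n : ℝ)) = t ^ (-a - ((n + 1 : ℕ) : ℝ)) := by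
      congr 1
      push_cast
      ring
    have e2 : t ^ (-(a + 2) - (n : ℝ)) = t ^ (-a - ((n + 1 : ℕ) : ℝ)) / t := by
      rw [← Real.rpow_sub_one ht0.ne']
      congr 1
      push_cast
      ring
    have h1 := H₁ t w ht hw
    have h2 := H₂ t w ht hw
    rw [e1] at h1
    rw [e2] at h2
    set X := t ^ (-a - ((n + 1 : ℕ) : ℝ))
    set E := Real.exp (-(w / t))
    have hX : 0 < X := by positivity
    have hE : 0 < E := Real.exp_pos _
    have hr : 0 < w / t := by positivity
    calc |-a * heatPot (fun r => ∫ s in (0)..r, h s) T (a + 1) t w +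
          w * heatPot (fun r => ∫ s in (0)..r, h s) T (a + 2) t w|
        ≤ a * |heatPot (fun r => ∫ s in (0)..r, h s) T (a + 1) t w| +
          w * |heatPot (fun r => ∫ s in (0)..r, h s) T (a + 2) t w| := by
          refine (abs_add_le _ _).trans_eq ?_
          rw [abs_mul, abs_mul, abs_neg, abs_of_pos ha, abs_of_pos hw]
      _ ≤ a * (C₁ * X * (1 + w / t) ^ n * E) + w * (C₂ * (X / t) * (1 + w / t) ^ n * E) := by
          gcongr
      _ = (a * C₁ + C₂ * (w / t)) * (X * (1 + w / t) ^ n * E) := by ring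
      _ ≤ ((a * C₁ + C₂) * (1 + w / t)) * (X * (1 + w / t) ^ n * E) := by
          gcongr
          have : 0 ≤ a * C₁ * (w / t) := by positivity
          nlinarith
      _ = (a * C₁ + C₂) * X * (1 + w / t) ^ (n + 1) * E := by ring

theorem heatPot_zeroExt {h : ℝ → ℝ} {T : ℝ} (hT : 0 < T) (a t w : ℝ) :
    heatPot (zeroExt h) T a t w = heatPot h T a t w := by
  refine intervalIntegral.integral_congr fun s hs => ?_
  rw [uIcc_of_le hT.le] at hs
  simp only [zeroExt_of_nonneg hs.1]

/-- Half of the exponential absorbs the polynomial. The exponent is raised to `n + 1` so that it is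
positive also for `n = 0`. -/
theorem one_add_pow_mul_exp_neg_le (n : ℕ) {x : ℝ} (hx : 0 ≤ x) :
    (1 + x) ^ n * Real.exp (-x) ≤
      Real.exp (1 / 2) * (2 * (n + 1 : ℝ)) ^ (n + 1 : ℝ) * Real.exp (-(x / 2)) := by
  have h1 := rpow_mul_exp_neg_le (b := n + 1) (x := (1 + x) / 2) (by positivity) (by linarith)
  rw [Real.div_rpow (by linarith) zero_le_two, div_mul_eq_mul_div,
    div_le_iff₀ (by positivity), ← Real.mul_rpow (by positivity) (by positivity)] at h1
  have h2 : (1 + x) ^ n ≤ (1 + x) ^ (n + 1 : ℝ) := by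
    rw [← Real.rpow_natCast]
    exact Real.rpow_le_rpow_of_exponent_le (by linarith) (by linarith)
  have h3 : Real.exp (-x) = Real.exp (1 / 2) * Real.exp (-((1 + x) / 2)) * Real.exp (-(x / 2)) := by
    rw [← Real.exp_add, ← Real.exp_add]
    ring_nf
  rw [h3]
  calc (1 + x) ^ n * (Real.exp (1 / 2) * Real.exp (-((1 + x) / 2)) * Real.exp (-(x / 2)))
      ≤ (1 + x) ^ (n + 1 : ℝ) * (Real.exp (1 / 2) * Real.exp (-((1 + x) / 2)) *
        Real.exp (-(x / 2))) := by gcongr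
    _ = Real.exp (1 / 2) * ((1 + x) ^ (n + 1 : ℝ) * Real.exp (-((1 + x) / 2))) *
        Real.exp (-(x / 2)) := by ring
    _ ≤ Real.exp (1 / 2) * ((n + 1 : ℝ) * 2) ^ (n + 1 : ℝ) * Real.exp (-(x / 2)) := by gcongr
    _ = _ := by rw [mul_comm (n + 1 : ℝ) 2]

/-- Gaussian decay of the layer profile, improved by the vanishing moments of the base flow. -/
theorem exists_abs_layerProfile_le {T L : ℝ} {n : ℕ} {h : ℝ → ℝ} (hh : IsBaseFlow T L n h)
    (hT : 0 < T) : ∃ C, 0 ≤ C ∧ ∀ V, IsLayerProfile h V → ∀ t z, 2 * T ≤ t → 0 ≤ z →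
      |V t z| ≤ C * t ^ (-1 - n : ℝ) * Real.exp (-(z ^ 2 / (16 * t))) := by
  have hmom : ∀ k < n, ∫ t in (0)..T, t ^ k * zeroExt h t = 0 := by
    intro k hk
    refine Eq.trans (intervalIntegral.integral_congr fun s hs => ?_) (hh.moments k hk)
    rw [uIcc_of_le hT.le] at hs
    simp only [zeroExt_of_nonneg hs.1]
  obtain ⟨C, hC, H⟩ := exists_abs_heatPot_le_of_moments hT n (3 / 2) (zeroExt h) (by norm_num)
    (hh.continuous_zeroExt hT) hmom
  set N := Real.exp (1 / 2) * (2 * (n + 2 : ℝ)) ^ (n + 2 : ℝ) with hN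
  refine ⟨C * N, by positivity, fun V hV t z ht hz => ?_⟩
  have ht0 : 0 < t := by linarith
  have hpi : 1 ≤ Real.sqrt Real.pi := by
    rw [Real.one_le_sqrt]
    linarith [Real.pi_gt_three]
  rw [hV.unique (isLayerProfile_layerSol hh hT) ht0.le hz]
  -- The potential formula needs `z > 0`; at `z = 0` the profile equals `h t`, which is zero after
  -- `T`.
  rcases hz.eq_or_lt with h0 | hz
  · rw [← h0, (isLayerProfile_layerSol hh hT).boundary t ht0.le,
      hh.eq_zero_of_ge hT (by linarith), abs_zero]
    positivity
  rw [layerSol_eq hh hT t hz, ← heatPot_zeroExt hT, abs_mul, abs_of_pos (by positivity)]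
  have h1 := H t (z ^ 2 / 4) ht (by positivity)
  set x := z ^ 2 / 4 / t with hx
  have hx0 : 0 < x := by positivity
  -- The prefactor `z` costs `√t`, as `z / 2 = √t √x`. This turns the power `-3/2 - n` of `t` into
  -- `-1 - n`.
  have h2 : z / (2 * Real.sqrt Real.pi) ≤ t ^ (1 / 2 : ℝ) * (1 + x) := by
    have e : z / 2 = t ^ (1 / 2 : ℝ) * Real.sqrt x := by
      rw [← Real.sqrt_eq_rpow, ← Real.sqrt_mul ht0.le, hx,
        show t * (z ^ 2 / 4 / t) = (z / 2) ^ 2 by field_simp; norm_num,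
        Real.sqrt_sq (by positivity)]
    have e2 : Real.sqrt x ≤ 1 + x := by
      rw [Real.sqrt_le_left (by positivity)]
      nlinarith
    calc z / (2 * Real.sqrt Real.pi) ≤ z / (2 * 1) := by gcongr
      _ = z / 2 := by rw [mul_one]
      _ ≤ _ := by rw [e]; gcongr
  have h3 := one_add_pow_mul_exp_neg_le (n + 1) hx0.le
  have e3 : t ^ (1 / 2 : ℝ) * t ^ (-(3 / 2) - n : ℝ) = t ^ (-1 - n : ℝ) := by
    rw [← Real.rpow_add ht0]
    congr 1
    ring
  calc z / (2 * Real.sqrt Real.pi) * |heatPot (zeroExt h) T (3 / 2) t (z ^ 2 / 4)|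
      ≤ (t ^ (1 / 2 : ℝ) * (1 + x)) *
        (C * t ^ (-(3 / 2) - n : ℝ) * (1 + x) ^ n * Real.exp (-x)) := by gcongr
    _ = C * (t ^ (1 / 2 : ℝ) * t ^ (-(3 / 2) - n : ℝ)) * ((1 + x) ^ (n + 1) * Real.exp (-x)) := by
        ring
    _ ≤ C * t ^ (-1 - n : ℝ) * (N * Real.exp (-(x / 2))) := by
        rw [e3]
        refine mul_le_mul_of_nonneg_left (h3.trans_eq ?_) (by positivity)
        rw [hN]
        push_cast
        ring_nf
    _ ≤ C * N * t ^ (-1 - n : ℝ) * Real.exp (-(z ^ 2 / (16 * t))) := by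
        have : z ^ 2 / (16 * t) ≤ x / 2 := by
          rw [hx, div_div, div_div, div_le_div_iff₀ (by positivity) (by positivity)]
          nlinarith [sq_nonneg z, mul_nonneg (sq_nonneg z) ht0.le]
        have := Real.exp_le_exp.2 (neg_le_neg this)
        calc _ ≤ C * t ^ (-1 - n : ℝ) * (N * Real.exp (-(z ^ 2 / (16 * t)))) := by gcongr
          _ = _ := by ring

/-! ### The boundary distance and the cut-offs -/

theorem hasDerivAt_dI {f : ℝ → ℝ} (hf : ContDiffOn ℝ ∞ f I) {y : ℝ} (hy : y ∈ Ioo (-1 : ℝ) 1) :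
    HasDerivAt f (dI f y) y :=
  ((hf.differentiableOn (by simp)) y (Ioo_subset_Icc_self hy)).hasDerivWithinAt.hasDerivAt
    (Icc_mem_nhds hy.1 hy.2)

theorem contDiffOn_dI {f : ℝ → ℝ} (hf : ContDiffOn ℝ ∞ f I) : ContDiffOn ℝ ∞ (dI f) I :=
  hf.derivWithin (uniqueDiffOn_Icc (by norm_num)) (by simp)

theorem exists_abs_le_on_I {f : ℝ → ℝ} (hf : ContDiffOn ℝ ∞ f I) :
    ∃ A, 0 ≤ A ∧ ∀ y ∈ I, |f y| ≤ A := by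
  obtain ⟨A, hA⟩ := isCompact_Icc.exists_bound_of_continuousOn hf.continuousOn
  exact ⟨A, (norm_nonneg _).trans (hA 0 (by constructor <;> norm_num)), hA⟩

theorem dI_eq_zero_of_const {f : ℝ → ℝ} {c y : ℝ} {s : Set ℝ} (hs : IsOpen s) (hy : y ∈ s)
    (hf : ∀ x ∈ s ∩ I, f x = c) (hyI : y ∈ I) : dI f y = 0 := by
  have h1 : f =ᶠ[𝓝[I] y] fun _ => c := by
    filter_upwards [mem_nhdsWithin_of_mem_nhds (hs.mem_nhds hy), self_mem_nhdsWithin] with x h1 h2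
      using hf x ⟨h1, h2⟩
  rw [dI, h1.derivWithin_eq (hf y ⟨hy, hyI⟩)]
  exact congrFun (derivWithin_const I c) y

/-- A continuous derivative of modulus one has constant sign on each of the two end intervals. The
sign is then fixed by `φ = 0` at the end point and `φ ≥ 0`. The parameter `σ` treats both ends at
once. -/
theorem IsBoundaryDistance.eq_one_sub_abs {φ : ℝ → ℝ} (hφ : IsBoundaryDistance φ) {y : ℝ}
    (hy : y ∈ I) (hy4 : 1 / 4 ≤ |y|) : φ y = 1 - |y| := by
  have key : ∀ σ : ℝ, (σ = 1 ∨ σ = -1) → ∀ r ∈ Icc (1 / 4 : ℝ) 1, φ (σ * r) = 1 - r := by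
    intro σ hσ r hr
    have hmaps : ∀ r ∈ Icc (1 / 4 : ℝ) 1, σ * r ∈ I := by
      intro r hr
      have h1 := hr.1
      have h2 := hr.2
      rcases hσ with rfl | rfl <;> constructor <;> linarith
    have habs : ∀ r ∈ Icc (1 / 4 : ℝ) 1, |σ * r| = r := by
      intro r hr
      have h1 : 0 ≤ r := by linarith [hr.1]
      rcases hσ with rfl | rfl <;> simp [abs_of_nonneg h1]
    have hσ1 : φ (σ * 1) = 0 := by
      rcases hσ with rfl | rfl
      · simpa using hφ.right
      · simpa using hφ.left
    have hcσ : ContinuousOn (fun r => σ * r) (Icc (1 / 4 : ℝ) 1) := by fun_prop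
    have hc : ContinuousOn (fun r => σ * dI φ (σ * r)) (Icc (1 / 4 : ℝ) 1) :=
      ((contDiffOn_dI hφ.smooth).continuousOn.comp hcσ hmaps).const_mul σ
    have hφc : ContinuousOn (fun r => φ (σ * r)) (Icc (1 / 4 : ℝ) 1) :=
      hφ.smooth.continuousOn.comp hcσ hmaps
    have hcases := isPreconnected_Icc.eq_or_eq_neg_of_sq_eq hc continuousOn_const
      (g := fun _ => (1 : ℝ)) (fun r hr => by
        have h1 := hφ.slope _ (hmaps r hr) (by rw [habs r hr]; exact hr.1)
        have h2 : dI φ (σ * r) ^ 2 = 1 := by rw [← sq_abs, h1, one_pow]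
        have h3 : σ ^ 2 = 1 := by rcases hσ with rfl | rfl <;> norm_num
        simp only [Pi.pow_apply, mul_pow, h2, h3, one_pow, mul_one]) (fun _ => one_ne_zero)
    have hd : ∀ r ∈ Ico (1 / 4 : ℝ) 1,
        HasDerivAt (fun r => φ (σ * r)) (σ * dI φ (σ * r)) r := by
      intro r hr
      have hmem : σ * r ∈ Ioo (-1 : ℝ) 1 := by
        have h1 := hr.1
        have h2 := hr.2
        rcases hσ with rfl | rfl <;> constructor <;> linarith
      have := (hasDerivAt_dI hφ.smooth hmem).comp r ((hasDerivAt_id r).const_mul σ)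
      convert! this using 1
      ring
    have hconst : ∀ c : ℝ, (∀ r ∈ Icc (1 / 4 : ℝ) 1, σ * dI φ (σ * r) = c) →
        ∀ r ∈ Icc (1 / 4 : ℝ) 1, φ (σ * r) = c * (r - 1) := by
      intro c hcc
      have := constant_of_has_deriv_right_zero (f := fun r => φ (σ * r) - c * r) (a := 1 / 4)
        (b := 1) (hφc.sub (by fun_prop)) (fun r hr => by
          have h1 := (hd r hr).sub ((hasDerivAt_id r).const_mul c)
          rw [hcc r ⟨hr.1, hr.2.le⟩, mul_one, sub_self] at h1
          exact h1.hasDerivWithinAt)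
      intro r hr
      have e1 := this r hr
      have e2 := this 1 ⟨by norm_num, le_rfl⟩
      simp only [hσ1] at e1 e2
      linarith
    rcases hcases with h1 | h1
    -- The wrong sign would give the value `-3/4` at distance `1/4` from the centre.
    · have h2 := hconst 1 (fun r hr => h1 hr) (1 / 4) ⟨le_rfl, by norm_num⟩
      have h3 := (hφ.range _ (hmaps (1 / 4) ⟨le_rfl, by norm_num⟩)).1
      rw [h2] at h3
      norm_num at h3
    · have h2 := hconst (-1) (fun r hr => by simpa using h1 hr) r hr
      rw [h2]
      ring
  rcases le_total 0 y with h | h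
  · rw [abs_of_nonneg h] at hy4 ⊢
    simpa using key 1 (Or.inl rfl) y ⟨hy4, hy.2⟩
  · rw [abs_of_nonpos h] at hy4 ⊢
    simpa using key (-1) (Or.inr rfl) (-y) ⟨hy4, by linarith [hy.1]⟩

theorem IsBoundaryCutoff.dI_eq_zero {χ : ℝ → ℝ} (hχ : IsBoundaryCutoff χ) {y : ℝ} (hy : y ∈ I)
    (h : |y| < 1 / 3 ∨ 2 / 3 < |y|) : dI χ y = 0 := by
  rcases h with h | h
  · exact dI_eq_zero_of_const (s := {x | |x| < 1 / 3}) (c := 0)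
      (isOpen_lt continuous_abs continuous_const) h (fun x hx => hχ.eq_zero x hx.2 hx.1.le) hy
  · exact dI_eq_zero_of_const (s := {x | 2 / 3 < |x|}) (c := 1)
      (isOpen_lt continuous_const continuous_abs) h (fun x hx => hχ.eq_one x hx.2 hx.1.le) hy

theorem IsBoundaryCutoff.dI_dI_eq_zero {χ : ℝ → ℝ} (hχ : IsBoundaryCutoff χ) {y : ℝ} (hy : y ∈ I)
    (h : |y| < 1 / 3 ∨ 2 / 3 < |y|) : dI (dI χ) y = 0 := by
  rcases h with h | h
  · exact dI_eq_zero_of_const (s := {x | |x| < 1 / 3}) (c := 0)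
      (isOpen_lt continuous_abs continuous_const) h (fun x hx => hχ.dI_eq_zero hx.2 (.inl hx.1)) hy
  · exact dI_eq_zero_of_const (s := {x | 2 / 3 < |x|}) (c := 0)
      (isOpen_lt continuous_const continuous_abs) h (fun x hx => hχ.dI_eq_zero hx.2 (.inr hx.1)) hy

/-! ### The technical profile -/

/-- Only the size of `h` enters, not its moments, and all positive times are covered. The weights
`z²` and `z³` cancel the homogeneity of the kernels, leaving the spare factor `(t / z²)^m` of
`heatQ_le`. -/
theorem exists_weighted_bound {T L : ℝ} {n : ℕ} {h : ℝ → ℝ} (hh : IsBaseFlow T L n h)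
    (hT : 0 < T) {m : ℝ} (hm : 0 ≤ m) : ∃ C, 0 ≤ C ∧ ∀ V, IsLayerProfile h V → ∀ t z,
      0 < t → 0 < z → |z ^ 2 * V t z| ≤ C * (t / z ^ 2) ^ m ∧
        |z ^ 3 * deriv (V t) z| ≤ C * (t / z ^ 2) ^ m := by
  obtain ⟨M, hM0, hM⟩ := hh.exists_bound hT
  have hpot : ∀ a t w : ℝ, 0 < a → 0 < t → 0 < w →
      |heatPot h T a t w| ≤ M * T * (a + m) ^ (a + m) * (w ^ (-a) * (t / w) ^ m) := by
    intro a t w ha ht hw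
    rw [← heatPot_zeroExt hT]
    have := intervalIntegral.norm_integral_le_of_norm_le_const (a := 0) (b := T)
      (f := fun s => zeroExt h s * heatQ a (t - s) w)
      (C := M * ((a + m) ^ (a + m) * w ^ (-a) * (t / w) ^ m)) ?_
    · rw [Real.norm_eq_abs] at this
      refine this.trans_eq ?_
      rw [sub_zero, abs_of_pos hT]
      ring
    · intro s hs
      rw [uIoc_of_le hT.le] at hs
      rw [norm_mul, Real.norm_of_nonneg (heatQ_nonneg _ _ _)]
      exact mul_le_mul (hM s) (heatQ_le ha hm hw (by linarith [hs.1]) ht.le)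
        (heatQ_nonneg _ _ _) hM0
  set K := M * T * (3 / 2 + m) ^ (3 / 2 + m) with hK
  set K' := M * T * (5 / 2 + m) ^ (5 / 2 + m) with hK'
  have hpi : 1 ≤ Real.sqrt Real.pi := by
    rw [Real.one_le_sqrt]
    linarith [Real.pi_gt_three]
  refine ⟨(8 * K + 16 * K') * 4 ^ m, by positivity, fun V hV t z ht hz => ?_⟩
  have hw : 0 < z ^ 2 / 4 := by positivity
  have e0 : z ^ 2 / 4 = (z / 2) ^ (2 : ℝ) := by simp; ring
  have e3 : (z ^ 2 / 4) ^ (-(3 / 2) : ℝ) = 8 / z ^ 3 := by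
    rw [e0, ← Real.rpow_mul (by positivity), show (2 : ℝ) * -(3 / 2) = -(3 : ℕ) by norm_num,
      Real.rpow_neg (by positivity), Real.rpow_natCast]
    field_simp
    norm_num
  have e5 : (z ^ 2 / 4) ^ (-(5 / 2) : ℝ) = 32 / z ^ 5 := by
    rw [e0, ← Real.rpow_mul (by positivity), show (2 : ℝ) * -(5 / 2) = -(5 : ℕ) by norm_num,
      Real.rpow_neg (by positivity), Real.rpow_natCast]
    field_simp
    norm_num
  have em : (t / (z ^ 2 / 4)) ^ m = 4 ^ m * (t / z ^ 2) ^ m := by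
    rw [← Real.mul_rpow (by norm_num) (by positivity)]
    congr 1
    field_simp
  have h3 := hpot (3 / 2) t (z ^ 2 / 4) (by norm_num) ht hw
  have h5 := hpot (5 / 2) t (z ^ 2 / 4) (by norm_num) ht hw
  rw [e3, em, ← hK] at h3
  rw [e5, em, ← hK'] at h5
  set X := (t / z ^ 2) ^ m
  have hX : 0 ≤ X := by positivity
  have hVeq : V t =ᶠ[𝓝 z] layerSol h t := by
    filter_upwards [Ioi_mem_nhds hz] with v hv
      using hV.unique (isLayerProfile_layerSol hh hT) ht.le (le_of_lt hv)
  have hpos : 0 < 1 / (2 * Real.sqrt Real.pi) := by positivity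
  have hle1 : 1 / (2 * Real.sqrt Real.pi) ≤ 1 := by
    rw [div_le_one (by positivity)]
    linarith
  have hKX : 0 ≤ K * 4 ^ m * X := by positivity
  have hKX' : 0 ≤ K' * 4 ^ m * X := by positivity
  constructor
  · rw [hVeq.self_of_nhds, layerSol_eq hh hT t hz]
    calc |z ^ 2 * (z / (2 * Real.sqrt Real.pi) * heatPot h T (3 / 2) t (z ^ 2 / 4))|
        = 1 / (2 * Real.sqrt Real.pi) * (z ^ 3 * |heatPot h T (3 / 2) t (z ^ 2 / 4)|) := by
          rw [abs_mul, abs_mul, abs_of_pos (by positivity : 0 < z ^ 2),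
            abs_of_pos (by positivity : 0 < z / (2 * Real.sqrt Real.pi))]
          ring
      _ ≤ 1 * (z ^ 3 * (K * (8 / z ^ 3 * (4 ^ m * X)))) := by gcongr
      _ = 8 * (K * 4 ^ m * X) := by field_simp
      _ ≤ _ := by linarith
  · rw [hVeq.deriv_eq, (hasDerivAt_layerSol_space hh hT t hz).deriv, layerSolDz]
    calc |z ^ 3 * (1 / (2 * Real.sqrt Real.pi) * (heatPot h T (3 / 2) t (z ^ 2 / 4) -
            z ^ 2 / 2 * heatPot h T (5 / 2) t (z ^ 2 / 4)))|
        = 1 / (2 * Real.sqrt Real.pi) * (z ^ 3 * |heatPot h T (3 / 2) t (z ^ 2 / 4) -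
            z ^ 2 / 2 * heatPot h T (5 / 2) t (z ^ 2 / 4)|) := by
          rw [abs_mul, abs_mul, abs_of_pos (by positivity : 0 < z ^ 3), abs_of_pos hpos]
          ring
      _ ≤ 1 * (z ^ 3 * (K * (8 / z ^ 3 * (4 ^ m * X)) +
            z ^ 2 / 2 * (K' * (32 / z ^ 5 * (4 ^ m * X))))) := by
          have h6 : |z ^ 2 / 2 * heatPot h T (5 / 2) t (z ^ 2 / 4)| ≤
              z ^ 2 / 2 * (K' * (32 / z ^ 5 * (4 ^ m * X))) := by
            rw [abs_mul, abs_of_pos (by positivity : 0 < z ^ 2 / 2)]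
            gcongr
          have h7 := (abs_sub _ _).trans (add_le_add h3 h6)
          exact mul_le_mul hle1 (mul_le_mul_of_nonneg_left h7 (by positivity)) (by positivity)
            zero_le_one
      _ = 8 * (K * 4 ^ m * X) + 16 * (K' * 4 ^ m * X) := by
          field_simp
          ring
      _ ≤ _ := by linarith

/-- On the support of the source, `1/3 ≤ |y| ≤ 2/3`, so `φ ≥ 1/3` and `t / z² ≤ 9 ε t`. The source
is thus of order `(ετ)^m` up to time `τ`, and the maximum principle multiplies this by `τ`. -/
theorem exists_abs_technicalProfile_le {T L : ℝ} {n : ℕ} {h φ χ : ℝ → ℝ}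
    (hh : IsBaseFlow T L n h) (hT : 0 < T) (hφ : IsBoundaryDistance φ) (hχ : IsBoundaryCutoff χ)
    {m : ℝ} (hm : 0 ≤ m) : ∃ C, 0 ≤ C ∧ ∀ V, IsLayerProfile h V → ∀ ε W, 0 < ε →
      IsTechnicalProfile φ χ V ε W → ∀ τ, 0 < τ → ∀ y ∈ I, |W τ y| ≤ C * (ε * τ) ^ m * τ := by
  obtain ⟨C, hC, H⟩ := exists_weighted_bound hh hT hm
  obtain ⟨A, hA, hχ1⟩ := exists_abs_le_on_I (contDiffOn_dI hχ.smooth)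
  obtain ⟨B, hB, hχ2⟩ := exists_abs_le_on_I (contDiffOn_dI (contDiffOn_dI hχ.smooth))
  refine ⟨(B * 9 + 2 * (A * 27)) * C * 9 ^ m, by positivity, fun V hV ε W hε hW τ hτ y hy => ?_⟩
  refine abs_le_of_heat_source (ε := ε) (τ := τ) (a := -1) (b := 1) (f := sourceW φ χ V ε)
    (M := (B * 9 + 2 * (A * 27)) * C * 9 ^ m * (ε * τ) ^ m) hε.le
    (hW.cont.mono (prod_mono (fun x hx => hx.1) subset_rfl)) (fun t ht => hW.smooth_space t ht.1)
    (fun t ht y hy => hW.heat t ht.1 y hy) ?_ (by positivity) hW.initial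
    (fun t ht => hW.left t ht.1) (fun t ht => hW.right t ht.1) τ ⟨hτ.le, le_rfl⟩ y hy
  intro t ht y hy
  have hyI : y ∈ I := Ioo_subset_Icc_self hy
  by_cases hout : |y| < 1 / 3 ∨ 2 / 3 < |y|
  · simp only [sourceW, hχ.dI_eq_zero hyI hout, hχ.dI_dI_eq_zero hyI hout]
    simp only [zero_div, zero_mul, neg_zero, mul_zero, sub_zero, abs_zero]
    positivity
  push Not at hout
  have hφy : 1 / 3 ≤ φ y := by
    rw [hφ.eq_one_sub_abs hyI (by linarith [hout.1])]
    linarith [hout.2]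
  have hφ0 : 0 < φ y := by linarith
  set z := φ y / Real.sqrt ε with hz
  have hz0 : 0 < z := div_pos hφ0 (Real.sqrt_pos.2 hε)
  obtain ⟨h1, h2⟩ := H V hV t z ht.1 hz0
  have hX : (t / z ^ 2) ^ m ≤ 9 ^ m * (ε * τ) ^ m := by
    rw [← Real.mul_rpow (by norm_num) (by positivity)]
    refine Real.rpow_le_rpow (div_nonneg ht.1.le (by positivity)) ?_ hm
    have h9 : 1 ≤ 9 * φ y ^ 2 := by nlinarith
    rw [hz, div_pow, Real.sq_sqrt hε.le, div_div_eq_mul_div, div_le_iff₀ (by positivity)]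
    have : t * ε ≤ ε * τ := by
      rw [mul_comm]
      exact mul_le_mul_of_nonneg_left ht.2 hε.le
    have h10 : 0 ≤ ε * τ := by positivity
    nlinarith
  have hX' : C * (t / z ^ 2) ^ m ≤ C * (9 ^ m * (ε * τ) ^ m) := mul_le_mul_of_nonneg_left hX hC
  -- The constants `9` and `27` below are the bounds for `φ⁻²` and `φ⁻³` when `φ ≥ 1/3`.
  have c1 : |dI (dI χ) y / φ y ^ 2| ≤ B * 9 := by
    rw [abs_div, abs_of_pos (by positivity : 0 < φ y ^ 2), div_le_iff₀ (by positivity)]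
    have : 1 ≤ 9 * φ y ^ 2 := by nlinarith
    have := hχ2 y hyI
    nlinarith
  have c2 : |dI χ y / φ y ^ 3| ≤ A * 27 := by
    rw [abs_div, abs_of_pos (by positivity : 0 < φ y ^ 3), div_le_iff₀ (by positivity)]
    have : (1 / 3) ^ 3 ≤ φ y ^ 3 := by gcongr
    have := hχ1 y hyI
    nlinarith
  have c3 : |dI φ y| = 1 := hφ.slope y hyI (by linarith [hout.1])
  calc |sourceW φ χ V ε t y|
      = |-(dI (dI χ) y / φ y ^ 2 * (z ^ 2 * V t z))
          - 2 * (dI χ y / φ y ^ 3) * dI φ y * (z ^ 3 * deriv (V t) z)| := rfl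
    _ ≤ |dI (dI χ) y / φ y ^ 2| * |z ^ 2 * V t z| +
        2 * |dI χ y / φ y ^ 3| * |z ^ 3 * deriv (V t) z| := by
        refine (abs_sub _ _).trans_eq ?_
        rw [abs_neg, abs_mul, abs_mul _ (z ^ 3 * _), abs_mul _ (dI φ y), c3, abs_mul 2, abs_two,
          mul_one]
    _ ≤ B * 9 * (C * (9 ^ m * (ε * τ) ^ m)) + 2 * (A * 27) * (C * (9 ^ m * (ε * τ) ^ m)) := by
        gcongr
        · exact h1.trans hX'
        · exact h2.trans hX'
    _ = _ := by ring

/-! ### Norms of horizontal shear profiles -/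

theorem norm_ex : ‖ex‖ = 1 := by simp [ex]

theorem measurableSet_Omega (L : ℝ) : MeasurableSet (Omega L) :=
  measurableSet_Ioo.prod measurableSet_Ioo

theorem volume_restrict_Omega (L : ℝ) :
    (volume.restrict (Omega L) : Measure (ℝ × ℝ)) =
      (volume.restrict (Ioo 0 L)).prod (volume.restrict (Ioo (-1) 1)) := by
  rw [Measure.prod_restrict, Omega, Measure.volume_eq_prod]

theorem aestronglyMeasurable_shear {f : ℝ → ℝ} (hf : ContinuousOn f (Ioo (-1) 1)) (L : ℝ) :
    AEStronglyMeasurable (fun p : ℝ × ℝ => f p.2 • ex) (volume.restrict (Omega L)) := by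
  refine ContinuousOn.aestronglyMeasurable ?_ (measurableSet_Omega L)
  exact (hf.comp continuousOn_snd fun p hp => hp.2).smul continuousOn_const

theorem eLpNorm_shear_le {f G : ℝ → ℝ} {L B : ℝ} (hL : 0 ≤ L) (hB : 0 ≤ B)
    (hG : IntegrableOn G (Ioo (-1) 1)) (hfG : ∀ y ∈ Ioo (-1 : ℝ) 1, f y ^ 2 ≤ G y)
    (hGB : ∫ y in Ioo (-1) 1, G y ≤ B ^ 2) :
    eLpNorm (fun p : ℝ × ℝ => f p.2 • ex) 2 (volume.restrict (Omega L)) ≤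
      ENNReal.ofReal (Real.sqrt L * B) := by
  have h1 : ∫⁻ p in Omega L, ‖f p.2 • ex‖ₑ ^ (2 : ℝ) ≤ ENNReal.ofReal (L * B ^ 2) := by
    calc ∫⁻ p in Omega L, ‖f p.2 • ex‖ₑ ^ (2 : ℝ)
        ≤ ∫⁻ p in Omega L, 1 * ENNReal.ofReal (G p.2) := by
          refine setLIntegral_mono' (measurableSet_Omega L) fun p hp => ?_
          rw [enorm_smul, ← ofReal_norm ex, norm_ex, ENNReal.ofReal_one, mul_one, one_mul,
            Real.enorm_eq_ofReal_abs, ENNReal.ofReal_rpow_of_nonneg (abs_nonneg _) zero_le_two]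
          refine ENNReal.ofReal_le_ofReal ?_
          rw [Real.rpow_two, sq_abs]
          exact hfG _ hp.2
      _ = (∫⁻ _ in Ioo (0 : ℝ) L, 1) * ∫⁻ y in Ioo (-1 : ℝ) 1, ENNReal.ofReal (G y) := by
          rw [volume_restrict_Omega]
          exact lintegral_prod_mul (μ := volume.restrict (Ioo 0 L))
            (ν := volume.restrict (Ioo (-1 : ℝ) 1)) (f := fun _ => 1)
            (g := fun y => ENNReal.ofReal (G y))
            aemeasurable_const hG.aestronglyMeasurable.aemeasurable.ennreal_ofReal
      _ = ENNReal.ofReal L * ENNReal.ofReal (∫ y in Ioo (-1) 1, G y) := by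
          rw [setLIntegral_one, Real.volume_Ioo, sub_zero, ofReal_integral_eq_lintegral_ofReal hG]
          filter_upwards [ae_restrict_mem measurableSet_Ioo] with y hy
            using (sq_nonneg _).trans (hfG y hy)
      _ ≤ ENNReal.ofReal (L * B ^ 2) := by
          rw [ENNReal.ofReal_mul hL]
          gcongr
  rw [eLpNorm_eq_lintegral_rpow_enorm_toReal two_ne_zero ENNReal.ofNat_ne_top,
    ENNReal.toReal_ofNat]
  calc (∫⁻ p in Omega L, ‖f p.2 • ex‖ₑ ^ (2 : ℝ)) ^ (1 / 2 : ℝ)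
      ≤ (ENNReal.ofReal (L * B ^ 2)) ^ (1 / 2 : ℝ) := by gcongr
    _ = ENNReal.ofReal (Real.sqrt L * B) := by
        rw [ENNReal.ofReal_rpow_of_nonneg (by positivity) (by norm_num), ← Real.sqrt_eq_rpow,
          Real.sqrt_mul hL, Real.sqrt_sq hB]

theorem eLpNorm_shear_le_of_bound {f : ℝ → ℝ} {L D : ℝ} (hL : 0 ≤ L) (hD : 0 ≤ D)
    (hf : ∀ y ∈ Ioo (-1 : ℝ) 1, |f y| ≤ D) :
    eLpNorm (fun p : ℝ × ℝ => f p.2 • ex) 2 (volume.restrict (Omega L)) ≤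
      ENNReal.ofReal (Real.sqrt L * (2 * D)) := by
  refine eLpNorm_shear_le (G := fun _ => D ^ 2) hL (by positivity)
    (integrableOn_const (by simp)) (fun y hy => ?_) ?_
  · rw [← sq_abs]
    gcongr
    exact hf y hy
  · simp [Measure.real]
    norm_num
    nlinarith [sq_nonneg D]

/-- The squared profile is dominated by two Gaussians in `y`, one centred at each wall, each of mass
`√(8π ε t)`. The square root of this mass gives the factor `(εt)^(1/4)`. -/
theorem exists_eLpNorm_layer_le {T L : ℝ} {n : ℕ} {h φ χ : ℝ → ℝ} (hh : IsBaseFlow T L n h)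
    (hT : 0 < T) (hL : 0 < L) (hφ : IsBoundaryDistance φ) (hχ : IsBoundaryCutoff χ) :
    ∃ C, 0 ≤ C ∧ ∀ V, IsLayerProfile h V → ∀ ε t, 0 < ε → 2 * T ≤ t →
      eLpNorm (fun p : ℝ × ℝ => (χ p.2 * -V t (φ p.2 / Real.sqrt ε)) • ex) 2
        (volume.restrict (Omega L)) ≤
          ENNReal.ofReal (C * (t ^ (-1 - n : ℝ) * (ε * t) ^ (1 / 4 : ℝ))) := by
  obtain ⟨C, hC, H⟩ := exists_abs_layerProfile_le hh hT
  set c := Real.sqrt (2 * Real.sqrt (8 * Real.pi)) with hc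
  refine ⟨Real.sqrt L * (C * c), by positivity, fun V hV ε t hε ht => ?_⟩
  have ht0 : 0 < t := by linarith
  set b := 1 / (8 * (ε * t)) with hb
  have hb0 : 0 < b := by positivity
  set K := (C * t ^ (-1 - n : ℝ)) ^ 2 with hK
  have hint : ∀ r : ℝ, Integrable fun y : ℝ => Real.exp (-b * (y + r) ^ 2) :=
    fun r => (integrable_exp_neg_mul_sq hb0).comp_add_right r
  have hval : ∀ r : ℝ, ∫ y : ℝ, Real.exp (-b * (y + r) ^ 2) = Real.sqrt (Real.pi / b) := by
    intro r
    rw [integral_add_right_eq_self (fun y => Real.exp (-b * y ^ 2)) r, integral_gaussian]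
  have hG : Integrable fun y : ℝ =>
      K * (Real.exp (-b * (y + -1) ^ 2) + Real.exp (-b * (y + 1) ^ 2)) :=
    ((hint _).add (hint _)).const_mul K
  have := eLpNorm_shear_le (f := fun y => χ y * -V t (φ y / Real.sqrt ε))
    (G := fun y => K * (Real.exp (-b * (y + -1) ^ 2) + Real.exp (-b * (y + 1) ^ 2)))
    (L := L) (B := C * t ^ (-1 - n : ℝ) * (c * (ε * t) ^ (1 / 4 : ℝ))) hL.le (by positivity)
    hG.integrableOn ?_ ?_
  · refine this.trans_eq ?_
    congr 1
    ring
  · intro y hy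
    have hyI : y ∈ I := Ioo_subset_Icc_self hy
    rcases le_or_gt |y| (1 / 3) with h1 | h1
    · rw [hχ.eq_zero y hyI h1, zero_mul, zero_pow two_ne_zero]
      positivity
    have hφy := hφ.eq_one_sub_abs hyI (by linarith)
    have hz : 0 ≤ φ y / Real.sqrt ε := div_nonneg (hφ.range y hyI).1 (Real.sqrt_nonneg _)
    have h2 := H V hV t _ ht hz
    have h3 : |χ y * -V t (φ y / Real.sqrt ε)| ≤
        C * t ^ (-1 - n : ℝ) * Real.exp (-((φ y / Real.sqrt ε) ^ 2 / (16 * t))) := by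
      rw [abs_mul, abs_neg, abs_of_nonneg (hχ.range y hyI).1]
      exact (mul_le_of_le_one_left (abs_nonneg _) (hχ.range y hyI).2).trans h2
    have h4 : Real.exp (-((φ y / Real.sqrt ε) ^ 2 / (16 * t))) ^ 2 =
        Real.exp (-b * (1 - |y|) ^ 2) := by
      rw [← Real.exp_nat_mul, hφy, div_pow, Real.sq_sqrt hε.le, hb]
      congr 1
      push_cast
      field_simp
      ring
    have h5 : Real.exp (-b * (1 - |y|) ^ 2) ≤
        Real.exp (-b * (y + -1) ^ 2) + Real.exp (-b * (y + 1) ^ 2) := by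
      rcases le_total 0 y with h6 | h6
      · rw [abs_of_nonneg h6, show (1 - y) ^ 2 = (y + -1) ^ 2 by ring]
        linarith [Real.exp_pos (-b * (y + 1) ^ 2)]
      · rw [abs_of_nonpos h6, show (1 - -y) ^ 2 = (y + 1) ^ 2 by ring]
        linarith [Real.exp_pos (-b * (y + -1) ^ 2)]
    calc (χ y * -V t (φ y / Real.sqrt ε)) ^ 2
        = |χ y * -V t (φ y / Real.sqrt ε)| ^ 2 := (sq_abs _).symm
      _ ≤ (C * t ^ (-1 - n : ℝ) * Real.exp (-((φ y / Real.sqrt ε) ^ 2 / (16 * t)))) ^ 2 := by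
          gcongr
      _ = K * Real.exp (-b * (1 - |y|) ^ 2) := by rw [mul_pow, h4]
      _ ≤ _ := by gcongr
  · have h1 : ∫ y in Ioo (-1 : ℝ) 1,
        K * (Real.exp (-b * (y + -1) ^ 2) + Real.exp (-b * (y + 1) ^ 2)) ≤
        ∫ y : ℝ, K * (Real.exp (-b * (y + -1) ^ 2) + Real.exp (-b * (y + 1) ^ 2)) :=
      setIntegral_le_integral hG (Eventually.of_forall fun y => by
        simp only [Pi.zero_apply]; positivity)
    refine h1.trans_eq ?_
    rw [integral_const_mul, integral_add (hint _) (hint _), hval, hval, mul_pow, ← hK, mul_pow, hc,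
      Real.sq_sqrt (by positivity), ← Real.rpow_natCast (_ ^ (1 / 4 : ℝ)),
      ← Real.rpow_mul (by positivity), show (1 / 4 : ℝ) * (2 : ℕ) = 1 / 2 by norm_num,
      ← Real.sqrt_eq_rpow, hb, mul_assoc 2, ← Real.sqrt_mul (by positivity)]
    rw [show Real.pi / (1 / (8 * (ε * t))) = 8 * Real.pi * (ε * t) by field_simp]
    ring

/-! ### Square integrable functions on the band -/

/-- Lebesgue measure on the section of the band. -/
abbrev nu : Measure ℝ := volume.restrict (Ioo (-1) 1)

theorem volume_restrict_openBand :
    (volume.restrict openBand : Measure (ℝ × ℝ)) = (volume : Measure ℝ).prod nu := by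
  rw [openBand, Measure.volume_eq_prod, ← Measure.prod_restrict, Measure.restrict_univ]

theorem volume_restrict_band :
    (volume.restrict band : Measure (ℝ × ℝ)) = (volume : Measure ℝ).prod nu := by
  rw [band, Measure.volume_eq_prod, ← Measure.prod_restrict, Measure.restrict_univ,
    Measure.restrict_congr_set (Ioo_ae_eq_Icc (a := (-1 : ℝ)) (b := 1)).symm]

theorem isOpen_openBand : IsOpen openBand := isOpen_univ.prod isOpen_Ioo

/-- Cauchy-Schwarz against the constant `1`, obtained by expanding `∫ (f - d)² ≥ 0` with `d = (∫ f)
/ m`. Only an upper bound `m` for the total mass is required. -/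
theorem sq_integral_le {α : Type*} [MeasurableSpace α] {μ : Measure α} [IsFiniteMeasure μ]
    {f : α → ℝ} (hf : MemLp f 2 μ) {m : ℝ} (hm : 0 < m) (hμ : μ.real univ ≤ m) :
    (∫ x, f x ∂μ) ^ 2 ≤ m * ∫ x, f x ^ 2 ∂μ := by
  set c := ∫ x, f x ∂μ with hc
  set d := c / m with hd
  have h1 : Integrable f μ := hf.integrable one_le_two
  have h2 : Integrable (fun x => f x ^ 2) μ := hf.integrable_sq
  have h3 : 0 ≤ ∫ x, (f x - d) ^ 2 ∂μ := integral_nonneg fun x => sq_nonneg _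
  have h4 : ∫ x, (f x - d) ^ 2 ∂μ = ∫ x, f x ^ 2 ∂μ - 2 * d * c + d ^ 2 * μ.real univ := by
    have e : ∀ x, (f x - d) ^ 2 = f x ^ 2 - 2 * d * f x + d ^ 2 := fun x => by ring
    have h5 : Integrable (fun x => 2 * d * f x) μ := h1.const_mul _
    have h6 : Integrable (fun x => f x ^ 2 - 2 * d * f x) μ := h2.sub h5
    simp only [e]
    rw [integral_add h6 (integrable_const _), integral_sub h2 h5, integral_const_mul,
      integral_const, ← hc, smul_eq_mul]
    ring
  have h7 : d * m = c := div_mul_cancel₀ _ hm.ne'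
  have h8 : d ^ 2 * μ.real univ ≤ d ^ 2 * m := by gcongr
  have h9 : 0 ≤ m * (∫ x, f x ^ 2 ∂μ - 2 * d * c + d ^ 2 * m) :=
    mul_nonneg hm.le (by linarith)
  have h10 : m * (∫ x, f x ^ 2 ∂μ - 2 * d * c + d ^ 2 * m) = m * ∫ x, f x ^ 2 ∂μ - c ^ 2 := by
    rw [← h7]
    ring
  linarith

theorem memLp_slice {f : ℝ × ℝ → ℝ} (hf : MemLp f 2 ((volume : Measure ℝ).prod nu)) :
    ∀ᵐ x : ℝ, MemLp (fun s => f (x, s)) 2 nu := by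
  filter_upwards [hf.1.prodMk_left, hf.integrable_sq.prod_right_ae] with x h1 h2
  exact (memLp_two_iff_integrable_sq h1).2 h2

theorem intervalIntegrable_slice {w : ℝ → ℝ} (hw : MemLp w 2 nu) :
    IntervalIntegrable w volume (-1) 1 := by
  rw [intervalIntegrable_iff_integrableOn_Ioo_of_le (by norm_num)]
  exact hw.integrable one_le_two

/-- The primitive in the vertical direction. -/
def primY (f : ℝ × ℝ → ℝ) (p : ℝ × ℝ) : ℝ := ∫ s in (-1)..p.2, f (p.1, s)

theorem primY_eq {f : ℝ × ℝ → ℝ} {x y : ℝ} (hy : y ∈ Ioo (-1 : ℝ) 1) :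
    primY f (x, y) = ∫ s, (Iic y).indicator (fun s => f (x, s)) s ∂nu := by
  rw [integral_indicator measurableSet_Iic, nu, Measure.restrict_restrict measurableSet_Iic,
    primY, intervalIntegral.integral_of_le hy.1.le]
  congr 2
  ext s
  simp only [mem_Ioc, mem_inter_iff, mem_Iic, mem_Ioo]
  constructor
  · rintro ⟨h1, h2⟩
    exact ⟨h2, h1, h2.trans_lt hy.2⟩
  · rintro ⟨h1, h2, _⟩
    exact ⟨h2, h1⟩

theorem ae_snd_mem : ∀ᵐ p ∂((volume : Measure ℝ).prod nu), p.2 ∈ Ioo (-1 : ℝ) 1 := by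
  rw [← volume_restrict_openBand]
  filter_upwards [ae_restrict_mem isOpen_openBand.measurableSet] with p hp using hp.2

theorem ae_fst_of_ae {P : ℝ → Prop} (h : ∀ᵐ x : ℝ, P x) :
    ∀ᵐ p ∂((volume : Measure ℝ).prod nu), P p.1 :=
  Measure.quasiMeasurePreserving_fst.ae h

theorem aestronglyMeasurable_primY {f : ℝ × ℝ → ℝ}
    (hf : AEStronglyMeasurable f ((volume : Measure ℝ).prod nu)) :
    AEStronglyMeasurable (primY f) ((volume : Measure ℝ).prod nu) := by
  -- A strongly measurable representative makes the integrand jointly measurable; it agrees with `f`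
  -- on almost every vertical line.
  set v := hf.mk f with hv
  have hvm : StronglyMeasurable v := hf.stronglyMeasurable_mk
  have hm : StronglyMeasurable fun q : (ℝ × ℝ) × ℝ =>
      {q : (ℝ × ℝ) × ℝ | q.2 ≤ q.1.2}.indicator (fun q => v (q.1.1, q.2)) q := by
    refine StronglyMeasurable.indicator ?_ (measurableSet_le (by fun_prop) (by fun_prop))
    exact hvm.comp_measurable (by fun_prop)
  refine ⟨fun p => ∫ s, {q : (ℝ × ℝ) × ℝ | q.2 ≤ q.1.2}.indicator
    (fun q => v (q.1.1, q.2)) (p, s) ∂nu, hm.integral_prod_right, ?_⟩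
  filter_upwards [ae_snd_mem, ae_fst_of_ae (Measure.ae_ae_of_ae_prod hf.ae_eq_mk)] with p hp hpx
  rw [← Prod.mk.eta (p := p), primY_eq hp]
  refine integral_congr_ae ?_
  filter_upwards [hpx] with s hs
  simp only [indicator, mem_Iic, mem_ofPred_eq]
  split_ifs
  · exact hs
  · rfl

theorem sq_primY_le {f : ℝ × ℝ → ℝ} {x y : ℝ} (hf : MemLp (fun s => f (x, s)) 2 nu)
    (hy : y ∈ Ioo (-1 : ℝ) 1) : primY f (x, y) ^ 2 ≤ 2 * ∫ s, f (x, s) ^ 2 ∂nu := by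
  have h1 : |primY f (x, y)| ≤ ∫ s, |f (x, s)| ∂nu := by
    rw [primY_eq hy, ← Real.norm_eq_abs]
    refine norm_integral_le_of_norm_le (hf.integrable one_le_two).norm
      (Eventually.of_forall fun s => ?_)
    exact norm_indicator_le_norm_self _ _
  have h2 := sq_integral_le hf.norm zero_lt_two (by simp [Measure.real]; norm_num)
  simp only [Real.norm_eq_abs, sq_abs] at h2
  have h3 : primY f (x, y) ^ 2 ≤ (∫ s, |f (x, s)| ∂nu) ^ 2 := by
    rw [← sq_abs]
    gcongr
  linarith

theorem memLp_primY {f : ℝ × ℝ → ℝ} (hf : MemLp f 2 ((volume : Measure ℝ).prod nu)) :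
    MemLp (primY f) 2 ((volume : Measure ℝ).prod nu) := by
  have hm := aestronglyMeasurable_primY hf.1
  rw [memLp_two_iff_integrable_sq hm]
  have hN : Integrable (fun x => 2 * ∫ s, f (x, s) ^ 2 ∂nu) volume :=
    (hf.integrable_sq.integral_prod_left).const_mul 2
  refine Integrable.mono' (hN.comp_fst nu) (hm.pow 2) ?_
  filter_upwards [ae_snd_mem, ae_fst_of_ae (memLp_slice hf)] with p hp hpx
  rw [Real.norm_of_nonneg (by positivity)]
  exact sq_primY_le hpx hp

/-- Integration by parts against a primitive. -/
theorem integral_deriv_mul_primitive {w k k' : ℝ → ℝ} (hw : IntervalIntegrable w volume (-1) 1)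
    (hk : ContDiffOn ℝ 1 k I) (hk' : ∀ y ∈ Ioo (-1 : ℝ) 1, HasDerivAt k (k' y) y) (h1 : k 1 = 0) :
    ∫ y, k' y * (∫ s in (-1)..y, w s) ∂nu = -∫ y, k y * w y ∂nu := by
  -- `w` is merely integrable, so its primitive is only absolutely continuous. The boundary terms
  -- vanish because the primitive is zero at `-1` and `k` is zero at `1`.
  have hac : AbsolutelyContinuousOnInterval (fun y => ∫ s in (-1)..y, w s) (-1) 1 :=
    hw.absolutelyContinuousOnInterval_intervalIntegral (by simp)
  have hkac : AbsolutelyContinuousOnInterval k (-1) 1 := by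
    refine ContDiffOn.absolutelyContinuousOnInterval ?_
    rwa [uIcc_of_le (by norm_num)]
  have key := hkac.integral_mul_deriv_eq_deriv_mul hac
  rw [h1, intervalIntegral.integral_same] at key
  have e : ∀ f : ℝ → ℝ, ∫ y in (-1)..1, f y = ∫ y, f y ∂nu := fun f => by
    rw [intervalIntegral.integral_of_le (by norm_num), integral_Ioc_eq_integral_Ioo]
  rw [e (fun y => k y * deriv _ y), e (fun y => deriv k y * _)] at key
  have e1 : ∫ y, k y * deriv (fun y => ∫ s in (-1)..y, w s) y ∂nu = ∫ y, k y * w y ∂nu := by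
    refine integral_congr_ae ?_
    filter_upwards [ae_restrict_of_ae hw.ae_hasDerivAt_integral,
      ae_restrict_mem measurableSet_Ioo] with y hy hmem
    have hmem' : y ∈ uIcc (-1 : ℝ) 1 := by
      rw [uIcc_of_le (by norm_num)]
      exact Ioo_subset_Icc_self hmem
    rw [(hy hmem' (-1) (by simp)).deriv]
  have e2 : ∫ y, deriv k y * (∫ s in (-1)..y, w s) ∂nu = ∫ y, k' y * (∫ s in (-1)..y, w s) ∂nu := by
    refine setIntegral_congr_fun measurableSet_Ioo fun y hy => ?_
    simp only [(hk' y hy).deriv]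
  rw [e1, e2] at key
  linarith

/-! ### The flux through a section vanishes -/

theorem contDiff_primitive {c : ℝ → ℝ} (hc : ContDiff ℝ ∞ c) :
    ContDiff ℝ ∞ fun x => ∫ s in (0)..x, c s := by
  have hd : ∀ x, HasDerivAt (fun x => ∫ s in (0)..x, c s) (c x) x :=
    fun x => (hc.continuous.integral_hasStrictDerivAt 0 x).hasDerivAt
  rw [contDiff_infty_iff_deriv]
  refine ⟨fun x => (hd x).differentiableAt, ?_⟩
  have : deriv (fun x => ∫ s in (0)..x, c s) = c := funext fun x => (hd x).deriv
  rwa [this]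

/-- A function in `L²(ℝ)` with vanishing weak derivative is zero. -/
theorem ae_eq_zero_of_weak_deriv_eq_zero {Φ : ℝ → ℝ} (hΦ : MemLp Φ 2 volume)
    (h : ∀ b : ℝ → ℝ, ContDiff ℝ ∞ b → HasCompactSupport b → ∫ x, Φ x * deriv b x = 0) :
    ∀ᵐ x, Φ x = 0 := by
  refine ae_eq_zero_of_integral_contDiff_smul_eq_zero (hΦ.locallyIntegrable (by norm_num)) ?_
  intro c hc hcs
  simp only [smul_eq_mul]
  obtain ⟨r, hr⟩ : ∃ r : ℝ, ∀ x, r ≤ |x| → c x = 0 := by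
    obtain ⟨r, hr⟩ := hcs.isCompact.isBounded.subset_ball 0
    refine ⟨r, fun x hx => ?_⟩
    by_contra hne
    have := hr (subset_tsupport _ hne)
    rw [mem_ball_zero_iff, Real.norm_eq_abs] at this
    linarith
  have hcL : MemLp c 2 volume := hc.continuous.memLp_of_hasCompactSupport hcs
  have hshift : ∀ k : ℝ, MemLp (fun x => c (x - k)) 2 volume := fun k =>
    hcL.comp_measurePreserving (measurePreserving_sub_right volume k)
  have hprim : ∀ x y : ℝ, ∫ s in x..y, c s = (∫ s in (0)..y, c s) - ∫ s in (0)..x, c s :=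
    fun x y => (intervalIntegral.integral_interval_sub_left (hc.continuous.intervalIntegrable _ _)
      (hc.continuous.intervalIntegrable _ _)).symm
  -- The difference of `c` and its translate is the derivative of a compactly supported `b`, so
  -- pairing with `Φ` is invariant under translation of `c`.
  have htrans : ∀ k : ℝ, 0 ≤ k → ∫ x, c x * Φ x = ∫ x, c (x - k) * Φ x := by
    intro k hk
    set b : ℝ → ℝ := fun x => (∫ s in (0)..x, c s) - ∫ s in (0)..(x - k), c s with hb
    have hbd : ∀ x, HasDerivAt b (c x - c (x - k)) x := fun x =>
      (hc.continuous.integral_hasStrictDerivAt 0 x).hasDerivAt.sub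
        ((hc.continuous.integral_hasStrictDerivAt 0 (x - k)).hasDerivAt.comp_sub_const x k)
    have hbs : ContDiff ℝ ∞ b := (contDiff_primitive hc).sub
      ((contDiff_primitive hc).comp (contDiff_id.sub contDiff_const))
    have hbc : HasCompactSupport b := by
      refine HasCompactSupport.intro (K := Icc (-|r|) (|r| + k)) isCompact_Icc fun x hx => ?_
      rw [hb]
      simp only
      rw [← hprim, intervalIntegral.integral_of_le (by linarith)]
      refine setIntegral_eq_zero_of_forall_eq_zero fun s hs => hr s ?_
      by_contra hlt
      have h1 := abs_lt.1 (not_le.1 hlt)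
      have h2 := le_abs_self r
      exact hx ⟨by linarith [hs.2], by linarith [hs.1]⟩
    have := h b hbs hbc
    have e : ∀ x, Φ x * deriv b x = c x * Φ x - c (x - k) * Φ x := fun x => by
      rw [(hbd x).deriv]
      ring
    simp only [e] at this
    have i1 : Integrable fun x => c x * Φ x := hcL.integrable_mul hΦ
    have i2 : Integrable fun x => c (x - k) * Φ x := (hshift k).integrable_mul hΦ
    rw [integral_sub i1 i2] at this
    linarith
  set J := ∫ x, c x * Φ x with hJ
  set D := ∫ x, c x ^ 2 with hD
  -- A far translate of `c` meets only the tail of `Φ`, whose `L²` mass tends to zero.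
  have htail : Tendsto (fun k : ℕ => ∫ x, (Ici ((k : ℝ) - r)).indicator (fun x => Φ x ^ 2) x) atTop
      (𝓝 0) := by
    have := tendsto_integral_of_dominated_convergence (μ := volume) (f := fun _ => (0 : ℝ))
      (F := fun (k : ℕ) x => (Ici ((k : ℝ) - r)).indicator (fun x => Φ x ^ 2) x)
      (fun x => Φ x ^ 2) (fun k => hΦ.integrable_sq.aestronglyMeasurable.indicator measurableSet_Ici)
      hΦ.integrable_sq (fun k => Eventually.of_forall fun x => ?_)
      (Eventually.of_forall fun x => ?_)
    · simpa using this
    · refine (norm_indicator_le_norm_self _ _).trans_eq ?_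
      rw [Real.norm_of_nonneg (sq_nonneg _)]
    · refine tendsto_const_nhds.congr' ?_
      filter_upwards [eventually_gt_atTop ⌈x + r⌉₊] with k hk
      have : x + r < k := Nat.lt_of_ceil_lt hk
      rw [indicator_of_notMem]
      simp only [mem_Ici, not_le]
      linarith
  -- Young's inequality with weight `η`; the limit `k → ∞` is taken first, then `η → 0`.
  have hbound : ∀ η : ℝ, 0 < η → ∀ k : ℕ,
      2 * |J| ≤ η * D + η⁻¹ * ∫ x, (Ici ((k : ℝ) - r)).indicator (fun x => Φ x ^ 2) x := by
    intro η hη k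
    have hi2 : Integrable (fun x => (Ici ((k : ℝ) - r)).indicator (fun x => Φ x ^ 2) x) :=
      hΦ.integrable_sq.indicator measurableSet_Ici
    have hi1 : Integrable (fun x => η * c (x - k) ^ 2) := (hshift k).integrable_sq.const_mul η
    have hD' : ∫ x, η * c (x - k) ^ 2 = η * D := by
      rw [integral_const_mul, integral_sub_right_eq_self (fun x => c x ^ 2) (k : ℝ)]
    have h1 : |J| ≤ ∫ x, (η * c (x - k) ^ 2 +
        η⁻¹ * (Ici ((k : ℝ) - r)).indicator (fun x => Φ x ^ 2) x) / 2 := by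
      rw [htrans k (Nat.cast_nonneg k), ← Real.norm_eq_abs]
      have hi3 : Integrable (fun x => (η * c (x - k) ^ 2 +
          η⁻¹ * (Ici ((k : ℝ) - r)).indicator (fun x => Φ x ^ 2) x) / 2) :=
        (hi1.add (hi2.const_mul _)).div_const 2
      refine norm_integral_le_of_norm_le hi3
        (Eventually.of_forall fun x => ?_)
      by_cases hx : r ≤ |x - k|
      · rw [hr _ hx]
        have : 0 ≤ (Ici ((k : ℝ) - r)).indicator (fun x => Φ x ^ 2) x :=
          indicator_nonneg (fun _ _ => sq_nonneg _) _
        simp only [zero_mul, norm_zero]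
        positivity
      · have hx' := (abs_lt.1 (not_le.1 hx)).1
        rw [indicator_of_mem (by simp only [mem_Ici]; linarith), norm_mul, Real.norm_eq_abs,
          Real.norm_eq_abs, ← sq_abs (c _), ← sq_abs (Φ x), le_div_iff₀ two_pos]
        have e : η * |c (x - k)| ^ 2 + η⁻¹ * |Φ x| ^ 2 - |c (x - k)| * |Φ x| * 2 =
            η * (|c (x - k)| - η⁻¹ * |Φ x|) ^ 2 := by
          field_simp
          ring
        have : 0 ≤ η * (|c (x - k)| - η⁻¹ * |Φ x|) ^ 2 := by positivity
        linarith
    rw [integral_div, integral_add hi1 (hi2.const_mul _), hD', integral_const_mul] at h1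
    linarith
  have hlim : ∀ η : ℝ, 0 < η → 2 * |J| ≤ η * D := by
    intro η hη
    have := (htail.const_mul η⁻¹).const_add (η * D)
    rw [mul_zero, add_zero] at this
    exact ge_of_tendsto this (Eventually.of_forall fun k => hbound η hη k)
  have hlim2 : Tendsto (fun η : ℝ => η * D) (𝓝[>] 0) (𝓝 0) := by
    have : Tendsto (fun η : ℝ => η * D) (𝓝 0) (𝓝 (0 * D)) := tendsto_id.mul_const D
    rw [zero_mul] at this
    exact this.mono_left nhdsWithin_le_nhds
  have := ge_of_tendsto hlim2 (by filter_upwards [self_mem_nhdsWithin] with η hη using hlim η hη)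
  have : |J| = 0 := le_antisymm (by linarith) (abs_nonneg _)
  exact abs_eq_zero.1 this

section Field

variable {ub : ℝ × ℝ → E2}

theorem IsL2div.memLp_coord (hu : IsL2div ub) (i : Fin 2) :
    MemLp (fun p => ub p i) 2 ((volume : Measure ℝ).prod nu) := by
  have := hu.memLp
  rw [volume_restrict_band] at this
  exact (EuclideanSpace.proj i : E2 →L[ℝ] ℝ).comp_memLp' this

theorem memLp_integral_section {f : ℝ × ℝ → ℝ} (hf : MemLp f 2 ((volume : Measure ℝ).prod nu)) :
    MemLp (fun x => ∫ s, f (x, s) ∂nu) 2 volume := by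
  have hm : AEStronglyMeasurable (fun x => ∫ s, f (x, s) ∂nu) volume := hf.1.integral_prod_right'
  rw [memLp_two_iff_integrable_sq hm]
  refine Integrable.mono' (hf.integrable_sq.integral_prod_left.const_mul 2) (hm.pow 2) ?_
  filter_upwards [memLp_slice hf] with x hx
  rw [Real.norm_of_nonneg (by positivity)]
  exact sq_integral_le hx zero_lt_two (by simp [Measure.real]; norm_num)

/-- The field is tested against the gradient of `b(x) ρ(y)` with `ρ = 1` across the band. This is
admissible because test functions need not vanish on the walls, and it shows that the flux has zero
weak derivative. Square integrability excludes a nonzero constant. -/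
theorem IsL2div.flux_eq_zero (hu : IsL2div ub) : ∀ᵐ x : ℝ, ∫ s, ub (x, s) 0 ∂nu = 0 := by
  have hu0 := hu.memLp_coord 0
  refine ae_eq_zero_of_weak_deriv_eq_zero (memLp_integral_section hu0) fun b hb hbc => ?_
  let ρ : ContDiffBump (0 : ℝ) := ⟨2, 3, by norm_num, by norm_num⟩
  have hρ : ∀ y ∈ Ioo (-1 : ℝ) 1, ρ y = 1 ∧ HasDerivAt ρ 0 y := by
    intro y hy
    have h1 : ∀ x ∈ Ioo (-1 : ℝ) 1, ρ x = 1 := fun x hx => ρ.one_of_mem_closedBall (by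
      rw [mem_closedBall_zero_iff, Real.norm_eq_abs, abs_le]
      exact ⟨by linarith [hx.1], by linarith [hx.2]⟩)
    refine ⟨h1 y hy, (hasDerivAt_const y (1 : ℝ)).congr_of_eventuallyEq ?_⟩
    filter_upwards [Ioo_mem_nhds hy.1 hy.2] with x hx using h1 x hx
  have hbd : ∀ x, HasDerivAt b (deriv b x) x := fun x =>
    (hb.differentiable (by simp) x).hasDerivAt
  have hq : ContDiff ℝ ∞ fun p : ℝ × ℝ => b p.1 * ρ p.2 :=
    (hb.comp contDiff_fst).mul (ρ.contDiff.comp contDiff_snd)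
  have hqc : HasCompactSupport fun p : ℝ × ℝ => b p.1 * ρ p.2 := by
    refine HasCompactSupport.intro (hbc.isCompact.prod ρ.hasCompactSupport.isCompact)
      fun p hp => ?_
    by_contra hne
    exact hp ⟨subset_tsupport _ (left_ne_zero_of_mul hne),
      subset_tsupport _ (right_ne_zero_of_mul hne)⟩
  have hqd : ∀ p : ℝ × ℝ, p.2 ∈ Ioo (-1 : ℝ) 1 →
      fderiv ℝ (fun p : ℝ × ℝ => b p.1 * ρ p.2) p (1, 0) = deriv b p.1 ∧
      fderiv ℝ (fun p : ℝ × ℝ => b p.1 * ρ p.2) p (0, 1) = 0 := by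
    intro p hp
    obtain ⟨h1, h2⟩ := hρ p.2 hp
    have hb1 := (hbd p.1).hasFDerivAt.comp p (hasFDerivAt_fst (𝕜 := ℝ) (E := ℝ) (F := ℝ) (p := p))
    have hρ1 := h2.hasFDerivAt.comp p (hasFDerivAt_snd (𝕜 := ℝ) (E := ℝ) (F := ℝ) (p := p))
    have hm : HasFDerivAt (fun p : ℝ × ℝ => b p.1 * ρ p.2) _ p := hb1.mul hρ1
    have := hm.fderiv
    rw [this]
    simp [h1]
  have h0 := hu.div_free _ hq hqc
  rw [volume_restrict_band] at h0
  have h1 : ∫ p, ub p 0 * deriv b p.1 ∂((volume : Measure ℝ).prod nu) = 0 := by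
    rw [← h0]
    refine integral_congr_ae ?_
    filter_upwards [ae_snd_mem] with p hp
    obtain ⟨e1, e2⟩ := hqd p hp
    rw [e1, e2, mul_zero, add_zero]
  have hdb : MemLp (fun p : ℝ × ℝ => deriv b p.1) 2 ((volume : Measure ℝ).prod nu) := by
    have : MemLp (deriv b) 2 volume :=
      (hb.continuous_deriv (by simp)).memLp_of_hasCompactSupport hbc.deriv
    exact this.comp_fst nu
  have hi : Integrable (fun p : ℝ × ℝ => ub p 0 * deriv b p.1)
      ((volume : Measure ℝ).prod nu) := hu0.integrable_mul hdb
  rw [integral_prod _ hi] at h1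
  rw [← h1]
  congr 1
  ext x
  exact (integral_mul_const _ _).symm

end Field

/-! ### The perpendicular gradient of a cut-off stream function -/

open scoped Convolution in
-- The integral is a convolution of `F` with a measure carried by a vertical segment, so it inherits
-- the smoothness of `F`.
theorem contDiff_vertical_integral {F : ℝ × ℝ → ℝ} (hF : ContDiff ℝ ∞ F)
    (hFc : HasCompactSupport F) :
    ContDiff ℝ ∞ fun p : ℝ × ℝ => ∫ s in Ioc (0 : ℝ) 2, F (p.1, p.2 + s) := by
  let μ' : Measure (ℝ × ℝ) := (volume.restrict (Ioc (0 : ℝ) 2)).map fun s : ℝ => ((0 : ℝ), -s)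
  have hm : Measurable fun s : ℝ => ((0 : ℝ), -s) := by fun_prop
  have hfin : IsFiniteMeasure μ' := Measure.isFiniteMeasure_map _ _
  have h1 : ContDiff ℝ ∞ ((fun _ => (1 : ℝ)) ⋆[ContinuousLinearMap.lsmul ℝ ℝ, μ'] F) :=
    hFc.contDiff_convolution_right _ (locallyIntegrable_const 1) hF
  convert! h1 using 1
  ext p
  rw [convolution_def, integral_map hm.aemeasurable]
  · simp [Prod.sub_def]
  · refine Continuous.aestronglyMeasurable ?_
    have := hF.continuous
    simp only [ContinuousLinearMap.lsmul_apply, one_smul]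
    fun_prop

theorem hasCompactSupport_vertical_integral {F : ℝ × ℝ → ℝ} (hFc : HasCompactSupport F) :
    HasCompactSupport fun p : ℝ × ℝ => ∫ s in Ioc (0 : ℝ) 2, F (p.1, p.2 + s) := by
  have hK : IsCompact ((fun r : (ℝ × ℝ) × ℝ => (r.1.1, r.1.2 - r.2)) ''
      (tsupport F ×ˢ Icc (0 : ℝ) 2)) :=
    (hFc.isCompact.prod isCompact_Icc).image (by fun_prop)
  refine HasCompactSupport.intro hK fun p hp => ?_
  refine setIntegral_eq_zero_of_forall_eq_zero fun s hs => ?_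
  by_contra hne
  exact hp ⟨((p.1, p.2 + s), s), ⟨subset_tsupport _ hne, hs.1.le, hs.2⟩, by simp⟩

theorem hasDerivAt_vertical {f : ℝ × ℝ → ℝ} {x y : ℝ} (hf : DifferentiableAt ℝ f (x, y)) :
    HasDerivAt (fun y => f (x, y)) (fderiv ℝ f (x, y) (0, 1)) y :=
  hf.hasFDerivAt.comp_hasDerivAt y ((hasDerivAt_const y x).prodMk (hasDerivAt_id y))

theorem hasDerivAt_horizontal {f : ℝ × ℝ → ℝ} {x y : ℝ} (hf : DifferentiableAt ℝ f (x, y)) :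
    HasDerivAt (fun x => f (x, y)) (fderiv ℝ f (x, y) (1, 0)) x :=
  hf.hasFDerivAt.comp_hasDerivAt (f := fun x => (x, y)) x
    ((hasDerivAt_id x).prodMk (hasDerivAt_const x y))

theorem contDiff_fderiv_apply {f : ℝ × ℝ → ℝ} (hf : ContDiff ℝ ∞ f) (v : ℝ × ℝ) :
    ContDiff ℝ ∞ fun p => fderiv ℝ f p v :=
  (hf.fderiv_right (m := ∞) (by norm_cast)).clm_apply contDiff_const

theorem fderiv_fderiv_apply {f : ℝ × ℝ → ℝ} (hf : ContDiff ℝ ∞ f) (p v w : ℝ × ℝ) :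
    fderiv ℝ (fun p => fderiv ℝ f p v) p w = fderiv ℝ (fderiv ℝ f) p w v := by
  have hdd : HasFDerivAt (fderiv ℝ f) (fderiv ℝ (fderiv ℝ f) p) p :=
    ((hf.fderiv_right (m := 1) (by norm_cast)).differentiable (by simp) p).hasFDerivAt
  have := ((ContinuousLinearMap.apply ℝ ℝ v).hasFDerivAt.comp p hdd).fderiv
  simp only [Function.comp_def, ContinuousLinearMap.apply_apply] at this
  rw [this]
  simp

/-- The function is `q(x,y) = ∫ F(x, ·)` over `(y, y+2]`. A window of length `2` keeps the support
compact, while for `y` in `(-1,1)` its upper end lies above the band, where `F = 0`; hence `∂_y q =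
-F` there and `q = 0` on the top wall. It need not vanish on the bottom wall. -/
theorem exists_test_primitive {F : ℝ × ℝ → ℝ} (hF : ContDiff ℝ ∞ F) (hFc : HasCompactSupport F)
    (hF0 : ∀ p ∉ openBand, F p = 0) :
    ∃ q : ℝ × ℝ → ℝ, ContDiff ℝ ∞ q ∧ HasCompactSupport q ∧
      (∀ x, ∀ y ∈ Ioo (-1 : ℝ) 1, fderiv ℝ q (x, y) (0, 1) = -F (x, y)) ∧
      (∀ x, fderiv ℝ q (x, 1) (1, 0) = 0) ∧
      ∀ x, ∀ y ∈ Ioo (-1 : ℝ) 1,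
        HasDerivAt (fun y => fderiv ℝ q (x, y) (1, 0)) (-fderiv ℝ F (x, y) (1, 0)) y := by
  obtain ⟨q, hqdef⟩ : ∃ q : ℝ × ℝ → ℝ, q = fun p => ∫ s in Ioc (0 : ℝ) 2, F (p.1, p.2 + s) :=
    ⟨_, rfl⟩
  have hq : ContDiff ℝ ∞ q := hqdef ▸ contDiff_vertical_integral hF hFc
  have hqc : HasCompactSupport q := hqdef ▸ hasCompactSupport_vertical_integral hFc
  have hqd : Differentiable ℝ q := hq.differentiable (by simp)
  have hy1 : ∀ x, ∀ y ∈ Ioo (-1 : ℝ) 1, fderiv ℝ q (x, y) (0, 1) = -F (x, y) := by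
    intro x y hy
    have hcF : Continuous fun s => F (x, s) := hF.continuous.comp (by fun_prop)
    have e : ∀ y, q (x, y) = (∫ s in (0)..(y + 2), F (x, s)) - ∫ s in (0)..y, F (x, s) := by
      intro y
      rw [intervalIntegral.integral_interval_sub_left (hcF.intervalIntegrable _ _)
        (hcF.intervalIntegrable _ _), hqdef]
      simp only
      rw [← intervalIntegral.integral_of_le (by norm_num),
        intervalIntegral.integral_comp_add_left (fun s => F (x, s)), add_zero]
    have h1 : HasDerivAt (fun y => q (x, y)) (F (x, y + 2) - F (x, y)) y := by
      simp only [e]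
      exact ((hcF.integral_hasStrictDerivAt 0 (y + 2)).hasDerivAt.comp_add_const y 2).sub
        (hcF.integral_hasStrictDerivAt 0 y).hasDerivAt
    rw [(hasDerivAt_vertical (hqd (x, y))).unique h1, hF0 (x, y + 2), zero_sub]
    rintro ⟨-, h3⟩
    have h4 : y + 2 < 1 := h3.2
    linarith [hy.1]
  refine ⟨q, hq, hqc, hy1, fun x => ?_, fun x y hy => ?_⟩
  · have h1 : (fun x => q (x, 1)) = fun _ => 0 := by
      ext x
      rw [hqdef]
      refine setIntegral_eq_zero_of_forall_eq_zero fun s hs => hF0 _ ?_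
      rintro ⟨-, h3⟩
      have h4 : 1 + s < 1 := h3.2
      linarith [hs.1]
    have h2 := hasDerivAt_horizontal (hqd (x, 1))
    rw [h1] at h2
    exact h2.unique (hasDerivAt_const x 0)
  · have hsymm : IsSymmSndFDerivAt ℝ q (x, y) :=
      hq.contDiffAt.isSymmSndFDerivAt (by simp only [minSmoothness_of_isRCLikeNormedField]; norm_cast)
    have hd : ∀ v, Differentiable ℝ fun p => fderiv ℝ q p v :=
      fun v => (contDiff_fderiv_apply hq v).differentiable (by simp)
    have h1 := hasDerivAt_vertical (hd (1, 0) (x, y))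
    have h2 := hasDerivAt_horizontal (hd (0, 1) (x, y))
    have h3 : HasDerivAt (fun x => fderiv ℝ q (x, y) (0, 1)) (-fderiv ℝ F (x, y) (1, 0)) x := by
      simp only [hy1 _ y hy]
      exact (hasDerivAt_horizontal (hF.differentiable (by simp) (x, y))).neg
    rw [fderiv_fderiv_apply hq] at h1 h2
    rw [hsymm.eq, h2.unique h3] at h1
    exact h1

theorem integrable_weight_mul {f θ : ℝ × ℝ → ℝ} {A : ℝ → ℝ}
    (hf : MemLp f 2 ((volume : Measure ℝ).prod nu)) (hA : ContinuousOn A I) (hθ : Continuous θ)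
    (hθc : HasCompactSupport θ) :
    Integrable (fun p => A p.2 * θ p * f p) ((volume : Measure ℝ).prod nu) := by
  -- `A` is controlled only on `[-1,1]`, so it is extended by its end values to become continuous on
  -- the line.
  set A' : ℝ → ℝ := IccExtend (by norm_num : (-1 : ℝ) ≤ 1) ((Icc (-1) 1).domRestrict A)
  have hA' : Continuous A' := (continuousOn_iff_continuous_domRestrict.1 hA).Icc_extend'
  have hk : MemLp (fun p : ℝ × ℝ => A' p.2 * θ p) 2 ((volume : Measure ℝ).prod nu) :=
    Continuous.memLp_of_hasCompactSupport (by fun_prop) hθc.mul_left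
  have := hk.integrable_mul hf
  refine this.congr ?_
  filter_upwards [ae_snd_mem] with p hp
  have : A' p.2 = A p.2 := IccExtend_of_mem _ _ (Ioo_subset_Icc_self hp)
  simp only [Pi.mul_apply, this]

theorem contDiff_cutoff_mul {A : ℝ → ℝ} (hA : ContDiffOn ℝ ∞ A I) {θ : ℝ × ℝ → ℝ}
    (hθ : ContDiff ℝ ∞ θ) (hθs : tsupport θ ⊆ openBand) :
    ContDiff ℝ ∞ fun p : ℝ × ℝ => A p.2 * θ p := by
  rw [contDiff_iff_contDiffAt]
  intro p
  by_cases hp : p ∈ openBand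
  · have hp2 : p.2 ∈ Ioo (-1 : ℝ) 1 := hp.2
    have h1 : ContDiffAt ℝ ∞ A p.2 := hA.contDiffAt (Icc_mem_nhds hp2.1 hp2.2)
    exact (h1.comp p contDiffAt_snd).mul hθ.contDiffAt
  · have : (fun p : ℝ × ℝ => A p.2 * θ p) =ᶠ[𝓝 p] fun _ => 0 := by
      filter_upwards [(isClosed_tsupport θ).isOpen_compl.mem_nhds fun h => hp (hθs h)] with r hr
      rw [image_eq_zero_of_notMem_tsupport hr, mul_zero]
    exact contDiffAt_const.congr_of_eventuallyEq this

section Field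

variable {ub : ℝ × ℝ → E2} {A : ℝ → ℝ} {θ : ℝ × ℝ → ℝ}

/-- Fubini and integration by parts on almost every vertical line. -/
theorem integral_perpGrad_fst (hu : IsL2div ub) (hA : ContDiffOn ℝ ∞ A I) (hθ : ContDiff ℝ ∞ θ)
    (hθc : HasCompactSupport θ) (hθs : tsupport θ ⊆ openBand) :
    ∫ p, (dI A p.2 * primY (fun p => ub p 0) p + A p.2 * ub p 0) * θ p
        ∂((volume : Measure ℝ).prod nu) =
      ∫ p, A p.2 * -primY (fun p => ub p 0) p * fderiv ℝ θ p (0, 1)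
        ∂((volume : Measure ℝ).prod nu) := by
  set P := primY fun p => ub p 0 with hP
  have hu0 := hu.memLp_coord 0
  have hPL : MemLp P 2 ((volume : Measure ℝ).prod nu) := memLp_primY hu0
  have hθy : Continuous fun p => fderiv ℝ θ p (0, 1) := (contDiff_fderiv_apply hθ _).continuous
  have i1 := integrable_weight_mul hPL (contDiffOn_dI hA).continuousOn hθ.continuous hθc
  have i2 := integrable_weight_mul hu0 hA.continuousOn hθ.continuous hθc
  have i3 := integrable_weight_mul hPL hA.continuousOn hθy (hθc.fderiv_apply ℝ _)
  have key : ∫ p, (dI A p.2 * θ p * P p + A p.2 * fderiv ℝ θ p (0, 1) * P p)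
      ∂((volume : Measure ℝ).prod nu) =
      ∫ p, -(A p.2 * θ p * ub p 0) ∂((volume : Measure ℝ).prod nu) := by
    have i13 : Integrable (fun p => dI A p.2 * θ p * P p + A p.2 * fderiv ℝ θ p (0, 1) * P p)
        ((volume : Measure ℝ).prod nu) := i1.add i3
    have i2n : Integrable (fun p => -(A p.2 * θ p * ub p 0))
        ((volume : Measure ℝ).prod nu) := i2.neg
    rw [integral_prod _ i13, integral_prod _ i2n]
    refine integral_congr_ae ?_
    filter_upwards [memLp_slice hu0] with x hx
    have := integral_deriv_mul_primitive (w := fun s => ub (x, s) 0)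
      (k := fun y => A y * θ (x, y))
      (k' := fun y => dI A y * θ (x, y) + A y * fderiv ℝ θ (x, y) (0, 1))
      (intervalIntegrable_slice hx)
      ((hA.of_le (by norm_cast)).mul ((hθ.of_le (by norm_cast)).comp (by fun_prop)).contDiffOn)
      (fun y hy => (hasDerivAt_dI hA hy).mul (hasDerivAt_vertical (hθ.differentiable (by simp) (x, y))))
      (by
        rw [image_eq_zero_of_notMem_tsupport (f := θ), mul_zero]
        intro h
        exact lt_irrefl (1 : ℝ) (hθs h).2.2)
    rw [← integral_neg] at this
    refine Eq.trans ?_ this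
    congr 1
    ext y
    simp only [hP, primY]
    ring
  have e1 : ∫ p, (dI A p.2 * P p + A p.2 * ub p 0) * θ p ∂((volume : Measure ℝ).prod nu) =
      ∫ p, dI A p.2 * θ p * P p ∂((volume : Measure ℝ).prod nu) +
      ∫ p, A p.2 * θ p * ub p 0 ∂((volume : Measure ℝ).prod nu) := by
    rw [← integral_add i1 i2]
    congr 1
    ext p
    ring
  have e2 : ∫ p, A p.2 * -P p * fderiv ℝ θ p (0, 1) ∂((volume : Measure ℝ).prod nu) =
      -∫ p, A p.2 * fderiv ℝ θ p (0, 1) * P p ∂((volume : Measure ℝ).prod nu) := by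
    rw [← integral_neg]
    congr 1
    ext p
    ring
  rw [integral_add i1 i3, integral_neg] at key
  rw [e1, e2]
  linarith

/-- Here `∂_x ψ_b = u_b·e_y` is extracted from the divergence condition. Testing with `q` such that
`∂_y q = -A θ` exchanges `u_b·e_y` for `u_b·e_x` against `∂_x q`, and an integration by parts in `y`
brings in the primitive. As `A` does not depend on `x`, `∂_x (A θ) = A ∂_x θ`. -/
theorem integral_perpGrad_snd (hu : IsL2div ub) (hA : ContDiffOn ℝ ∞ A I) (hθ : ContDiff ℝ ∞ θ)
    (hθc : HasCompactSupport θ) (hθs : tsupport θ ⊆ openBand) :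
    ∫ p, A p.2 * ub p 1 * θ p ∂((volume : Measure ℝ).prod nu) =
      -∫ p, A p.2 * -primY (fun p => ub p 0) p * fderiv ℝ θ p (1, 0)
        ∂((volume : Measure ℝ).prod nu) := by
  set P := primY fun p => ub p 0 with hP
  have hu0 := hu.memLp_coord 0
  have hu1 := hu.memLp_coord 1
  have hPL : MemLp P 2 ((volume : Measure ℝ).prod nu) := memLp_primY hu0
  set F : ℝ × ℝ → ℝ := fun p => A p.2 * θ p with hFdef
  have hF : ContDiff ℝ ∞ F := contDiff_cutoff_mul hA hθ hθs
  have hFc : HasCompactSupport F := hθc.mul_left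
  obtain ⟨q, hq, hqc, hqy, hq1, hqxy⟩ := exists_test_primitive hF hFc fun p hp => by
    simp only [hFdef]
    rw [image_eq_zero_of_notMem_tsupport fun h => hp (hθs h), mul_zero]
  have hFx : ∀ p : ℝ × ℝ, p.2 ∈ Ioo (-1 : ℝ) 1 →
      fderiv ℝ F p (1, 0) = A p.2 * fderiv ℝ θ p (1, 0) := by
    rintro ⟨x, y⟩ -
    have h1 := hasDerivAt_horizontal (hF.differentiable (by simp) (x, y))
    have h2 := hasDerivAt_horizontal (hθ.differentiable (by simp) (x, y))
    exact h1.unique (h2.const_mul (A y))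
  have hqx : Continuous fun p => fderiv ℝ q p (1, 0) := (contDiff_fderiv_apply hq _).continuous
  have hθx : Continuous fun p => fderiv ℝ θ p (1, 0) := (contDiff_fderiv_apply hθ _).continuous
  have j1 := integrable_weight_mul (A := fun _ => 1) hu0 continuousOn_const hqx
    (hqc.fderiv_apply ℝ _)
  have j2 := integrable_weight_mul hPL hA.continuousOn hθx (hθc.fderiv_apply ℝ _)
  have j3 := integrable_weight_mul hu1 hA.continuousOn hθ.continuous hθc
  have hdiv : ∫ p, 1 * fderiv ℝ q p (1, 0) * ub p 0 ∂((volume : Measure ℝ).prod nu) =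
      ∫ p, A p.2 * θ p * ub p 1 ∂((volume : Measure ℝ).prod nu) := by
    have h0 := hu.div_free q hq hqc
    rw [volume_restrict_band] at h0
    have h1 : ∫ p, (1 * fderiv ℝ q p (1, 0) * ub p 0 - A p.2 * θ p * ub p 1)
        ∂((volume : Measure ℝ).prod nu) = 0 := by
      refine (integral_congr_ae ?_).trans h0
      filter_upwards [ae_snd_mem] with p hp
      have := hqy p.1 p.2 hp
      rw [Prod.mk.eta] at this
      rw [this]
      simp only [hFdef]
      ring
    rw [integral_sub j1 j3] at h1
    linarith
  have key : ∫ p, -(A p.2 * fderiv ℝ θ p (1, 0) * P p) ∂((volume : Measure ℝ).prod nu) =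
      ∫ p, -(1 * fderiv ℝ q p (1, 0) * ub p 0) ∂((volume : Measure ℝ).prod nu) := by
    have j2n : Integrable (fun p => -(A p.2 * fderiv ℝ θ p (1, 0) * P p))
        ((volume : Measure ℝ).prod nu) := j2.neg
    have j1n : Integrable (fun p => -(1 * fderiv ℝ q p (1, 0) * ub p 0))
        ((volume : Measure ℝ).prod nu) := j1.neg
    rw [integral_prod _ j2n, integral_prod _ j1n]
    refine integral_congr_ae ?_
    filter_upwards [memLp_slice hu0] with x hx
    have := integral_deriv_mul_primitive (w := fun s => ub (x, s) 0)
      (k := fun y => fderiv ℝ q (x, y) (1, 0))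
      (k' := fun y => -fderiv ℝ F (x, y) (1, 0))
      (intervalIntegrable_slice hx)
      (((contDiff_fderiv_apply hq _).of_le (by norm_cast)).comp
        (by fun_prop : ContDiff ℝ 1 fun y : ℝ => (x, y))).contDiffOn
      (fun y hy => hqxy x y hy) (hq1 x)
    rw [← integral_neg] at this
    refine Eq.trans ?_ (this.trans ?_)
    · refine setIntegral_congr_fun measurableSet_Ioo fun y hy => ?_
      simp only [hFx (x, y) hy, hP, primY]
      ring
    · congr 1
      ext y
      ring
  rw [integral_neg, integral_neg, hdiv] at key
  have e1 : ∫ p, A p.2 * ub p 1 * θ p ∂((volume : Measure ℝ).prod nu) =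
      ∫ p, A p.2 * θ p * ub p 1 ∂((volume : Measure ℝ).prod nu) := by
    congr 1
    ext p
    ring
  have e2 : ∫ p, A p.2 * -P p * fderiv ℝ θ p (1, 0) ∂((volume : Measure ℝ).prod nu) =
      -∫ p, A p.2 * fderiv ℝ θ p (1, 0) * P p ∂((volume : Measure ℝ).prod nu) := by
    rw [← integral_neg]
    congr 1
    ext p
    ring
  rw [e1, e2]
  linarith

end Field

theorem ae_eq_of_forall_test {f G : ℝ × ℝ → ℝ} (hf : LocallyIntegrableOn f openBand)
    (hG : LocallyIntegrableOn G openBand)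
    (h : ∀ θ : ℝ × ℝ → ℝ, ContDiff ℝ ∞ θ → HasCompactSupport θ → tsupport θ ⊆ openBand →
      ∫ p in openBand, f p * θ p = ∫ p in openBand, G p * θ p) :
    ∀ᵐ p ∂((volume : Measure ℝ).prod nu), f p = G p := by
  have key := isOpen_openBand.ae_eq_zero_of_integral_contDiff_smul_eq_zero (hf.sub hG) ?_
  · rw [← volume_restrict_openBand]
    filter_upwards [ae_restrict_of_ae key, ae_restrict_mem isOpen_openBand.measurableSet] with p h1 h2
    exact sub_eq_zero.1 (h1 h2)
  · intro θ hθ hθc hθs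
    have hint : ∀ k : ℝ × ℝ → ℝ, LocallyIntegrableOn k openBand →
        IntegrableOn (fun p => k p * θ p) openBand := by
      intro k hk
      have h1 : IntegrableOn (fun p => k p * θ p) (tsupport θ) :=
        (hk.integrableOn_compact_subset hθs hθc).mul_continuousOn hθ.continuous.continuousOn hθc
      rw [integrableOn_iff_integrable_of_support_subset] at h1
      · exact h1.integrableOn
      · exact fun p hp => subset_tsupport _ (right_ne_zero_of_mul hp)
    have h2 : ∫ p in openBand, (f p * θ p - G p * θ p) = 0 := by
      rw [integral_sub (hint f hf) (hint G hG), h θ hθ hθc hθs, sub_self]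
    rw [setIntegral_eq_integral_of_forall_compl_eq_zero] at h2
    · rw [← h2]
      congr 1
      ext p
      simp only [Pi.sub_apply, smul_eq_mul]
      ring
    · intro p hp
      rw [image_eq_zero_of_notMem_tsupport fun hh => hp (hθs hh), mul_zero, mul_zero, sub_zero]

theorem locallyIntegrableOn_openBand {f : ℝ × ℝ → ℝ}
    (hf : MemLp f 2 ((volume : Measure ℝ).prod nu)) : LocallyIntegrableOn f openBand := by
  rw [← volume_restrict_openBand] at hf
  exact locallyIntegrableOn_of_locallyIntegrable_restrict (hf.locallyIntegrable (by norm_num))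

theorem aestronglyMeasurable_snd {A : ℝ → ℝ} (hA : ContinuousOn A I) :
    AEStronglyMeasurable (fun p : ℝ × ℝ => A p.2) ((volume : Measure ℝ).prod nu) := by
  rw [← volume_restrict_openBand]
  exact (hA.comp continuousOn_snd fun p hp => Ioo_subset_Icc_self hp.2).aestronglyMeasurable
    isOpen_openBand.measurableSet

theorem memLp_weight_smul {E : Type*} [NormedAddCommGroup E] [NormedSpace ℝ E] {A : ℝ → ℝ}
    (hA : ContDiffOn ℝ ∞ A I) {f : ℝ × ℝ → E} (hf : MemLp f 2 ((volume : Measure ℝ).prod nu)) :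
    MemLp (fun p => A p.2 • f p) 2 ((volume : Measure ℝ).prod nu) := by
  obtain ⟨C, -, hC⟩ := exists_abs_le_on_I hA
  refine hf.of_le_mul (c := C) ((aestronglyMeasurable_snd hA.continuousOn).smul hf.1) ?_
  filter_upwards [ae_snd_mem] with p hp
  rw [norm_smul, Real.norm_eq_abs]
  gcongr
  exact hC _ (Ioo_subset_Icc_self hp)

/-- The Leibniz rule for `∇^⊥[A ψ_b]`, which replaces the distributional definition by a formula in
`L²`. -/
theorem IsPerpGrad.ae_eq {ub g : ℝ × ℝ → E2} {A : ℝ → ℝ} (hu : IsL2div ub)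
    (hA : ContDiffOn ℝ ∞ A I) (hg : IsPerpGrad (fun p => A p.2 * streamFunction ub p) g) :
    ∀ᵐ p ∂((volume : Measure ℝ).prod nu),
      g p = (dI A p.2 * primY (fun p => ub p 0) p) • ex + A p.2 • ub p := by
  have hproj : ∀ i : Fin 2, LocallyIntegrableOn (fun p => g p i) openBand := fun i p hp => by
    obtain ⟨s, hs, hi⟩ := hg.loc_int_grad p hp
    exact ⟨s, hs, (EuclideanSpace.proj i : E2 →L[ℝ] ℝ).integrable_comp hi⟩
  have hP := memLp_primY (hu.memLp_coord 0)
  have h0 := ae_eq_of_forall_test (hproj 0)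
    (G := fun p => dI A p.2 * primY (fun p => ub p 0) p + A p.2 * ub p 0)
    (locallyIntegrableOn_openBand ((memLp_weight_smul (contDiffOn_dI hA) hP).add
      (memLp_weight_smul hA (hu.memLp_coord 0)))) fun θ hθ hθc hθs => by
      rw [hg.fst θ hθ hθc hθs, volume_restrict_openBand, integral_perpGrad_fst hu hA hθ hθc hθs]
      rfl
  have h1 := ae_eq_of_forall_test (hproj 1) (G := fun p => A p.2 * ub p 1)
    (locallyIntegrableOn_openBand (memLp_weight_smul hA (hu.memLp_coord 1)))
    fun θ hθ hθc hθs => by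
      rw [hg.snd θ hθ hθc hθs, volume_restrict_openBand, integral_perpGrad_snd hu hA hθ hθc hθs]
      rfl
  filter_upwards [h0, h1] with p e0 e1
  ext i
  fin_cases i
  · simpa [ex] using e0
  · simpa [ex] using e1

/-! ### The edge strips -/

/-- The part of the section close to the boundary. -/
def edgeSection (δ : ℝ) : Set ℝ := {s | 1 - 2 * δ ≤ |s|}

theorem measurableSet_edgeSection (δ : ℝ) : MeasurableSet (edgeSection δ) :=
  measurableSet_le measurable_const (by fun_prop)

/-- Zero flux allows the primitive to be computed from the nearer wall: from below if `y ≤ 0`, and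
as minus the integral over `(y, 1)` if `y ≥ 0`. The interval then lies in the edge section and has
length at most `1`, so Cauchy-Schwarz costs no constant. -/
theorem sq_primY_le_edge {ub : ℝ × ℝ → E2} {δ x y : ℝ} (hδ' : δ < 1 / 2)
    (hx : MemLp (fun s => ub (x, s) 0) 2 nu) (hflux : ∫ s, ub (x, s) 0 ∂nu = 0)
    (hy : y ∈ Ioo (-1 : ℝ) 1) (hyδ : 1 - 2 * δ ≤ |y|) :
    primY (fun p => ub p 0) (x, y) ^ 2 ≤ ∫ s in edgeSection δ, ub (x, s) 0 ^ 2 ∂nu := by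
  have hset : ∀ s : Set ℝ, s ⊆ edgeSection δ → (nu.restrict s).real univ ≤ 1 →
      (∫ r in s, ub (x, r) 0 ∂nu) ^ 2 ≤ ∫ s in edgeSection δ, ub (x, s) 0 ^ 2 ∂nu := by
    intro s hs hm
    refine (sq_integral_le (hx.restrict s) one_pos hm).trans ?_
    rw [one_mul]
    exact setIntegral_mono_set hx.integrable_sq.integrableOn
      (Eventually.of_forall fun _ => sq_nonneg _) (LE.le.eventuallyLE hs)
  have hreal : ∀ s t : Set ℝ, MeasurableSet s → s ∩ Ioo (-1) 1 ⊆ t → volume t ≤ 1 →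
      (nu.restrict s).real univ ≤ 1 := by
    intro s t hs hst ht
    rw [Measure.real, Measure.restrict_apply_univ, nu, Measure.restrict_apply hs]
    exact ENNReal.toReal_le_of_le_ofReal zero_le_one
      (((measure_mono hst).trans ht).trans_eq ENNReal.ofReal_one.symm)
  have hP : primY (fun p => ub p 0) (x, y) = ∫ s in Iic y, ub (x, s) 0 ∂nu := by
    rw [primY_eq hy, integral_indicator measurableSet_Iic]
  rcases le_total 0 y with h0 | h0
  · rw [abs_of_nonneg h0] at hyδ
    have h1 := integral_add_compl (μ := nu) (measurableSet_Iic (a := y)) (hx.integrable one_le_two)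
    rw [hflux, compl_Iic, ← hP] at h1
    rw [eq_neg_of_add_eq_zero_left h1, neg_sq]
    refine hset _ (fun s hs => ?_) (hreal _ (Ioc y 1) measurableSet_Ioi
      (fun s hs => ⟨hs.1, hs.2.2.le⟩) ?_)
    · have : y < s := hs
      exact (hyδ.trans this.le).trans (le_abs_self s)
    · rw [Real.volume_Ioc, ENNReal.ofReal_le_one]
      linarith
  · rw [abs_of_nonpos h0] at hyδ
    rw [hP]
    refine hset _ (fun s hs => ?_) (hreal _ (Ioc (-1) y) measurableSet_Iic
      (fun s hs => ⟨hs.2.1, hs.1⟩) ?_)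
    · have : s ≤ y := hs
      exact (hyδ.trans (neg_le_neg this)).trans (neg_le_abs s)
    · rw [Real.volume_Ioc, ENNReal.ofReal_le_one]
      linarith

section Edge

variable {ub : ℝ × ℝ → E2} {δ : ℝ} {χδ : ℝ → ℝ}

theorem measurableSet_edgeStrips (δ : ℝ) : MeasurableSet (edgeStrips δ) :=
  (MeasurableSet.univ.prod measurableSet_Icc).inter
    (measurableSet_edgeSection δ |>.preimage measurable_snd)

theorem memLp_edgeStrips (hu : IsL2div ub) : MemLp ub 2 (volume.restrict (edgeStrips δ)) :=
  hu.memLp.mono_measure (Measure.restrict_mono (fun _ hp => hp.1) le_rfl)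

theorem sq_normL2 {u : ℝ × ℝ → E2} {S : Set (ℝ × ℝ)} (hu : MemLp u 2 (volume.restrict S)) :
    normL2 u S ^ 2 = ∫ p in S, ‖u p‖ ^ 2 := by
  have h0 : 0 ≤ ∫ p in S, ‖u p‖ ^ 2 := integral_nonneg fun _ => sq_nonneg _
  rw [normL2, hu.eLpNorm_eq_integral_rpow_norm two_ne_zero ENNReal.ofNat_ne_top]
  simp only [ENNReal.toReal_ofNat, Real.rpow_two]
  rw [ENNReal.toReal_ofReal (by positivity), ← Real.rpow_natCast, ← Real.rpow_mul h0]
  norm_num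

theorem integral_edge_le (hu : IsL2div ub) :
    ∫ x : ℝ, ∫ s in edgeSection δ, ub (x, s) 0 ^ 2 ∂nu ≤ normL2 ub (edgeStrips δ) ^ 2 := by
  have hsq := (hu.memLp_coord 0).integrable_sq
  set S : Set (ℝ × ℝ) := univ ×ˢ edgeSection δ with hS
  have hSm : MeasurableSet S := MeasurableSet.univ.prod (measurableSet_edgeSection δ)
  have e : ((volume : Measure ℝ).prod nu).restrict S = volume.prod (nu.restrict (edgeSection δ)) := by
    rw [hS, ← Measure.prod_restrict, Measure.restrict_univ]
  have e2 : ((volume : Measure ℝ).prod nu).restrict S = volume.restrict (edgeStrips δ) := by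
    rw [← volume_restrict_band, Measure.restrict_restrict hSm]
    congr 1
    ext p
    simp [hS, edgeStrips, edgeSection, and_comm]
  have hi := hsq.restrict (s := S)
  have h1 := integral_prod (fun p => ub p 0 ^ 2) (e ▸ hi)
  rw [← h1, ← e, e2, sq_normL2 (memLp_edgeStrips hu)]
  rw [e2] at hi
  refine integral_mono hi ((memLp_edgeStrips hu).norm.integrable_sq) fun p => ?_
  have := PiLp.norm_apply_le (ub p) 0
  simp only
  rw [← sq_abs (ub p 0), ← Real.norm_eq_abs]
  gcongr

theorem IsInteriorCutoff.dI_eq_zero (hχ : IsInteriorCutoff δ χδ) {y : ℝ} (hy : y ∈ I)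
    (h : |y| < 1 - 2 * δ) : dI χδ y = 0 :=
  dI_eq_zero_of_const (s := {x | |x| < 1 - 2 * δ}) (c := 1)
    (isOpen_lt continuous_abs continuous_const) h (fun x hx => hχ.eq_one x hx.2 hx.1.le) hy

theorem integral_sq_dI_le (hχ : IsInteriorCutoff δ χδ) :
    ∫ y, dI χδ y ^ 2 ∂nu ≤ normH1 χδ ^ 2 := by
  have c1 : ContinuousOn (fun y => dI χδ y ^ 2) (Icc (-1) 1) :=
    (contDiffOn_dI hχ.smooth).continuousOn.pow 2
  have c2 : ContinuousOn (fun y => χδ y ^ 2) (Icc (-1) 1) := hχ.smooth.continuousOn.pow 2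
  have i1 : IntegrableOn (fun y => dI χδ y ^ 2) (Ioo (-1) 1) :=
    (c1.integrableOn_compact isCompact_Icc).mono_set Ioo_subset_Icc_self
  have i2 : IntegrableOn (fun y => χδ y ^ 2 + dI χδ y ^ 2) (Ioo (-1) 1) :=
    ((c2.add c1).integrableOn_compact isCompact_Icc).mono_set Ioo_subset_Icc_self
  rw [normH1, intervalIntegral.integral_of_le (by norm_num), integral_Ioc_eq_integral_Ioo,
    Real.sq_sqrt (integral_nonneg fun y => by positivity)]
  exact integral_mono i1 i2 fun y => by
    simp only
    linarith [sq_nonneg (χδ y)]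

theorem normH1_nonneg (f : ℝ → ℝ) : 0 ≤ normH1 f := Real.sqrt_nonneg _

theorem normL2_nonneg (u : ℝ × ℝ → E2) (S : Set (ℝ × ℝ)) : 0 ≤ normL2 u S := ENNReal.toReal_nonneg

/-- The square is dominated by a function of `x` times `χ_δ'(y)²`, so its integral factorises. The
derivative vanishes for `|y| < 1 - 2δ`, which is where the edge bound on the primitive is
unavailable. `D` is free up to sign so that the derivative of `1 - χ_δ` qualifies. -/
theorem eLpNorm_stream_edge_le (hδ' : δ < 1 / 2) (hu : IsL2div ub)
    (hχ : IsInteriorCutoff δ χδ) {D : ℝ → ℝ} (hD : ∀ y ∈ I, |D y| = |dI χδ y|) :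
    eLpNorm (fun p => (D p.2 * primY (fun p => ub p 0) p) • ex) 2
      ((volume : Measure ℝ).prod nu) ≤
        ENNReal.ofReal (normH1 χδ * normL2 ub (edgeStrips δ)) := by
  set N : ℝ → ℝ := fun x => ∫ s in edgeSection δ, ub (x, s) 0 ^ 2 ∂nu with hN
  have hN0 : ∀ x, 0 ≤ N x := fun x => integral_nonneg fun _ => sq_nonneg _
  have hu0 := hu.memLp_coord 0
  have hNi : Integrable N := by
    have h1 : Integrable (fun p => ub p 0 ^ 2)
        ((volume : Measure ℝ).prod (nu.restrict (edgeSection δ))) :=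
      hu0.integrable_sq.mono_measure (Measure.prod_mono le_rfl Measure.restrict_le_self)
    exact h1.integral_prod_left
  have hdi : Integrable (fun y => dI χδ y ^ 2) nu :=
    (((contDiffOn_dI hχ.smooth).continuousOn.pow 2).integrableOn_compact isCompact_Icc).mono_set
      Ioo_subset_Icc_self
  have hd0 : 0 ≤ ∫ y, dI χδ y ^ 2 ∂nu := integral_nonneg fun _ => sq_nonneg _
  have hpt : ∀ᵐ p ∂((volume : Measure ℝ).prod nu),
      (D p.2 * primY (fun p => ub p 0) p) ^ 2 ≤ N p.1 * dI χδ p.2 ^ 2 := by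
    filter_upwards [ae_snd_mem, ae_fst_of_ae (memLp_slice hu0), ae_fst_of_ae hu.flux_eq_zero]
      with p hp h1 h2
    have hpI : p.2 ∈ I := Ioo_subset_Icc_self hp
    rw [mul_pow, ← sq_abs (D _), hD _ hpI, sq_abs, mul_comm]
    rcases lt_or_ge |p.2| (1 - 2 * δ) with h3 | h3
    · rw [hχ.dI_eq_zero hpI h3]
      simp
    · gcongr
      exact sq_primY_le_edge hδ' h1 h2 hp h3
  have hlint : ∫⁻ p, ‖(D p.2 * primY (fun p => ub p 0) p) • ex‖ₑ ^ (2 : ℝ)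
      ∂((volume : Measure ℝ).prod nu) ≤
      ENNReal.ofReal ((normH1 χδ * normL2 ub (edgeStrips δ)) ^ 2) := by
    calc _ ≤ ∫⁻ p, ENNReal.ofReal (N p.1) * ENNReal.ofReal (dI χδ p.2 ^ 2)
          ∂((volume : Measure ℝ).prod nu) := by
          refine lintegral_mono_ae ?_
          filter_upwards [hpt] with p hp
          rw [enorm_smul, ← ofReal_norm ex, norm_ex, ENNReal.ofReal_one, mul_one,
            Real.enorm_eq_ofReal_abs, ENNReal.ofReal_rpow_of_nonneg (abs_nonneg _) zero_le_two,
            ← ENNReal.ofReal_mul (hN0 _), Real.rpow_two, sq_abs]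
          exact ENNReal.ofReal_le_ofReal hp
      _ = (∫⁻ x, ENNReal.ofReal (N x)) * ∫⁻ y, ENNReal.ofReal (dI χδ y ^ 2) ∂nu :=
          lintegral_prod_mul (f := fun x => ENNReal.ofReal (N x))
            (g := fun y => ENNReal.ofReal (dI χδ y ^ 2))
            hNi.aestronglyMeasurable.aemeasurable.ennreal_ofReal
            hdi.aestronglyMeasurable.aemeasurable.ennreal_ofReal
      _ = ENNReal.ofReal (∫ x, N x) * ENNReal.ofReal (∫ y, dI χδ y ^ 2 ∂nu) := by
          rw [ofReal_integral_eq_lintegral_ofReal hNi (Eventually.of_forall hN0),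
            ofReal_integral_eq_lintegral_ofReal hdi (Eventually.of_forall fun _ => sq_nonneg _)]
      _ ≤ ENNReal.ofReal (normL2 ub (edgeStrips δ) ^ 2) * ENNReal.ofReal (normH1 χδ ^ 2) := by
          gcongr
          · exact integral_edge_le hu
          · exact integral_sq_dI_le hχ
      _ = _ := by rw [← ENNReal.ofReal_mul (sq_nonneg _), mul_pow, mul_comm]
  rw [eLpNorm_eq_lintegral_rpow_enorm_toReal two_ne_zero ENNReal.ofNat_ne_top,
    ENNReal.toReal_ofNat]
  calc _ ≤ (ENNReal.ofReal ((normH1 χδ * normL2 ub (edgeStrips δ)) ^ 2)) ^ (1 / 2 : ℝ) := by gcongr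
    _ = _ := by
        rw [ENNReal.ofReal_rpow_of_nonneg (by positivity) (by norm_num), ← Real.sqrt_eq_rpow,
          Real.sqrt_sq (mul_nonneg (normH1_nonneg _) (normL2_nonneg _ _))]

theorem eLpNorm_cutoff_smul_le (hu : IsL2div ub) (hχ : IsInteriorCutoff δ χδ) :
    eLpNorm (fun p => (1 - χδ p.2) • ub p) 2 ((volume : Measure ℝ).prod nu) ≤
      ENNReal.ofReal (normL2 ub (edgeStrips δ)) := by
  rw [normL2, ENNReal.ofReal_toReal (memLp_edgeStrips hu).2.ne]
  have h1 : eLpNorm (fun p => (1 - χδ p.2) • ub p) 2 ((volume : Measure ℝ).prod nu) ≤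
      eLpNorm ((edgeStrips δ).indicator ub) 2 ((volume : Measure ℝ).prod nu) := by
    refine eLpNorm_mono_ae ?_
    filter_upwards [ae_snd_mem] with p hp
    have hpI : p.2 ∈ I := Ioo_subset_Icc_self hp
    by_cases h : 1 - 2 * δ ≤ |p.2|
    · rw [indicator_of_mem (show p ∈ edgeStrips δ from ⟨⟨mem_univ _, hpI⟩, h⟩), norm_smul]
      refine mul_le_of_le_one_left (norm_nonneg _) ?_
      have := hχ.range _ hpI
      rw [Real.norm_eq_abs, abs_le]
      exact ⟨by linarith [this.2], by linarith [this.1]⟩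
    · rw [hχ.eq_one _ hpI (not_le.1 h).le]
      simp
  refine h1.trans ?_
  rw [eLpNorm_indicator_eq_eLpNorm_restrict (measurableSet_edgeStrips δ), ← volume_restrict_band,
    Measure.restrict_restrict (measurableSet_edgeStrips δ)]
  exact eLpNorm_mono_measure _ (Measure.restrict_mono inter_subset_left le_rfl)

/-- The perpendicular gradient of the boundary part of the stream function is controlled by the
field near the boundary. -/
theorem IsPerpGrad.eLpNorm_edge_le {g : ℝ × ℝ → E2} (hδ' : δ < 1 / 2)
    (hu : IsL2div ub) (hχ : IsInteriorCutoff δ χδ)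
    (hg : IsPerpGrad (fun p => (1 - χδ p.2) * streamFunction ub p) g) (L : ℝ) :
    MemLp g 2 (volume.restrict (Omega L)) ∧ eLpNorm g 2 (volume.restrict (Omega L)) ≤
      ENNReal.ofReal ((1 + normH1 χδ) * normL2 ub (edgeStrips δ)) := by
  have hA : ContDiffOn ℝ ∞ (fun y => 1 - χδ y) I := contDiffOn_const.sub hχ.smooth
  have hae := IsPerpGrad.ae_eq (A := fun y => 1 - χδ y) hu hA hg
  have hD : ∀ y ∈ I, |dI (fun y => 1 - χδ y) y| = |dI χδ y| := by
    intro y _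
    rw [dI, derivWithin_const_sub, abs_neg]
    rfl
  have hP := memLp_primY (hu.memLp_coord 0)
  have hub : MemLp ub 2 ((volume : Measure ℝ).prod nu) := volume_restrict_band ▸ hu.memLp
  have m1 : MemLp (fun p => (dI (fun y => 1 - χδ y) p.2 * primY (fun p => ub p 0) p) • ex) 2
      ((volume : Measure ℝ).prod nu) := by
    refine (memLp_weight_smul (contDiffOn_dI hA) hP).of_le_mul (c := 1) ?_ ?_
    · exact (memLp_weight_smul (contDiffOn_dI hA) hP).1.smul_const ex
    · refine Eventually.of_forall fun p => ?_
      rw [norm_smul, norm_ex, mul_one, one_mul]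
      rfl
  have m2 : MemLp (fun p => (1 - χδ p.2) • ub p) 2 ((volume : Measure ℝ).prod nu) :=
    memLp_weight_smul hA hub
  have hle : volume.restrict (Omega L) ≤ (volume : Measure ℝ).prod nu := by
    rw [← volume_restrict_openBand]
    exact Measure.restrict_mono (prod_mono (subset_univ _) subset_rfl) le_rfl
  have hgL : MemLp g 2 ((volume : Measure ℝ).prod nu) :=
    (memLp_congr_ae hae).2 (m1.add m2)
  refine ⟨hgL.mono_measure hle, (eLpNorm_mono_measure _ hle).trans ?_⟩
  rw [eLpNorm_congr_ae hae]
  refine (eLpNorm_add_le m1.1 m2.1 one_le_two).trans ?_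
  refine (add_le_add (eLpNorm_stream_edge_le hδ' hu hχ hD) (eLpNorm_cutoff_smul_le hu hχ)).trans_eq ?_
  rw [← ENNReal.ofReal_add (mul_nonneg (normH1_nonneg _) (normL2_nonneg _ _)) (normL2_nonneg _ _)]
  congr 1
  ring

end Edge

/-! ### The approximate trajectory at the final time -/

theorem IsBaseFlow.integral_eq_zero {T L : ℝ} {n : ℕ} {h : ℝ → ℝ} (hh : IsBaseFlow T L n h)
    (hT : 0 < T) (hn : 0 < n) {t : ℝ} (ht : T ≤ t) : ∫ s in (0)..t, h s = 0 := by
  have h0 : ∫ s in (0)..T, h s = 0 := by simpa using hh.moments 0 hn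
  have hc : ∀ a b : ℝ, 0 ≤ a → 0 ≤ b → IntervalIntegrable h volume a b := fun a b ha hb =>
    (hh.smooth.continuousOn.mono fun x hx => (le_min ha hb).trans hx.1).intervalIntegrable
  rw [← intervalIntegral.integral_add_adjacent_intervals (hc 0 T le_rfl hT.le)
    (hc T t hT.le (hT.le.trans ht)), h0, zero_add]
  refine intervalIntegral.integral_zero_ae (Eventually.of_forall fun s hs => ?_)
  rw [uIoc_of_le ht] at hs
  exact hh.eq_zero_of_ge hT hs.1.le

/-- The vanishing zeroth moment brings every particle back to its starting abscissa, so both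
translations are the identity. -/
theorem uAppFormula_final {T L : ℝ} {n : ℕ} {h φ χ β : ℝ → ℝ} {V W : ℝ → ℝ → ℝ}
    {g g' : ℝ × ℝ → E2} (hh : IsBaseFlow T L n h) (hT : 0 < T) (hn : 0 < n)
    (hβ : IsTimeCutoff T β) (ε : ℝ) {t : ℝ} (ht : T ≤ t) :
    uAppFormula h φ χ V W (profileOne h β g g') ε t = fun p =>
      (χ p.2 * -V t (φ p.2 / Real.sqrt ε)) • ex + ε • g' p + (ε ^ 2 * W t p.2) • ex := by
  ext1 p
  rw [uAppFormula, profileOne, translate, translate, hh.integral_eq_zero hT hn ht,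
    hh.eq_zero_of_ge hT ht, hβ.eq_zero t (by linarith)]
  simp only [zero_smul, zero_add, sub_zero, Prod.mk.eta, smul_smul]

/-- The three remaining terms are estimated separately. The middle one carries no `C`, since its
constant may depend only on `χ_δ`. -/
theorem exists_final_bound {T L δ : ℝ} {n : ℕ} {h φ χ β χδ : ℝ → ℝ} {ub : ℝ × ℝ → E2}
    (hT : 0 < T) (hL : 0 < L) (hδ' : δ < 1 / 2) (hn : 0 < n)
    (hh : IsBaseFlow T L n h) (hφ : IsBoundaryDistance φ) (hχ : IsBoundaryCutoff χ)
    (hβ : IsTimeCutoff T β) (hχδ : IsInteriorCutoff δ χδ) (hu : IsL2div ub) {m : ℝ} (hm : 0 ≤ m) :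
    ∃ C, 0 ≤ C ∧ ∀ ε t, 0 < ε → 2 * T ≤ t → ∀ u, IsUApp h φ χ β χδ ub ε u →
      MemLp (u t) 2 (volume.restrict (Omega L)) ∧
      normL2 (u t) (Omega L) ≤ C * (t ^ (-1 - n : ℝ) * (ε * t) ^ (1 / 4 : ℝ)) +
        ε * ((1 + normH1 χδ) * normL2 ub (edgeStrips δ)) + C * (ε ^ 2 * ((ε * t) ^ m * t)) := by
  obtain ⟨C₁, hC₁, H₁⟩ := exists_eLpNorm_layer_le hh hT hL hφ hχ
  obtain ⟨C₂, hC₂, H₂⟩ := exists_abs_technicalProfile_le hh hT hφ hχ hm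
  refine ⟨C₁ + Real.sqrt L * (2 * C₂), by positivity, fun ε t hε ht u ⟨V, W, g, g', hV, hW, _, hg',
    hueq⟩ => ?_⟩
  have ht0 : 0 < t := by linarith
  rw [hueq, uAppFormula_final hh hT hn hβ ε (by linarith : T ≤ t)]
  obtain ⟨mg, eg⟩ := hg'.eLpNorm_edge_le hδ' hu hχδ L
  have hlay := H₁ V hV ε t hε ht
  have hWb := H₂ V hV ε W hε hW t ht0
  have hVc : ContinuousOn (fun y => χ y * -V t (φ y / Real.sqrt ε)) (Ioo (-1) 1) := by
    refine (hχ.smooth.continuousOn.mono Ioo_subset_Icc_self).mul (ContinuousOn.neg ?_)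
    refine hV.cont.comp (f := fun y => (t, φ y / Real.sqrt ε)) ?_ ?_
    · exact continuousOn_const.prodMk
        ((hφ.smooth.continuousOn.mono Ioo_subset_Icc_self).div_const _)
    · exact fun y hy => ⟨ht0.le, div_nonneg (hφ.range y (Ioo_subset_Icc_self hy)).1
        (Real.sqrt_nonneg _)⟩
  have hWc : ContinuousOn (fun y => ε ^ 2 * W t y) (Ioo (-1) 1) := by
    refine ContinuousOn.const_mul ?_ _
    exact hW.cont.comp (f := fun y => (t, y)) (by fun_prop)
      fun y hy => ⟨ht0.le, Ioo_subset_Icc_self hy⟩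
  have s1 := aestronglyMeasurable_shear hVc L
  have s3 := aestronglyMeasurable_shear hWc L
  set X := t ^ (-1 - n : ℝ) * (ε * t) ^ (1 / 4 : ℝ) with hX
  set Y := ε ^ 2 * ((ε * t) ^ m * t) with hY
  have hX0 : 0 ≤ X := by positivity
  have hY0 : 0 ≤ Y := by positivity
  have hG0 : 0 ≤ (1 + normH1 χδ) * normL2 ub (edgeStrips δ) :=
    mul_nonneg (by linarith [normH1_nonneg χδ]) (normL2_nonneg _ _)
  have hlast : eLpNorm (fun p : ℝ × ℝ => (ε ^ 2 * W t p.2) • ex) 2 (volume.restrict (Omega L)) ≤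
      ENNReal.ofReal (Real.sqrt L * (2 * (C₂ * Y))) := by
    refine eLpNorm_shear_le_of_bound (f := fun y => ε ^ 2 * W t y) hL.le (by positivity)
      fun y hy => ?_
    rw [abs_mul, abs_of_pos (by positivity : 0 < ε ^ 2), hY]
    calc ε ^ 2 * |W t y| ≤ ε ^ 2 * (C₂ * (ε * t) ^ m * t) :=
          mul_le_mul_of_nonneg_left (hWb y (Ioo_subset_Icc_self hy)) (by positivity)
      _ = _ := by ring
  have hmid : eLpNorm (fun p => ε • g' p) 2 (volume.restrict (Omega L)) ≤
      ENNReal.ofReal (ε * ((1 + normH1 χδ) * normL2 ub (edgeStrips δ))) := by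
    have := eLpNorm_const_smul ε g' 2 (volume.restrict (Omega L))
    rw [show (fun p => ε • g' p) = ε • g' from rfl, this, Real.enorm_eq_ofReal hε.le,
      ENNReal.ofReal_mul hε.le]
    gcongr
  have m1 : MemLp (fun p : ℝ × ℝ => (χ p.2 * -V t (φ p.2 / Real.sqrt ε)) • ex) 2
      (volume.restrict (Omega L)) := ⟨s1, hlay.trans_lt ENNReal.ofReal_lt_top⟩
  have m2 : MemLp (fun p => ε • g' p) 2 (volume.restrict (Omega L)) := mg.const_smul ε
  have m3 : MemLp (fun p : ℝ × ℝ => (ε ^ 2 * W t p.2) • ex) 2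
      (volume.restrict (Omega L)) := ⟨s3, hlast.trans_lt ENNReal.ofReal_lt_top⟩
  refine ⟨(m1.add m2).add m3, ?_⟩
  have htri := (eLpNorm_add_le (m1.1.add m2.1) m3.1 one_le_two).trans (add_le_add
    ((eLpNorm_add_le m1.1 m2.1 one_le_two).trans (add_le_add hlay hmid)) hlast)
  rw [← ENNReal.ofReal_add (by positivity) (by positivity),
    ← ENNReal.ofReal_add (by positivity) (by positivity)] at htri
  refine (ENNReal.toReal_le_of_le_ofReal (by positivity) htri).trans ?_
  have e1 : 0 ≤ Real.sqrt L * (2 * C₂) * X := by positivity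
  have e2 : 0 ≤ C₁ * Y := by positivity
  linarith

end ApproxTrajectory

end

/-! ### Counting powers of `ε` at the time `T / ε ^ κ`. -/

open ApproxTrajectory
theorem mainTheorem5 :
    ∃ K : ℝ → ℝ, (∀ r, 0 < K r) ∧
      ∀ (T L κ δ : ℝ) (n : ℕ) (h φ χ β χδ : ℝ → ℝ) (ub : ℝ × ℝ → E2),
        0 < T → 0 < L → 0 < κ → κ < 1 → 0 < δ → δ < 1 / 2 →
        3 ≤ n → 3 / 4 * (1 / κ - 1) < (n : ℝ) →
        IsBaseFlow T L n h → IsBoundaryDistance φ → IsBoundaryCutoff χ →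
        IsTimeCutoff T β → IsInteriorCutoff δ χδ → IsL2div ub →
        ∃ Capp : ℝ, 0 < Capp ∧ ∃ ε₀ : ℝ, 0 < ε₀ ∧
          ∀ ε : ℝ, 0 < ε → ε < ε₀ →
            ∀ u : ℝ → ℝ × ℝ → E2, IsUApp h φ χ β χδ ub ε u →
              MemLp (u (T / ε ^ κ)) 2 (volume.restrict (Omega L)) ∧
              1 / ε * normL2 (u (T / ε ^ κ)) (Omega L) ≤
                Capp * (ε ^ (1 / 4 : ℝ) +
                  ε ^ (κ * ((n : ℝ) - 3 / 4 * (1 / κ - 1))) *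
                    |Real.log ε| ^ ((n : ℝ) + 3 / 4)) +
                K (normH1 χδ) * normL2 ub (edgeStrips δ) := by
  -- The absolute value only ensures positivity for every real `r`; the `H¹` norm is nonnegative.
  refine ⟨fun r => 1 + |r|, fun r => by positivity, ?_⟩
  intro T L κ δ n h φ χ β χδ ub hT hL hκ hκ1 _ hδ' hn _ hh hφ hχ hβ hχδ hu
  have hκ' : 0 < 1 - κ := by linarith
  -- Since `ε t = T ε^(1-κ)`, the choice `m = 1/(1-κ)` makes `(ε t)^m` equal to `T^m ε`.
  obtain ⟨C, hC, H⟩ := exists_final_bound (m := 1 / (1 - κ)) hT hL hδ' (by omega) hh hφ hχ hβ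
    hχδ hu (by positivity)
  set B := T ^ (-(n : ℝ) - 3 / 4) + T ^ (1 / (1 - κ) + 1) with hB
  have hB0 : 0 < B := by positivity
  -- The bound `e⁻¹` gives `|ln ε| ≥ 1`; the bound `(1/2)^(1/κ)` gives `ε^κ ≤ 1/2`, hence `t ≥ 2T`.
  refine ⟨C * B + 1, by positivity, min (Real.exp (-1)) ((1 / 2) ^ (1 / κ)), by positivity, ?_⟩
  intro ε hε hε₀ u hu'
  have hε1 : ε < Real.exp (-1) := hε₀.trans_le (min_le_left _ _)
  have hε2 : ε < (1 / 2 : ℝ) ^ (1 / κ) := hε₀.trans_le (min_le_right _ _)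
  have hεlt1 : ε < 1 := hε1.trans (by rw [Real.exp_lt_one_iff]; norm_num)
  have hεκ : ε ^ κ ≤ 1 / 2 := by
    have := Real.rpow_le_rpow hε.le hε2.le hκ.le
    rwa [← Real.rpow_mul (by norm_num), one_div_mul_cancel hκ.ne', Real.rpow_one] at this
  have hεκ0 : 0 < ε ^ κ := by positivity
  have ht : 2 * T ≤ T / ε ^ κ := by
    rw [le_div_iff₀ hεκ0]
    nlinarith
  have hlog : 1 ≤ |Real.log ε| := by
    have := (Real.log_lt_log hε hε1)
    rw [Real.log_exp] at this
    rw [abs_of_neg (by linarith)]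
    linarith
  obtain ⟨hmem, hbound⟩ := H ε _ hε ht u hu'
  refine ⟨hmem, ?_⟩
  set t := T / ε ^ κ with htdef
  have htrw : t = T * ε ^ (-κ) := by rw [htdef, Real.rpow_neg hε.le, div_eq_mul_inv]
  have hεt : ε * t = T * ε ^ (1 - κ) := by
    rw [htrw, sub_eq_add_neg, Real.rpow_add hε, Real.rpow_one]
    ring
  -- The exponent of `ε` is `-1 + κ(1 + n) + (1 - κ)/4 = κ n - 3/4 (1 - κ)`.
  have p1 : 1 / ε * (t ^ (-1 - n : ℝ) * (ε * t) ^ (1 / 4 : ℝ)) =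
      T ^ (-(n : ℝ) - 3 / 4) * ε ^ (κ * ((n : ℝ) - 3 / 4 * (1 / κ - 1))) := by
    rw [hεt, htrw, Real.mul_rpow hT.le (by positivity), Real.mul_rpow hT.le (by positivity),
      ← Real.rpow_mul hε.le, ← Real.rpow_mul hε.le, one_div ε, ← Real.rpow_neg_one ε]
    calc _ = (T ^ (-1 - n : ℝ) * T ^ (1 / 4 : ℝ)) *
          (ε ^ (-1 : ℝ) * ε ^ (-κ * (-1 - n)) * ε ^ ((1 - κ) * (1 / 4))) := by ring
      _ = _ := by
          rw [← Real.rpow_add hT, ← Real.rpow_add hε, ← Real.rpow_add hε]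
          congr 2
          · ring
          · field_simp
            ring
  -- The left side equals `T^(m+1) ε^(2-κ)`, far smaller than `ε^(1/4)`.
  have p2 : 1 / ε * (ε ^ 2 * ((ε * t) ^ (1 / (1 - κ)) * t)) ≤
      T ^ (1 / (1 - κ) + 1) * ε ^ (1 / 4 : ℝ) := by
    have e : 1 / ε * (ε ^ 2 * ((ε * t) ^ (1 / (1 - κ)) * t)) =
        T ^ (1 / (1 - κ) + 1) * (ε * ε ^ (1 - κ)) := by
      have e1 : (ε * t) ^ (1 / (1 - κ)) = T ^ (1 / (1 - κ)) * ε := by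
        rw [hεt, Real.mul_rpow hT.le (by positivity), ← Real.rpow_mul hε.le,
          mul_one_div_cancel hκ'.ne', Real.rpow_one]
      rw [e1, Real.rpow_add hT, Real.rpow_one]
      calc _ = T ^ (1 / (1 - κ)) * ε * (ε * t) := by field_simp
        _ = _ := by rw [hεt]; ring
    rw [e]
    have e3 : ε * ε ^ (1 - κ) ≤ ε ^ (1 / 4 : ℝ) := by
      calc ε * ε ^ (1 - κ) ≤ ε * 1 :=
            mul_le_mul_of_nonneg_left (Real.rpow_le_one hε.le hεlt1.le hκ'.le) hε.le
        _ = ε ^ (1 : ℝ) := by rw [mul_one, Real.rpow_one]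
        _ ≤ ε ^ (1 / 4 : ℝ) :=
            Real.rpow_le_rpow_of_exponent_ge hε hεlt1.le (by norm_num)
    gcongr
  set E := ε ^ (κ * ((n : ℝ) - 3 / 4 * (1 / κ - 1))) with hE
  set G := |Real.log ε| ^ ((n : ℝ) + 3 / 4) with hG
  have hG1 : 1 ≤ G := Real.one_le_rpow hlog (by positivity)
  have hE0 : 0 ≤ E := by positivity
  have hEG : E ≤ E * G := le_mul_of_one_le_right hE0 hG1
  set Q := ε ^ (1 / 4 : ℝ) with hQ
  have hQ0 : 0 ≤ Q := by positivity
  have hT1 : 0 < T ^ (-(n : ℝ) - 3 / 4) := by positivity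
  have hT2 : 0 < T ^ (1 / (1 - κ) + 1) := by positivity
  set R := normL2 ub (edgeStrips δ)
  calc 1 / ε * normL2 (u t) (Omega L)
      ≤ 1 / ε * (C * (t ^ (-1 - n : ℝ) * (ε * t) ^ (1 / 4 : ℝ)) + ε * ((1 + normH1 χδ) * R) +
          C * (ε ^ 2 * ((ε * t) ^ (1 / (1 - κ)) * t))) := by gcongr
    _ = C * (1 / ε * (t ^ (-1 - n : ℝ) * (ε * t) ^ (1 / 4 : ℝ))) +
          C * (1 / ε * (ε ^ 2 * ((ε * t) ^ (1 / (1 - κ)) * t))) + (1 + normH1 χδ) * R := by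
        field_simp
        ring
    _ ≤ C * (T ^ (-(n : ℝ) - 3 / 4) * E) + C * (T ^ (1 / (1 - κ) + 1) * Q) +
          (1 + normH1 χδ) * R := by
        rw [p1]
        gcongr
    _ ≤ C * (B * (E * G)) + C * (B * Q) + (1 + normH1 χδ) * R := by
        gcongr
        · linarith
        · linarith
    _ ≤ (C * B + 1) * (Q + E * G) + (1 + |normH1 χδ|) * R := by
        rw [abs_of_nonneg (normH1_nonneg χδ)]
        have : 0 ≤ E * G := hE0.trans hEG
        linarith
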